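/- Let $m\ge 0$ and let $\sigma_1=\begin{pmatrix}0&1\\1&0\end{pmatrix}$, $\sigma_2=\begin{pmatrix}0&-i\\i&0\end{pmatrix}$, $\sigma_3=\begin{pmatrix}1&0\\0&-1\end{pmatrix}$. In $L^2(\mathbb R;\mathbb C^2)$ let $S$ and $T$ be the operators acting as $f\mapsto -i\sigma_1 f'+m\sigma_3 f$ (weak derivative on $(0,\infty)$ and on $(-\infty,0)$) with $$\operatorname{dom}S=H^1_0((0,\infty);\mathbb C^2)\oplus H^1_0((-\infty,0);\mathbb C^2),\qquad \operatorname{dom}T=H^1((0,\infty);\mathbb C^2)\oplus H^1((-\infty,0);\mathbb C^2),$$ and let $A_0f=-i\sigma_1f'+m\sigma_3f$, $\operatorname{dom}A_0=H^1(\mathbb R;\mathbb C^2)$, be the free Dirac operator. For $f\in\operatorname{dom}T$ set $$\Gamma_0f=-i\sigma_1\big(f(0+)-f(0-)\big),\qquad \Gamma_1f=\tfrac12\big(f(0+)+f(0-)\big).$$ For $w\in\mathbb C\setminus[0,\infty)$ let $\sqrt w$ be the square root with positive imaginary part, and for $z\in\mathbb C\setminus((-\infty,-m]\cup[m,\infty))$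 put $k(z)=\sqrt{z^2-m^2}$, $\zeta(z)=(z+m)/k(z)$, $$G_z(x)=\frac i2e^{ik(z)|x|}\begin{pmatrix}\zeta(z)&\operatorname{sgn}x\\ \operatorname{sgn}x&\zeta(z)^{-1}\end{pmatrix},\qquad M(z)=\frac i2\begin{pmatrix}\zeta(z)&0\\0&\zeta(z)^{-1}\end{pmatrix}.$$ The discrete spectrum $\sigma_{\rm disc}$ of a self-adjoint operator is the set of isolated points of its spectrum that are eigenvalues of finite multiplicity, and $\sigma_{\rm ess}=\sigma\setminus\sigma_{\rm disc}$. (1) $S$ is densely defined, closed and symmetric, $S^*=T$, and $\{\mathbb C^2,\Gamma_0,\Gamma_1\}$ is an ordinary boundary triple for $S^*$: one has $(Tf,g)-(f,Tg)=(\Gamma_1f,\Gamma_0g)-(\Gamma_0f,\Gamma_1g)$ for all $f,g\in\operatorname{dom}T$, the map $(\Gamma_0,\Gamma_1):\operatorname{dom}T\to\mathbb C^2\times\mathbb C^2$ is surjective, and $T\upharpoonright\ker\Gamma_0$ is self-adjoint. Moreover $T\upharpoonright\ker\Gamma_0=A_0$ and $\rho(A_0)=\mathbb C\setminus((-\infty,-m]\cup[m,\infty))$.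 For $z\in\rho(A_0)$ the restriction of $\Gamma_0$ to $\ker(T-z)$ is a bijection onto $\mathbb C^2$, the $\gamma$-field $\gamma(z)=(\Gamma_0\upharpoonright\ker(T-z))^{-1}$ is given by $[\gamma(z)\xi](x)=G_z(x)\xi$ for $\xi\in\mathbb C^2$ and almost every $x\in\mathbb R$, and the Weyl function $\Gamma_1\gamma(z)$ is the matrix $M(z)$. (2) Let $\eta,\tau,\lambda\in\mathbb R$, $P=\eta I_2+\tau\sigma_3-\lambda\sigma_2$, $d=\eta^2-\tau^2-\lambda^2$, and $A_{\eta,\tau,\lambda}=S^*\upharpoonright\ker(\Gamma_0+P\Gamma_1)$. Then $A_{\eta,\tau,\lambda}$ is self-adjoint in $L^2(\mathbb R;\mathbb C^2)$. For all $z\in\rho(A_0)\cap\rho(A_{\eta,\tau,\lambda})$ the matrix $I_2+PM(z)$ is invertible, the functions $$g_{z,j}(x)=\frac i2\Big((I_2+PM(z))^{-1}P\,G_z(-x)\Big)^{\top}e_j,\qquad j\in\{1,2\},$$ where $e_1,e_2$ is the standard basis of $\mathbb C^2$, belong to $L^2(\mathbb R;\mathbb C^2)$, and for all $f\in L^2(\mathbb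 R;\mathbb C^2)$, with the inner product linear in the first entry, $$(A_{\eta,\tau,\lambda}-z)^{-1}f=(A_0-z)^{-1}f-(g_{z,1},\overline f)_{L^2}\begin{pmatrix}\zeta(z)\\ \operatorname{sgn}(\cdot)\end{pmatrix}e^{ik(z)|\cdot|}-(g_{z,2},\overline f)_{L^2}\begin{pmatrix}\operatorname{sgn}(\cdot)\\ \zeta(z)^{-1}\end{pmatrix}e^{ik(z)|\cdot|}.$$ Moreover: (i) $\sigma_{\rm ess}(A_{\eta,\tau,\lambda})=\sigma_{\rm ess}(A_0)=(-\infty,-m]\cup[m,\infty)$. (ii) Assume $m>0$. If $d=4$, then $\sigma_{\rm disc}(A_{\eta,\tau,\lambda})=\{-m\tau/\eta\}$. If $d\ne4$, then $\sigma_{\rm disc}(A_{\eta,\tau,\lambda})$ consists of exactly those of the two numbers $$z_\pm=m\,\frac{-\eta\tau\pm\left|\frac d4-1\right|\sqrt{\lambda^2+\left(\frac d4+1\right)^2}}{\eta^2+\left(\frac d4-1\right)^2}$$ that satisfy $(d-4)(m\tau+\eta z_\pm)>0$. -/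

import Mathlib

open MeasureTheory Set Filter Topology
open scoped ContDiff ComplexConjugate ENNReal LinearPMap Matrix

noncomputable section

namespace DeltaDirac

/-! ### Unbounded operators: restrictions, resolvent, spectrum -/

section Operators

variable {H G : Type*} [NormedAddCommGroup H] [InnerProductSpace ℂ H] [CompleteSpace H]
  [NormedAddCommGroup G] [InnerProductSpace ℂ G]

/-- The restriction `T ↾ ker L` of `T` to the kernel of a linear map `L : dom T → G`. -/
def restrictKer (T : H →ₗ.[ℂ] H) (L : T.domain →ₗ[ℂ] G) : H →ₗ.[ℂ] H :=
  T.domRestrict ((LinearMap.ker L).map T.domain.subtype)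

/-- `R` is the bounded, everywhere defined inverse `(A - z)⁻¹`. -/
def IsResolvent (A : H →ₗ.[ℂ] H) (z : ℂ) (R : H →L[ℂ] H) : Prop :=
  (∀ f : H, ∃ h : R f ∈ A.domain, A ⟨R f, h⟩ - z • R f = f) ∧
    ∀ u : A.domain, R (A u - z • (u : H)) = u

/-- The resolvent set `ρ(A)`. -/
def resSet (A : H →ₗ.[ℂ] H) : Set ℂ := {z | ∃ R : H →L[ℂ] H, IsResolvent A z R}

open Classical in
/-- The resolvent `(A - z)⁻¹` for `z ∈ ρ(A)` (and `0` for other `z`). -/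
def resolventOp (A : H →ₗ.[ℂ] H) (z : ℂ) : H →L[ℂ] H :=
  if h : ∃ R : H →L[ℂ] H, IsResolvent A z R then h.choose else 0

/-- The spectrum `σ(A) = ℂ \ ρ(A)`. -/
def spec (A : H →ₗ.[ℂ] H) : Set ℂ := (resSet A)ᶜ

/-- The kernel `ker (T - z)`, as a subspace of `dom T`. -/
def kerSub (T : H →ₗ.[ℂ] H) (z : ℂ) : Submodule ℂ T.domain :=
  LinearMap.ker (T.toFun - z • T.domain.subtype)

/-- The discrete spectrum: the isolated points of the spectrum that are eigenvalues of
finite multiplicity. -/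
def discSpec (A : H →ₗ.[ℂ] H) : Set ℂ :=
  {z ∈ spec A | (∃ ε > 0, ∀ w ∈ spec A, dist w z < ε → w = z) ∧
    kerSub A z ≠ ⊥ ∧ FiniteDimensional ℂ (kerSub A z)}

/-- The essential spectrum (of a self-adjoint operator): the rest of the spectrum. -/
def essSpec (A : H →ₗ.[ℂ] H) : Set ℂ := spec A \ discSpec A

/-- `{G, Γ₀, Γ₁}` with `Γ₀, Γ₁ : dom T → G` is an ordinary boundary triple for `S*`, where `S` is a
densely defined closed symmetric operator and the closure of `T` is `S*`. -/
structure IsOrdinaryBoundaryTriple (S T : H →ₗ.[ℂ] H) (Γ₀ Γ₁ : T.domain →ₗ[ℂ] G) : Prop where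
  dense_domain : Dense (S.domain : Set H)
  isClosed : S.IsClosed
  symmetric : S.IsFormalAdjoint S
  isClosable : T.IsClosable
  closure_eq : T.closure = S†
  green : ∀ f g : T.domain,
    inner ℂ (T f) (g : H) - inner ℂ (f : H) (T g) =
      inner ℂ (Γ₁ f) (Γ₀ g) - inner ℂ (Γ₀ f) (Γ₁ g)
  selfAdjoint : IsSelfAdjoint (restrictKer T Γ₀)
  surjective : Function.Surjective fun f : T.domain => (Γ₀ f, Γ₁ f)

open Classical in
/-- The value `γ(z) = (Γ₀ ↾ ker (T - z))⁻¹ : G → ker (T - z)` of the `γ`-field (and `0` if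
`Γ₀ ↾ ker (T - z)` is not a bijection onto `G`). -/
def gammaField (T : H →ₗ.[ℂ] H) (Γ₀ : T.domain →ₗ[ℂ] G) (z : ℂ) : G →ₗ[ℂ] T.domain :=
  if h : Function.Bijective (Γ₀.domRestrict (kerSub T z)) then
    (kerSub T z).subtype ∘ₗ (LinearEquiv.ofBijective (Γ₀.domRestrict (kerSub T z)) h).symm.toLinearMap
  else 0

/-- The value `M(z) = Γ₁ (Γ₀ ↾ ker (T - z))⁻¹` of the Weyl function. -/
def weylFunction (T : H →ₗ.[ℂ] H) (Γ₀ Γ₁ : T.domain →ₗ[ℂ] G) (z : ℂ) : G →ₗ[ℂ] G :=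
  Γ₁ ∘ₗ gammaField T Γ₀ z

end Operators

/-! ### Sobolev spaces on open subsets of the line -/

/-- `ℂ²` with its Euclidean inner product. -/
abbrev Spinor : Type := EuclideanSpace ℂ (Fin 2)

/-- `L²(ℝ; ℂ²)`. -/
abbrev L2 : Type := Lp Spinor 2 (volume : Measure ℝ)

/-- `φ ∈ C₀^∞(Ω; F)`. -/
def IsTestFunction {F : Type*} [NormedAddCommGroup F] [NormedSpace ℝ F] (Ω : Set ℝ) (φ : ℝ → F) :
    Prop :=
  ContDiff ℝ ∞ φ ∧ HasCompactSupport φ ∧ tsupport φ ⊆ Ω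

/-- `g` is the weak derivative of `f` on the open set `Ω`. -/
def HasWeakDerivOn (Ω : Set ℝ) (f g : ℝ → Spinor) : Prop :=
  ∀ φ : ℝ → ℝ, IsTestFunction Ω φ → ∫ x in Ω, deriv φ x • f x = -∫ x in Ω, φ x • g x

/-- `f ↾ Ω` is the limit in `H¹(Ω; ℂ²)` of functions in `C₀^∞(Ω; ℂ²)`, where `g` is the weak
derivative of `f`. -/
def IsLimitOfTestFunctions (Ω : Set ℝ) (f g : ℝ → Spinor) : Prop :=
  ∀ ε : ℝ≥0∞, 0 < ε → ∃ φ : ℝ → Spinor, IsTestFunction Ω φ ∧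
    eLpNorm (fun x => f x - φ x) 2 (volume.restrict Ω) < ε ∧
    eLpNorm (fun x => g x - deriv φ x) 2 (volume.restrict Ω) < ε

section Helpers

variable {Ω : Set ℝ}

theorem integrable_test_smul {φ : ℝ → ℝ} (hφ : Continuous φ) (hc : HasCompactSupport φ) (f : L2)
    (Ω : Set ℝ) : Integrable (fun x => φ x • f x) (volume.restrict Ω) :=
  ((((Lp.memLp f).locallyIntegrable (by norm_num)).integrable_smul_left_of_hasCompactSupport
    hφ hc)).restrict

theorem IsTestFunction.continuous_deriv {φ : ℝ → ℝ} (h : IsTestFunction Ω φ) :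
    Continuous (deriv φ) := h.1.continuous_deriv (by simp)

theorem ae_restrict_coe_add (Ω : Set ℝ) (f g : L2) :
    ((f + g : L2) : ℝ → Spinor) =ᵐ[volume.restrict Ω] fun x => f x + g x :=
  ae_restrict_of_ae (Lp.coeFn_add f g)

theorem ae_restrict_coe_smul (Ω : Set ℝ) (c : ℂ) (f : L2) :
    ((c • f : L2) : ℝ → Spinor) =ᵐ[volume.restrict Ω] fun x => c • f x :=
  ae_restrict_of_ae (Lp.coeFn_smul c f)

theorem ae_restrict_coe_zero (Ω : Set ℝ) :
    ((0 : L2) : ℝ → Spinor) =ᵐ[volume.restrict Ω] fun _ => 0 :=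
  ae_restrict_of_ae (Lp.coeFn_zero _ _ _)

theorem setIntegral_smul_add {φ : ℝ → ℝ} (hφ : Continuous φ) (hc : HasCompactSupport φ)
    (f g : L2) :
    ∫ x in Ω, φ x • (f + g : L2) x = (∫ x in Ω, φ x • f x) + ∫ x in Ω, φ x • g x := by
  rw [← integral_add (integrable_test_smul hφ hc f Ω) (integrable_test_smul hφ hc g Ω)]
  refine integral_congr_ae ?_
  filter_upwards [ae_restrict_coe_add Ω f g] with x hx
  rw [hx, smul_add]

theorem setIntegral_smul_smul (φ : ℝ → ℝ) (c : ℂ) (f : L2) :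
    ∫ x in Ω, φ x • (c • f : L2) x = c • ∫ x in Ω, φ x • f x := by
  rw [← integral_smul]
  refine integral_congr_ae ?_
  filter_upwards [ae_restrict_coe_smul Ω c f] with x hx
  rw [hx, smul_comm]

theorem setIntegral_smul_zero (φ : ℝ → ℝ) : ∫ x in Ω, φ x • (0 : L2) x = 0 := by
  rw [← integral_zero ℝ Spinor (μ := volume.restrict Ω)]
  refine integral_congr_ae ?_
  filter_upwards [ae_restrict_coe_zero Ω] with x hx
  rw [hx, smul_zero]

end Helpers

/-- The pairs `(f, f')` in `L² × L²` such that `f ↾ Ω ∈ H¹(Ω; ℂ²)` has the weak derivative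
`f' ↾ Ω`. -/
def weakDerivGraph (Ω : Set ℝ) : Submodule ℂ (L2 × L2) where
  carrier := {p | HasWeakDerivOn Ω p.1 p.2}
  zero_mem' := by
    intro φ hφ
    simp only [Prod.fst_zero, Prod.snd_zero, setIntegral_smul_zero, neg_zero]
  add_mem' := by
    intro p q hp hq φ hφ
    simp only [Prod.fst_add, Prod.snd_add]
    rw [setIntegral_smul_add hφ.continuous_deriv hφ.2.1.deriv,
      setIntegral_smul_add hφ.1.continuous hφ.2.1, hp φ hφ, hq φ hφ, neg_add]
  smul_mem' := by
    intro c p hp φ hφ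
    simp only [Prod.smul_fst, Prod.smul_snd]
    rw [setIntegral_smul_smul, setIntegral_smul_smul, hp φ hφ, smul_neg]

/-- The pairs `(f, f')` in `L² × L²` such that `f ↾ Ω ∈ H₀¹(Ω; ℂ²)`, the closure of
`C₀^∞(Ω; ℂ²)` in `H¹(Ω; ℂ²)`, has the weak derivative `f' ↾ Ω`. -/
def weakDerivGraph₀ (Ω : Set ℝ) : Submodule ℂ (L2 × L2) where
  carrier := {p | HasWeakDerivOn Ω p.1 p.2 ∧ IsLimitOfTestFunctions Ω p.1 p.2}
  zero_mem' := by
    refine ⟨(weakDerivGraph Ω).zero_mem,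
      fun ε hε => ⟨0, ⟨contDiff_const, HasCompactSupport.zero, by simp⟩, ?_, ?_⟩⟩
    · have e : (fun x => ((0 : L2 × L2).1 : ℝ → Spinor) x - (0 : ℝ → Spinor) x)
          =ᵐ[volume.restrict Ω] fun _ => 0 := by
        filter_upwards [ae_restrict_coe_zero Ω] with x hx
        simp only [Prod.fst_zero, Pi.zero_apply, hx, sub_zero]
      rw [eLpNorm_congr_ae e]
      simpa using hε
    · have e : (fun x => ((0 : L2 × L2).2 : ℝ → Spinor) x - deriv (0 : ℝ → Spinor) x)
          =ᵐ[volume.restrict Ω] fun _ => 0 := by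
        filter_upwards [ae_restrict_coe_zero Ω] with x hx
        simp only [Prod.snd_zero, hx, Pi.zero_def, deriv_const, sub_zero]
      rw [eLpNorm_congr_ae e]
      simpa using hε
  add_mem' := by
    rintro p q ⟨hp, hp'⟩ ⟨hq, hq'⟩
    refine ⟨(weakDerivGraph Ω).add_mem hp hq, fun ε hε => ?_⟩
    obtain ⟨φ, hφ, h1, h2⟩ := hp' (ε / 2) (ENNReal.half_pos hε.ne')
    obtain ⟨ψ, hψ, h3, h4⟩ := hq' (ε / 2) (ENNReal.half_pos hε.ne')
    have key : ∀ (f g : L2) (a b c : ℝ → Spinor), Continuous a → Continuous b →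
        (∀ x, c x = a x + b x) →
        eLpNorm (fun x => f x - a x) 2 (volume.restrict Ω) < ε / 2 →
        eLpNorm (fun x => g x - b x) 2 (volume.restrict Ω) < ε / 2 →
        eLpNorm (fun x => (f + g : L2) x - c x) 2 (volume.restrict Ω) < ε := by
      intro f g a b c ha hb hc h h'
      have e : (fun x => (f + g : L2) x - c x) =ᵐ[volume.restrict Ω]
          (fun x => f x - a x) + (fun x => g x - b x) := by
        filter_upwards [ae_restrict_coe_add Ω f g] with x hx
        simp only [Pi.add_apply, hx, hc]
        abel
      rw [eLpNorm_congr_ae e]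
      calc _ ≤ _ := eLpNorm_add_le ((Lp.aestronglyMeasurable f).restrict.sub
              ha.aestronglyMeasurable) ((Lp.aestronglyMeasurable g).restrict.sub
              hb.aestronglyMeasurable) (by norm_num)
        _ < ε / 2 + ε / 2 := ENNReal.add_lt_add h h'
        _ = ε := ENNReal.add_halves ε
    exact ⟨φ + ψ, ⟨hφ.1.add hψ.1, hφ.2.1.add hψ.2.1,
      (tsupport_add φ ψ).trans (union_subset hφ.2.2 hψ.2.2)⟩,
      key _ _ _ _ _ hφ.1.continuous hψ.1.continuous (fun _ => rfl) h1 h3,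
      key _ _ _ _ _ (hφ.1.continuous_deriv (by simp)) (hψ.1.continuous_deriv (by simp))
        (fun x => deriv_add (hφ.1.differentiable (by simp) x) (hψ.1.differentiable (by simp) x))
        h2 h4⟩
  smul_mem' := by
    rintro c p ⟨hp, hp'⟩
    refine ⟨(weakDerivGraph Ω).smul_mem c hp, fun ε hε => ?_⟩
    obtain ⟨δ, hδ, hδε⟩ : ∃ δ : ℝ≥0∞, 0 < δ ∧ ∀ t < δ, ‖c‖ₑ * t < ε := by
      by_cases hc : c = 0
      · exact ⟨1, one_pos, fun t _ => by simpa [hc] using hε⟩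
      · have hc' : ‖c‖ₑ ≠ 0 := by simpa using hc
        refine ⟨ε / ‖c‖ₑ, ENNReal.div_pos hε.ne' (by simp), fun t ht => ?_⟩
        rw [mul_comm]
        exact (ENNReal.lt_div_iff_mul_lt (Or.inl hc') (Or.inl (by simp))).1 ht
    obtain ⟨φ, hφ, h1, h2⟩ := hp' δ hδ
    have key : ∀ (f : L2) (a b : ℝ → Spinor), (∀ x, b x = c • a x) →
        eLpNorm (fun x => f x - a x) 2 (volume.restrict Ω) < δ →
        eLpNorm (fun x => (c • f : L2) x - b x) 2 (volume.restrict Ω) < ε := by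
      intro f a b hb h
      have e : (fun x => (c • f : L2) x - b x) =ᵐ[volume.restrict Ω]
          c • fun x => f x - a x := by
        filter_upwards [ae_restrict_coe_smul Ω c f] with x hx
        simp only [Pi.smul_apply, hx, hb, smul_sub]
      rw [eLpNorm_congr_ae e, eLpNorm_const_smul]
      exact hδε _ h
    exact ⟨c • φ, ⟨contDiff_const.smul hφ.1, hφ.2.1.smul_left (f := fun _ => c),
      (closure_mono (Function.support_const_smul_subset c φ)).trans hφ.2.2⟩,
      key _ _ _ (fun _ => rfl) h1,
      key _ _ _ (fun x => deriv_const_smul c (hφ.1.differentiable (by simp) x)) h2⟩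

section Traces

variable {Ω : Set ℝ}

theorem setIntegral_eq_integral_of_test {φ : ℝ → ℝ} (h : tsupport φ ⊆ Ω) (u : ℝ → Spinor) :
    ∫ x in Ω, φ x • u x = ∫ x, φ x • u x := by
  refine setIntegral_eq_integral_of_forall_compl_eq_zero fun x hx => ?_
  rw [image_eq_zero_of_notMem_tsupport fun hx' => hx (h hx'), zero_smul]

theorem locallyIntegrable_coe (f : L2) : LocallyIntegrable f volume :=
  (Lp.memLp f).locallyIntegrable (by norm_num)

theorem intervalIntegrable_coe (f : L2) (a b : ℝ) : IntervalIntegrable f volume a b :=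
  intervalIntegrable_iff.2 (((locallyIntegrable_coe f).integrableOn_isCompact
    isCompact_uIcc).mono_set uIoc_subset_uIcc)

theorem continuous_primitive_coe (g : L2) : Continuous fun x => ∫ t in (0 : ℝ)..x, g t :=
  intervalIntegral.continuous_primitive (intervalIntegrable_coe g) 0

/-- A weak derivative is unique. -/
theorem HasWeakDerivOn.ae_eq_zero (hΩ : IsOpen Ω) {f g : L2} (hf : f = 0)
    (h : HasWeakDerivOn Ω f g) : ∀ᵐ x, x ∈ Ω → g x = 0 := by
  refine hΩ.ae_eq_zero_of_integral_contDiff_smul_eq_zero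
    ((locallyIntegrable_coe g).locallyIntegrableOn Ω) fun φ h1 h2 h3 => ?_
  have := h φ ⟨h1, h2, h3⟩
  rw [hf, setIntegral_smul_zero, setIntegral_eq_integral_of_test h3] at this
  exact neg_eq_zero.1 this.symm

/-- Integration by parts against the primitive of an `L²`-function. -/
theorem integral_deriv_smul_primitive (g : L2) {φ : ℝ → ℝ} (hφ : IsTestFunction univ φ) :
    ∫ x, deriv φ x • (∫ t in (0 : ℝ)..x, g t) = -∫ x, φ x • g x := by
  obtain ⟨R, hR⟩ := hφ.2.1.isBounded.subset_ball 0
  have hR' : tsupport φ ⊆ Ioo (-R) R := by rwa [Real.ball_eq_Ioo, zero_sub, zero_add] at hR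
  have hI1 : Integrable (fun x => deriv φ x • ∫ t in (0 : ℝ)..x, g t) :=
    (continuous_primitive_coe g).locallyIntegrable.integrable_smul_left_of_hasCompactSupport
      hφ.continuous_deriv hφ.2.1.deriv
  have hI2 : Integrable (fun x => φ x • g x) :=
    (locallyIntegrable_coe g).integrable_smul_left_of_hasCompactSupport hφ.1.continuous hφ.2.1
  refine (SeparatingDual.eq_iff_forall_dual_eq (R := ℝ)).2 fun L => ?_
  rw [map_neg, ← L.integral_comp_comm hI1, ← L.integral_comp_comm hI2]
  simp only [map_smul, smul_eq_mul]
  have hLg : IntervalIntegrable (fun t => L (g t)) volume (-R) R :=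
    ⟨L.integrable_comp (intervalIntegrable_coe g (-R) R).1,
      L.integrable_comp (intervalIntegrable_coe g (-R) R).2⟩
  have hLF : ∀ x, L (∫ t in (0 : ℝ)..x, g t) = ∫ t in (0 : ℝ)..x, L (g t) := fun x =>
    (L.intervalIntegral_comp_comm (intervalIntegrable_coe g 0 x)).symm
  simp only [hLF]
  have s1 : Function.support φ ⊆ Ioc (-R) R :=
    (subset_tsupport φ).trans (hR'.trans Ioo_subset_Ioc_self)
  have s2 : Function.support (deriv φ) ⊆ Ioc (-R) R :=
    (support_deriv_subset).trans (hR'.trans Ioo_subset_Ioc_self)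
  rw [← intervalIntegral.integral_eq_integral_of_support_subset (a := -R) (b := R)
      ((Function.support_mul_subset_left _ _).trans s2),
    ← intervalIntegral.integral_eq_integral_of_support_subset (a := -R) (b := R)
      ((Function.support_mul_subset_left _ _).trans s1)]
  by_cases hR0 : 0 ≤ R
  swap
  · have : ∀ x, φ x = 0 := fun x => by
      by_contra hx
      have := s1 hx
      linarith [this.1, this.2]
    have : φ = 0 := funext this
    simp [this]
  have h0 : (0 : ℝ) ∈ uIcc (-R) R := by
    rw [uIcc_of_le (by linarith)]; exact ⟨by linarith, hR0⟩
  have e1 : φ R = 0 := image_eq_zero_of_notMem_tsupport fun h => (hR' h).2.false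
  have e2 : φ (-R) = 0 := image_eq_zero_of_notMem_tsupport fun h => (hR' h).1.false
  have := AbsolutelyContinuousOnInterval.integral_mul_deriv_eq_deriv_mul (a := -R) (b := R)
    (f := φ) (g := fun x => ∫ t in (0 : ℝ)..x, L (g t))
    ((hφ.1.of_le (by simp)).contDiffOn.absolutelyContinuousOnInterval)
    (hLg.absolutelyContinuousOnInterval_intervalIntegral h0)
  rw [e1, e2] at this
  have e3 : ∫ x in (-R)..R, φ x * deriv (fun x => ∫ t in (0 : ℝ)..x, L (g t)) x =
      ∫ x in (-R)..R, φ x * L (g x) := by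
    refine intervalIntegral.integral_congr_ae ?_
    filter_upwards [hLg.ae_hasDerivAt_integral] with x hx hx'
    rw [(hx (uIoc_subset_uIcc hx') 0 h0).deriv]
  rw [e3] at this
  linarith

/-- A function with vanishing weak derivative on an open interval is constant there. -/
theorem exists_ae_eq_const (hΩ : IsOpen Ω) (hc : Ω.OrdConnected) (hne : Ω.Nonempty)
    {h : ℝ → Spinor} (hh : LocallyIntegrable h volume)
    (H : ∀ φ : ℝ → ℝ, IsTestFunction Ω φ → ∫ x, deriv φ x • h x = 0) :
    ∃ c : Spinor, ∀ᵐ x, x ∈ Ω → h x = c := by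
  obtain ⟨ψ, hψ, hψ1⟩ : ∃ ψ : ℝ → ℝ, IsTestFunction Ω ψ ∧ ∫ x, ψ x = 1 := by
    obtain ⟨y, hy⟩ := hne
    obtain ⟨ε, hε, hεΩ⟩ := Metric.isOpen_iff.1 hΩ y hy
    let B : ContDiffBump y := ⟨ε / 4, ε / 2, by linarith, by linarith⟩
    refine ⟨B.normed volume, ⟨B.contDiff_normed, B.hasCompactSupport_normed, ?_⟩,
      B.integral_normed⟩
    rw [B.tsupport_normed_eq]
    exact (Metric.closedBall_subset_ball (by change ε / 2 < ε; linarith)).trans hεΩ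
  have prim : ∀ θ : ℝ → ℝ, IsTestFunction Ω θ → ∫ x, θ x = 0 → ∫ x, θ x • h x = 0 := by
    intro θ hθ h0
    rcases (tsupport θ).eq_empty_or_nonempty with he | hK
    · have : θ = 0 := tsupport_eq_empty_iff.1 he
      simp [this]
    have hKc : IsCompact (tsupport θ) := hθ.2.1
    set a := sInf (tsupport θ)
    set b := sSup (tsupport θ)
    have ha : a ∈ tsupport θ := hKc.sInf_mem hK
    have hb : b ∈ tsupport θ := hKc.sSup_mem hK
    have hKab : tsupport θ ⊆ Icc a b := fun x hx =>
      ⟨csInf_le hKc.bddBelow hx, le_csSup hKc.bddAbove hx⟩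
    have hcont := hθ.1.continuous
    have hz : ∀ x, x ∉ Icc a b → θ x = 0 := fun x hx =>
      image_eq_zero_of_notMem_tsupport fun h => hx (hKab h)
    have hint : Integrable θ := hcont.integrable_of_hasCompactSupport hθ.2.1
    have hd : deriv (fun x => ∫ t in a..x, θ t) = θ := by
      ext x
      exact hcont.deriv_integral _ _ _
    have hs : Function.support (fun x => ∫ t in a..x, θ t) ⊆ Icc a b := by
      intro x hx
      by_contra hxn
      refine hx ?_
      rcases lt_or_ge x a with hxa | hxa
      · refine intervalIntegral.integral_zero_ae ?_
        filter_upwards [(countable_singleton a).ae_notMem volume] with t ht ht'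
        rw [uIoc_of_ge hxa.le] at ht'
        exact hz t fun h => ht (le_antisymm ht'.2 h.1)
      · have hbx : b < x := lt_of_not_ge fun hh => hxn ⟨hxa, hh⟩
        have e : ∫ t in Iic a, θ t = 0 := by
          rw [integral_Iic_eq_integral_Iio]
          refine setIntegral_eq_zero_of_forall_eq_zero fun t ht => hz t fun h => ?_
          exact absurd h.1 (not_le.2 ht)
        have e' : ∫ t in Ioi x, θ t = 0 :=
          setIntegral_eq_zero_of_forall_eq_zero fun t ht => hz t fun h =>
            absurd (hbx.trans ht) (not_lt.2 h.2)
        have e1 := intervalIntegral.integral_Iic_add_Ioi (b := x)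
          hint.integrableOn hint.integrableOn
        have e2 := intervalIntegral.integral_Iic_sub_Iic (a := a) (b := x)
          hint.integrableOn hint.integrableOn
        change ∫ t in a..x, θ t = 0
        rw [e', add_zero, h0] at e1
        rw [← e2, e, e1, sub_zero]
    have hts : tsupport (fun x => ∫ t in a..x, θ t) ⊆ Icc a b :=
      closure_minimal hs isClosed_Icc
    have := H (fun x => ∫ t in a..x, θ t) ⟨?_, ?_, hts.trans (hc.out (hθ.2.2 ha) (hθ.2.2 hb))⟩
    · rwa [hd] at this
    · refine contDiff_infty_iff_deriv.2 ⟨fun x =>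
        (hcont.integral_hasStrictDerivAt a x).hasDerivAt.differentiableAt, ?_⟩
      rw [hd]
      exact hθ.1
    · exact HasCompactSupport.of_support_subset_isCompact isCompact_Icc hs
  refine ⟨∫ x, ψ x • h x, ?_⟩
  have key : ∀ᵐ x, x ∈ Ω → h x - (∫ x, ψ x • h x) = 0 := by
    refine hΩ.ae_eq_zero_of_integral_contDiff_smul_eq_zero
      ((hh.sub (locallyIntegrable_const _)).locallyIntegrableOn Ω) fun θ h1 h2 h3 => ?_
    have hI : ∀ {φ : ℝ → ℝ}, IsTestFunction Ω φ → Integrable fun x => φ x • h x := fun hφ =>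
      hh.integrable_smul_left_of_hasCompactSupport hφ.1.continuous hφ.2.1
    have hθ : IsTestFunction Ω θ := ⟨h1, h2, h3⟩
    have iθ : Integrable θ := h1.continuous.integrable_of_hasCompactSupport h2
    have iψ : Integrable ψ := hψ.1.continuous.integrable_of_hasCompactSupport hψ.2.1
    have hcs : HasCompactSupport fun x => (∫ t, θ t) * ψ x := hψ.2.1.mul_left
    have hts : tsupport (fun x => (∫ t, θ t) * ψ x) ⊆ tsupport ψ :=
      closure_mono (Function.support_mul_subset_right _ _)
    have := prim (θ - fun x => (∫ t, θ t) * ψ x)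
      ⟨h1.sub (contDiff_const.mul hψ.1), h2.sub hcs,
        (tsupport_sub _ _).trans (union_subset h3 (hts.trans hψ.2.2))⟩ (by
          simp only [Pi.sub_apply]
          rw [integral_sub iθ (iψ.const_mul _), integral_const_mul, hψ1, mul_one, sub_self])
    simp only [Pi.sub_apply, sub_smul, mul_smul] at this
    have iψh : Integrable fun x => (∫ t, θ t) • ψ x • h x := (hI hψ).smul (∫ t, θ t)
    rw [integral_sub (hI hθ) iψh, integral_smul] at this
    simp only [smul_sub]
    rw [integral_sub (hI hθ) (iθ.smul_const _), integral_smul_const, this]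
  filter_upwards [key] with x hx hxΩ using sub_eq_zero.1 (hx hxΩ)

/-- A function in `H¹` of an open interval has a continuous representative. -/
theorem HasWeakDerivOn.exists_ae_eq (hΩ : IsOpen Ω) (hc : Ω.OrdConnected) (hne : Ω.Nonempty)
    {f g : L2} (h : HasWeakDerivOn Ω f g) :
    ∃ c : Spinor, ∀ᵐ x, x ∈ Ω → f x = c + ∫ t in (0 : ℝ)..x, g t := by
  have hF := (continuous_primitive_coe g).locallyIntegrable (μ := volume)
  obtain ⟨c, hc⟩ := exists_ae_eq_const hΩ hc hne ((locallyIntegrable_coe f).sub hF)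
    (fun φ hφ => by
      have h1 := h φ hφ
      have h2 := integral_deriv_smul_primitive g ⟨hφ.1, hφ.2.1, subset_univ _⟩
      rw [setIntegral_eq_integral_of_test hφ.2.2,
        setIntegral_eq_integral_of_test ((closure_minimal support_deriv_subset
          (isClosed_tsupport φ)).trans hφ.2.2)] at h1
      simp only [Pi.sub_apply, smul_sub]
      rw [integral_sub ((locallyIntegrable_coe f).integrable_smul_left_of_hasCompactSupport
        hφ.continuous_deriv hφ.2.1.deriv) (hF.integrable_smul_left_of_hasCompactSupport
        hφ.continuous_deriv hφ.2.1.deriv), h1, h2, sub_self])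
  refine ⟨c, ?_⟩
  filter_upwards [hc] with x hx hxΩ
  have := hx hxΩ
  rw [Pi.sub_apply, sub_eq_iff_eq_add] at this
  exact this

/-- `c` is the boundary value at `0` of (the continuous representative of) `f ↾ Ω`. For
`Ω = (0, ∞)` this is `f(0+)`, for `Ω = (-∞, 0)` it is `f(0-)`. -/
def IsTrace (Ω : Set ℝ) (f : ℝ → Spinor) (c : Spinor) : Prop :=
  ∃ u : ℝ → Spinor, ContinuousOn u Ω ∧ f =ᵐ[volume.restrict Ω] u ∧ Tendsto u (𝓝[Ω] 0) (𝓝 c)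

theorem IsTrace.unique (hΩ : IsOpen Ω) (h0 : (𝓝[Ω] (0 : ℝ)).NeBot) {f : ℝ → Spinor} {c c' : Spinor}
    (h : IsTrace Ω f c) (h' : IsTrace Ω f c') : c = c' := by
  obtain ⟨u, hu, hfu, hc⟩ := h
  obtain ⟨v, hv, hfv, hc'⟩ := h'
  have e : EqOn u v Ω := Measure.eqOn_open_of_ae_eq (hfu.symm.trans hfv) hΩ hu hv
  refine tendsto_nhds_unique hc (hc'.congr' ?_)
  filter_upwards [self_mem_nhdsWithin] with x hx using (e hx).symm

theorem HasWeakDerivOn.exists_isTrace (hΩ : IsOpen Ω) (hc : Ω.OrdConnected) (hne : Ω.Nonempty)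
    {f g : L2} (h : HasWeakDerivOn Ω f g) : ∃ c : Spinor, IsTrace Ω f c := by
  obtain ⟨c, hc⟩ := h.exists_ae_eq hΩ hc hne
  have hcont : Continuous fun x => c + ∫ t in (0 : ℝ)..x, g t :=
    continuous_const.add (continuous_primitive_coe g)
  exact ⟨_, _, hcont.continuousOn, (ae_restrict_iff' hΩ.measurableSet).2 hc,
    (hcont.tendsto 0).mono_left nhdsWithin_le_nhds⟩

theorem IsTrace.add {f g : L2} {c d : Spinor} (h : IsTrace Ω f c) (h' : IsTrace Ω g d) :
    IsTrace Ω (f + g : L2) (c + d) := by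
  obtain ⟨u, hu, hfu, hc⟩ := h
  obtain ⟨v, hv, hfv, hd⟩ := h'
  refine ⟨fun x => u x + v x, hu.add hv, ?_, hc.add hd⟩
  filter_upwards [ae_restrict_coe_add Ω f g, hfu, hfv] with x h1 h2 h3
  rw [h1, h2, h3]

theorem IsTrace.smul {f : L2} {c : Spinor} (a : ℂ) (h : IsTrace Ω f c) :
    IsTrace Ω (a • f : L2) (a • c) := by
  obtain ⟨u, hu, hfu, hc⟩ := h
  refine ⟨fun x => a • u x, hu.const_smul a, ?_, hc.const_smul a⟩
  filter_upwards [ae_restrict_coe_smul Ω a f, hfu] with x h1 h2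
  rw [h1, h2]

end Traces

/-! ### The Dirac operators -/

/-- The weak derivative, with domain `H¹((0, ∞); ℂ²) ⊕ H¹((-∞, 0); ℂ²)`. -/
def derivMax : L2 →ₗ.[ℂ] L2 := (weakDerivGraph (Ioi 0) ⊓ weakDerivGraph (Iio 0)).toLinearPMap

/-- The weak derivative, with domain `H₀¹((0, ∞); ℂ²) ⊕ H₀¹((-∞, 0); ℂ²)`. -/
def derivMin : L2 →ₗ.[ℂ] L2 := (weakDerivGraph₀ (Ioi 0) ⊓ weakDerivGraph₀ (Iio 0)).toLinearPMap

/-- The weak derivative, with domain `H¹(ℝ; ℂ²)`. -/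
def derivFree : L2 →ₗ.[ℂ] L2 := (weakDerivGraph univ).toLinearPMap

theorem snd_eq_zero_of_max (p : L2 × L2) (hp : p ∈ weakDerivGraph (Ioi 0) ⊓ weakDerivGraph (Iio 0))
    (h0 : p.1 = 0) : p.2 = 0 := by
  have h1 := HasWeakDerivOn.ae_eq_zero isOpen_Ioi h0 hp.1
  have h2 := HasWeakDerivOn.ae_eq_zero isOpen_Iio h0 hp.2
  refine Lp.ext ?_
  filter_upwards [h1, h2, (countable_singleton (0 : ℝ)).ae_notMem volume,
    Lp.coeFn_zero Spinor 2 (volume : Measure ℝ)] with x h1 h2 h3 h4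
  rw [h4]
  rcases lt_trichotomy x 0 with h | h | h
  · exact h2 h
  · exact absurd h h3
  · exact h1 h

theorem graph_derivMax :
    derivMax.graph = weakDerivGraph (Ioi 0) ⊓ weakDerivGraph (Iio 0) :=
  Submodule.toLinearPMap_graph_eq _ snd_eq_zero_of_max

theorem graph_derivMin :
    derivMin.graph = weakDerivGraph₀ (Ioi 0) ⊓ weakDerivGraph₀ (Iio 0) :=
  Submodule.toLinearPMap_graph_eq _ fun p hp => snd_eq_zero_of_max p ⟨hp.1.1, hp.2.1⟩

theorem graph_derivFree : derivFree.graph = weakDerivGraph univ := by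
  refine Submodule.toLinearPMap_graph_eq _ fun p hp h0 => Lp.ext ?_
  filter_upwards [HasWeakDerivOn.ae_eq_zero isOpen_univ h0 hp,
    Lp.coeFn_zero Spinor 2 (volume : Measure ℝ)] with x h1 h2
  rw [h2, Pi.zero_apply, h1 (mem_univ x)]

/-! The Pauli matrices. -/

def σ₁ : Matrix (Fin 2) (Fin 2) ℂ := !![0, 1; 1, 0]

def σ₂ : Matrix (Fin 2) (Fin 2) ℂ := !![0, -Complex.I; Complex.I, 0]

def σ₃ : Matrix (Fin 2) (Fin 2) ℂ := !![1, 0; 0, -1]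

/-- A matrix acting on `ℂ²`. -/
abbrev mat (B : Matrix (Fin 2) (Fin 2) ℂ) : Spinor →L[ℂ] Spinor := Matrix.toEuclideanCLM (𝕜 := ℂ) B

/-- A constant matrix acting pointwise on `L²(ℝ; ℂ²)`. -/
def matL2 (B : Matrix (Fin 2) (Fin 2) ℂ) : L2 →L[ℂ] L2 := (mat B).compLpL 2 volume

/-- The operator `f ↦ -i σ₁ D f + m σ₃ f` on the domain of `D`. -/
def diracOp (m : ℝ) (D : L2 →ₗ.[ℂ] L2) : L2 →ₗ.[ℂ] L2 where
  domain := D.domain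
  toFun := (matL2 (-Complex.I • σ₁)).toLinearMap ∘ₗ D.toFun +
    (matL2 ((m : ℂ) • σ₃)).toLinearMap ∘ₗ D.domain.subtype

/-- The symmetric operator `S` on `H₀¹((0, ∞); ℂ²) ⊕ H₀¹((-∞, 0); ℂ²)`. -/
def diracMin (m : ℝ) : L2 →ₗ.[ℂ] L2 := diracOp m derivMin

/-- The same expression on `H¹((0, ∞); ℂ²) ⊕ H¹((-∞, 0); ℂ²)`. -/
def diracMax (m : ℝ) : L2 →ₗ.[ℂ] L2 := diracOp m derivMax

/-- The free Dirac operator `A₀` on `H¹(ℝ; ℂ²)`. -/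
def diracFree (m : ℝ) : L2 →ₗ.[ℂ] L2 := diracOp m derivFree

theorem exists_isTrace_right (f : derivMax.domain) : ∃ c, IsTrace (Ioi 0) (f : L2) c := by
  have := derivMax.mem_graph f
  rw [graph_derivMax] at this
  exact HasWeakDerivOn.exists_isTrace isOpen_Ioi ordConnected_Ioi ⟨1, by simp⟩ this.1

theorem exists_isTrace_left (f : derivMax.domain) : ∃ c, IsTrace (Iio 0) (f : L2) c := by
  have := derivMax.mem_graph f
  rw [graph_derivMax] at this
  exact HasWeakDerivOn.exists_isTrace isOpen_Iio ordConnected_Iio ⟨-1, by simp⟩ this.2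

/-- The one-sided limit `f(0+)`. -/
def traceRight : derivMax.domain →ₗ[ℂ] Spinor where
  toFun f := (exists_isTrace_right f).choose
  map_add' f g := IsTrace.unique isOpen_Ioi inferInstance (exists_isTrace_right (f + g)).choose_spec
    ((exists_isTrace_right f).choose_spec.add (exists_isTrace_right g).choose_spec)
  map_smul' a f := IsTrace.unique isOpen_Ioi inferInstance
    (exists_isTrace_right (a • f)).choose_spec ((exists_isTrace_right f).choose_spec.smul a)

/-- The one-sided limit `f(0-)`. -/
def traceLeft : derivMax.domain →ₗ[ℂ] Spinor where
  toFun f := (exists_isTrace_left f).choose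
  map_add' f g := IsTrace.unique isOpen_Iio inferInstance (exists_isTrace_left (f + g)).choose_spec
    ((exists_isTrace_left f).choose_spec.add (exists_isTrace_left g).choose_spec)
  map_smul' a f := IsTrace.unique isOpen_Iio inferInstance
    (exists_isTrace_left (a • f)).choose_spec ((exists_isTrace_left f).choose_spec.smul a)

theorem isTrace_traceRight (f : derivMax.domain) : IsTrace (Ioi 0) (f : L2) (traceRight f) :=
  (exists_isTrace_right f).choose_spec

theorem isTrace_traceLeft (f : derivMax.domain) : IsTrace (Iio 0) (f : L2) (traceLeft f) :=
  (exists_isTrace_left f).choose_spec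

/-- `Γ₀ f = -i σ₁ (f(0+) - f(0-))`. -/
def Gamma₀ (m : ℝ) : (diracMax m).domain →ₗ[ℂ] Spinor :=
  (mat (-Complex.I • σ₁)).toLinearMap ∘ₗ (traceRight - traceLeft)

/-- `Γ₁ f = (f(0+) + f(0-)) / 2`. -/
def Gamma₁ (m : ℝ) : (diracMax m).domain →ₗ[ℂ] Spinor :=
  (1 / 2 : ℂ) • (traceRight + traceLeft)

/-- `P_{η,τ,λ} = η I₂ + τ σ₃ - λ σ₂`. -/
def couplingMatrix (η τ lam : ℝ) : Matrix (Fin 2) (Fin 2) ℂ :=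
  (η : ℂ) • 1 + (τ : ℂ) • σ₃ - (lam : ℂ) • σ₂

/-- `A_{η,τ,λ} = S* ↾ ker (Γ₀ + P_{η,τ,λ} Γ₁)`, where `S*` is `diracMax m`. -/
def diracDelta (m η τ lam : ℝ) : L2 →ₗ.[ℂ] L2 :=
  restrictKer (diracMax m)
    (Gamma₀ m + (mat (couplingMatrix η τ lam)).toLinearMap ∘ₗ Gamma₁ m)

/-! ### Explicit expressions -/

/-- The branch of the square root on `ℂ \ [0, ∞)` with positive imaginary part. -/
def upperSqrt (w : ℂ) : ℂ := Complex.I * (-w) ^ (1 / 2 : ℂ)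

theorem upperSqrt_sq (w : ℂ) : upperSqrt w ^ 2 = w := by
  have : ((-w) ^ (1 / 2 : ℂ)) ^ 2 = -w := by
    rw [one_div]; exact Complex.cpow_nat_inv_pow (-w) two_ne_zero
  rw [upperSqrt, mul_pow, this, Complex.I_sq]
  ring

theorem upperSqrt_im_pos {w : ℂ} (hw : ∀ r : ℝ, 0 ≤ r → w ≠ r) : 0 < (upperSqrt w).im := by
  have h0 : -w ≠ 0 := neg_ne_zero.2 (by simpa using hw 0 le_rfl)
  have harg : (-w).arg ≠ Real.pi := fun h => by
    obtain ⟨h1, h2⟩ := Complex.arg_eq_pi_iff.1 h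
    refine hw w.re ?_ (Complex.ext (by simp) ?_)
    · simp at h1; linarith
    · simpa using h2
  have hlt := lt_of_le_of_ne (Complex.arg_le_pi (-w)) harg
  have hgt := Complex.neg_pi_lt_arg (-w)
  rw [upperSqrt, Complex.I_mul_im, Complex.cpow_def_of_ne_zero h0, Complex.exp_re]
  have him : (Complex.log (-w) * (1 / 2 : ℂ)).im = (-w).arg / 2 := by
    rw [show (1 / 2 : ℂ) = ((1 / 2 : ℝ) : ℂ) by norm_num, Complex.im_mul_ofReal, Complex.log_im]
    ring
  rw [him]
  exact mul_pos (Real.exp_pos _) (Real.cos_pos_of_mem_Ioo ⟨by linarith, by linarith⟩)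

/-- `k(z) = √(z² - m²)`. -/
def kFun (m : ℝ) (z : ℂ) : ℂ := upperSqrt (z ^ 2 - (m : ℂ) ^ 2)

/-- `ζ(z) = (z + m) / k(z)`. -/
def zetaFun (m : ℝ) (z : ℂ) : ℂ := (z + m) / kFun m z

/-- `sgn x` as a complex number. -/
def sgn (x : ℝ) : ℂ := (Real.sign x : ℂ)

/-- The matrix `G_{z,1}(x)`. -/
def greenMatrix (m : ℝ) (z : ℂ) (x : ℝ) : Matrix (Fin 2) (Fin 2) ℂ :=
  (Complex.I / 2 * Complex.exp (Complex.I * kFun m z * (|x| : ℝ))) •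
    !![zetaFun m z, sgn x; sgn x, (zetaFun m z)⁻¹]

/-- The matrix `M(z) = (i/2) diag(ζ(z), ζ(z)⁻¹)`. -/
def weylMatrix (m : ℝ) (z : ℂ) : Matrix (Fin 2) (Fin 2) ℂ :=
  (Complex.I / 2) • !![zetaFun m z, 0; 0, (zetaFun m z)⁻¹]

/-- `g_{z,j}(x) = (i/2) ((I₂ + P M(z))⁻¹ P G_{z,1}(-x))ᵀ e_j`. -/
def gFun (m : ℝ) (P : Matrix (Fin 2) (Fin 2) ℂ) (z : ℂ) (j : Fin 2) (x : ℝ) : Spinor :=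
  WithLp.toLp 2 ((Complex.I / 2) •
    (((1 + P * weylMatrix m z)⁻¹ * P * greenMatrix m z (-x))ᵀ *ᵥ Pi.single j 1))

/-- The inner product `(u, v)` of `L²(ℝ; ℂ²)`, linear in `u`. -/
def pairing (u v : ℝ → Spinor) : ℂ := ∫ x, ∑ i, u x i * conj (v x i)

/-- The complex conjugate `f̄`. -/
def conjFun (f : ℝ → Spinor) (x : ℝ) : Spinor := WithLp.toLp 2 fun i => conj (f x i)

/-- `d = η² - τ² - λ²`. -/
def dParam (η τ lam : ℝ) : ℝ := η ^ 2 - τ ^ 2 - lam ^ 2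

/-- The numbers `z₊` (for `s = 1`) and `z₋` (for `s = -1`). -/
def zPM (m η τ lam s : ℝ) : ℝ :=
  m * (-η * τ + s * (|dParam η τ lam / 4 - 1| * √(lam ^ 2 + (dParam η τ lam / 4 + 1) ^ 2))) /
    (η ^ 2 + (dParam η τ lam / 4 - 1) ^ 2)

end DeltaDirac

end

open DeltaDirac

noncomputable section

namespace DeltaDirac

section AbstractOperators

variable {H G : Type*} [NormedAddCommGroup H] [InnerProductSpace ℂ H]
  [NormedAddCommGroup G] [InnerProductSpace ℂ G]

/-! ### Restrictions to kernels and resolvents -/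

section

variable {T : H →ₗ.[ℂ] H} {L : T.domain →ₗ[ℂ] G}

/-! On each half-line, an `L²` function with `L²` weak derivative is almost everywhere a primitive
of that derivative. Hence the domain of `T` consists of pairs of primitives glued at `0` with
arbitrary boundary values, and everything about `T` reduces to integration by parts plus linear
algebra in `ℂ²`. The boundary term at infinity vanishes, which gives Green's identity. Testing
against `C₀^∞` functions supported away from `0` gives `S* = T`.

Two abstract facts then do the operator theory. First, Green's identity, surjectivity of `(Γ₀, Γ₁)`
and `S* = T` make `T ↾ ker (Γ₀ + P Γ₁)` self-adjoint for every symmetric `P`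
(`isSelfAdjoint_restrictKer`); `P = 0` is the free operator. Second, if `z ∈ ρ(A₀)`, the problem `(A
- z) u = f` is solved by `u = (A₀ - z)⁻¹ f - γ(z) c`, where `(I + P M(z)) c = P Γ₁ (A₀ - z)⁻¹ f`
(`krein_solution`). So `z ∈ ρ(A)` exactly when `I + P M(z)` is injective
(`mem_resSet_restrictKer_iff`). The identity `γ(z̄)* = Γ₁ (A₀ - z)⁻¹` turns the correction term into
the rank-two integral expression of the statement. The `γ`-field itself is explicit: the decaying
exponential solutions of the Dirac equation, normalised to have the prescribed jump at `0`.

For the spectrum, the half-lines `|x| ≥ m` lie in the spectrum of every extension: slowly decaying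
plane waves on `(0, ∞)`, combined so as to vanish at `0`, are approximate eigenvectors whatever the
boundary condition (`notMem_resSet_of_sq_le`). In the gap, `√(m² - x²) det (I + P M(x))` equals `(1
- d/4) √(m² - x²) + η x + m τ` (`det_eq_zero_iff_gap`). This is linear in `x` if `d = 4`. Otherwise
squaring gives a quadratic equation with roots `z₊` and `z₋`, and the sign condition `(d - 4)(m τ +
η x) > 0` singles out the genuine solutions. These are finitely many isolated eigenvalues, of
multiplicity at most two because `Γ₀` is injective on each eigenspace. -/

theorem mem_restrictKer_domain {x : H} :
    x ∈ (restrictKer T L).domain ↔ ∃ h : x ∈ T.domain, L ⟨x, h⟩ = 0 := by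
  simp only [restrictKer, LinearPMap.domRestrict_domain, Submodule.mem_inf, Submodule.mem_map,
    LinearMap.mem_ker, Submodule.subtype_apply, Subtype.exists, exists_and_right, exists_eq_right]
  exact ⟨fun h => h.1, fun h => ⟨h, h.1⟩⟩

theorem restrictKer_apply (x : (restrictKer T L).domain) (h : (x : H) ∈ T.domain) :
    restrictKer T L x = T ⟨x, h⟩ :=
  LinearPMap.domRestrict_apply rfl

end

variable {A : H →ₗ.[ℂ] H} {z : ℂ}

theorem resolventOp_spec (hz : z ∈ resSet A) : IsResolvent A z (resolventOp A z) := by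
  have hz' : ∃ R : H →L[ℂ] H, IsResolvent A z R := hz
  rw [resolventOp, dif_pos hz']
  exact hz'.choose_spec

theorem resolventOp_eq (hz : z ∈ resSet A) {f : H} (u : A.domain) (hu : A u - z • (u : H) = f) :
    resolventOp A z f = u := by
  rw [← hu, (resolventOp_spec hz).2 u]

theorem eq_zero_of_mem_resSet (hz : z ∈ resSet A) (u : A.domain) (hu : A u = z • (u : H)) :
    (u : H) = 0 := by
  rw [← resolventOp_eq hz u rfl, hu, sub_self, map_zero]

theorem exists_norm_le_of_mem_resSet (hz : z ∈ resSet A) :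
    ∃ C : ℝ, ∀ u : A.domain, ‖(u : H)‖ ≤ C * ‖A u - z • (u : H)‖ := by
  obtain ⟨R, hR⟩ := hz
  refine ⟨‖R‖, fun u => ?_⟩
  have := R.le_opNorm (A u - z • (u : H))
  rwa [hR.2 u] at this

/-- Symmetry makes `(u, A u)` real, so the imaginary part of `(u, (A - z) u)` is `-Im z ‖u‖²`, and
Cauchy–Schwarz applies. -/
theorem abs_im_mul_norm_le (hA : A.IsFormalAdjoint A) (z : ℂ) (u : A.domain) :
    |z.im| * ‖(u : H)‖ ≤ ‖A u - z • (u : H)‖ := by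
  rcases (norm_nonneg (u : H)).eq_or_lt with h0 | h0
  · rw [← h0]; simp
  have him : (inner ℂ (u : H) (A u)).im = 0 := by
    have h1 := hA u u
    rw [← inner_conj_symm] at h1
    have := congrArg Complex.im h1
    rw [Complex.conj_im] at this
    linarith
  have h2 : (inner ℂ (u : H) (A u - z • (u : H))).im = -(z.im * ‖(u : H)‖ ^ 2) := by
    have hre : (inner ℂ (u : H) (u : H)).re = ‖(u : H)‖ ^ 2 := inner_self_eq_norm_sq (𝕜 := ℂ) _
    have him' : (inner ℂ (u : H) (u : H)).im = 0 := inner_self_im (𝕜 := ℂ) _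
    rw [inner_sub_right, inner_smul_right, Complex.sub_im, him, Complex.mul_im, hre, him']
    ring
  have h3 := (Complex.abs_im_le_norm _).trans (norm_inner_le_norm (𝕜 := ℂ) (u : H) (A u - z • (u : H)))
  rw [h2, abs_neg, abs_mul, abs_of_nonneg (sq_nonneg ‖(u : H)‖)] at h3
  nlinarith

theorem mem_kerSub {T : H →ₗ.[ℂ] H} {u : T.domain} : u ∈ kerSub T z ↔ T u = z • (u : H) := by
  rw [kerSub, LinearMap.mem_ker]
  exact sub_eq_zero

theorem eq_zero_of_gamma_eq_zero {T : H →ₗ.[ℂ] H} {Γ₀ : T.domain →ₗ[ℂ] G} {γ : G →ₗ[ℂ] T.domain}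
    (hγ₀ : ∀ ξ, Γ₀ (γ ξ) = ξ) {ξ : G} (h : (γ ξ : H) = 0) : ξ = 0 := by
  rw [← hγ₀ ξ, show γ ξ = 0 from Subtype.ext h, map_zero]

section

variable {T : H →ₗ.[ℂ] H} {Γ₀ Γ₁ : T.domain →ₗ[ℂ] G} {P : G →ₗ[ℂ] G} {γ : G →ₗ[ℂ] T.domain}

/-- A right inverse of `Γ₀` with values in `ker (T - z)` is the `γ`-field. -/
theorem gammaField_eq (hz : z ∈ resSet (restrictKer T Γ₀)) {γ : G →ₗ[ℂ] T.domain}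
    (hγ : ∀ ξ, T (γ ξ) = z • (γ ξ : H)) (hγ₀ : ∀ ξ, Γ₀ (γ ξ) = ξ) :
    Function.Bijective (Γ₀.domRestrict (kerSub T z)) ∧ gammaField T Γ₀ z = γ := by
  have hbij : Function.Bijective (Γ₀.domRestrict (kerSub T z)) := by
    refine ⟨(injective_iff_map_eq_zero _).2 fun u hu => ?_,
      fun ξ => ⟨⟨γ ξ, mem_kerSub.2 (hγ ξ)⟩, hγ₀ ξ⟩⟩
    have hd : ((u : T.domain) : H) ∈ (restrictKer T Γ₀).domain :=
      mem_restrictKer_domain.2 ⟨(u : T.domain).2, hu⟩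
    exact Subtype.ext (Subtype.ext (eq_zero_of_mem_resSet hz ⟨_, hd⟩
      ((restrictKer_apply _ (u : T.domain).2).trans (mem_kerSub.1 u.2))))
  refine ⟨hbij, LinearMap.ext fun ξ => ?_⟩
  rw [gammaField, dif_pos hbij]
  have : (LinearEquiv.ofBijective (Γ₀.domRestrict (kerSub T z)) hbij).symm ξ =
      ⟨γ ξ, mem_kerSub.2 (hγ ξ)⟩ := by
    rw [LinearEquiv.symm_apply_eq]
    exact (hγ₀ ξ).symm
  simp [this]

theorem resolventOp_mem_restrictKer (hz : z ∈ resSet (restrictKer T Γ₀)) (f : H) :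
    ∃ h : resolventOp (restrictKer T Γ₀) z f ∈ T.domain,
      Γ₀ ⟨_, h⟩ = 0 ∧ T ⟨_, h⟩ = f + z • resolventOp (restrictKer T Γ₀) z f := by
  obtain ⟨h1, h2⟩ := (resolventOp_spec hz).1 f
  obtain ⟨h3, h4⟩ := mem_restrictKer_domain.1 h1
  refine ⟨h3, h4, ?_⟩
  rw [restrictKer_apply _ h3] at h2
  rw [← sub_eq_iff_eq_add]
  exact h2

/-- Source of eigenvectors: since `Γ₀ γ ξ = ξ`, the boundary condition for `γ ξ` reads `(I + P M(z))
ξ = 0`. -/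
theorem gamma_mem_restrictKer (hγ : ∀ ξ, T (γ ξ) = z • (γ ξ : H)) (hγ₀ : ∀ ξ, Γ₀ (γ ξ) = ξ)
    {ξ : G} (hξ : ξ + P (Γ₁ (γ ξ)) = 0) :
    ∃ h : (γ ξ : H) ∈ (restrictKer T (Γ₀ + P ∘ₗ Γ₁)).domain,
      restrictKer T (Γ₀ + P ∘ₗ Γ₁) ⟨_, h⟩ = z • (γ ξ : H) := by
  have h : (γ ξ : H) ∈ (restrictKer T (Γ₀ + P ∘ₗ Γ₁)).domain :=
    mem_restrictKer_domain.2 ⟨(γ ξ).2, by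
      simpa [hγ₀] using hξ⟩
  exact ⟨h, (restrictKer_apply _ (γ ξ).2).trans (hγ ξ)⟩

end

/-! ### Criteria for membership in the resolvent set. -/

variable [CompleteSpace H]

/-- Closed graph theorem: the graph of the algebraic inverse is the preimage of the closed graph of
`A` under a continuous map of `H × H`. -/
theorem mem_resSet_of_bijective (hA : A.IsClosed)
    (hinj : ∀ u : A.domain, A u = z • (u : H) → (u : H) = 0)
    (hsurj : ∀ f : H, ∃ u : A.domain, A u - z • (u : H) = f) : z ∈ resSet A := by
  let φ : A.domain →ₗ[ℂ] H := A.toFun - z • A.domain.subtype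
  have hφ : ∀ u, φ u = A u - z • (u : H) := fun u => rfl
  have hbij : Function.Bijective φ := by
    refine ⟨(injective_iff_map_eq_zero φ).2 fun u hu => Subtype.ext ?_, hsurj⟩
    exact hinj u (sub_eq_zero.1 (by rwa [hφ] at hu))
  let e := LinearEquiv.ofBijective φ hbij
  let R : H →ₗ[ℂ] H := A.domain.subtype ∘ₗ e.symm.toLinearMap
  have he : ∀ f, A (e.symm f) - z • (e.symm f : H) = f := fun f => e.apply_symm_apply f
  have hgr : (R.graph : Set (H × H)) = (fun p : H × H => (p.2, p.1 + z • p.2)) ⁻¹' A.graph := by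
    ext ⟨f, u⟩
    simp only [SetLike.mem_coe, LinearMap.mem_graph_iff, mem_preimage, LinearPMap.mem_graph_iff]
    constructor
    · rintro rfl
      refine ⟨e.symm f, rfl, ?_⟩
      rw [← sub_eq_iff_eq_add]
      exact he f
    · rintro ⟨y, rfl, hy⟩
      have : e y = f := by
        change A y - z • (y : H) = f
        rw [hy, add_sub_cancel_right]
      change (y : H) = (e.symm f : H)
      rw [← this, e.symm_apply_apply]
  have hc : Continuous R := by
    refine R.continuous_of_isClosed_graph ?_
    rw [hgr]
    exact IsClosed.preimage (by fun_prop) hA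
  refine ⟨⟨R, hc⟩, fun f => ⟨(e.symm f).2, he f⟩, fun u => ?_⟩
  change ((e.symm (e u) : A.domain) : H) = u
  rw [e.symm_apply_apply]

/-- The bound at `z` makes `A - z` injective with closed range. The orthogonal complement of the
range is `ker (A* - z̄) = ker (A - z̄)`, which is trivial by the bound at `z̄`. -/
theorem mem_resSet_of_isSelfAdjoint (hA : IsSelfAdjoint A) {c : ℝ} (hc : 0 < c)
    (h1 : ∀ u : A.domain, c * ‖(u : H)‖ ≤ ‖A u - z • (u : H)‖)
    (h2 : ∀ u : A.domain, c * ‖(u : H)‖ ≤ ‖A u - conj z • (u : H)‖) : z ∈ resSet A := by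
  have hz0 : ∀ w : ℂ, (∀ u : A.domain, c * ‖(u : H)‖ ≤ ‖A u - w • (u : H)‖) →
      ∀ u : A.domain, A u = w • (u : H) → (u : H) = 0 := by
    intro w hw u hu
    have := hw u
    rw [hu, sub_self, norm_zero] at this
    exact norm_le_zero_iff.1 (nonpos_of_mul_nonpos_right this hc)
  have hcl := hA.isClosed
  have : CompleteSpace A.graph := IsClosed.completeSpace_coe (hs := hcl)
  let ψ : A.graph →L[ℂ] H :=
    (ContinuousLinearMap.snd ℂ H H - z • ContinuousLinearMap.fst ℂ H H) ∘L A.graph.subtypeL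
  have hψ : ∀ p : A.graph, ψ p = (p : H × H).2 - z • (p : H × H).1 := fun p => rfl
  have hgr : ∀ p : A.graph, ∃ u : A.domain, (u : H) = (p : H × H).1 ∧ A u = (p : H × H).2 :=
    fun p => (LinearPMap.mem_graph_iff A).1 p.2
  -- The graph norm is the larger of `‖u‖ ≤ c⁻¹ ‖ψ p‖` and `‖A u‖ ≤ ‖ψ p‖ + ‖z‖ ‖u‖`; the constant
  -- dominates both bounds.
  have hanti : AntilipschitzWith (Real.toNNReal (1 + ‖z‖ * c⁻¹ + c⁻¹)) ψ := by
    refine AddMonoidHomClass.antilipschitz_of_bound ψ fun p => ?_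
    obtain ⟨u, hu1, hu2⟩ := hgr p
    have hu := h1 u
    rw [hu1, hu2, ← hψ] at hu
    have hu' : ‖(p : H × H).1‖ ≤ c⁻¹ * ‖ψ p‖ := by
      rw [inv_mul_eq_div, le_div_iff₀ hc]; linarith
    have h3 : ‖(p : H × H).2‖ ≤ ‖ψ p‖ + ‖z‖ * ‖(p : H × H).1‖ := by
      calc ‖(p : H × H).2‖ = ‖ψ p + z • (p : H × H).1‖ := by rw [hψ]; simp
        _ ≤ _ := (norm_add_le _ _).trans (by rw [norm_smul])
    have hc' : 0 < c⁻¹ := inv_pos.2 hc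
    rw [Real.coe_toNNReal _ (by positivity)]
    have h4 : ‖z‖ * ‖(p : H × H).1‖ ≤ ‖z‖ * (c⁻¹ * ‖ψ p‖) :=
      mul_le_mul_of_nonneg_left hu' (norm_nonneg _)
    have h5 : 0 ≤ c⁻¹ * ‖ψ p‖ := by positivity
    have h6 : 0 ≤ ‖z‖ * (c⁻¹ * ‖ψ p‖) := by positivity
    have h7 := norm_nonneg (ψ p)
    change max ‖(p : H × H).1‖ ‖(p : H × H).2‖ ≤ _
    exact max_le (by nlinarith) (by nlinarith)
  have hcr : IsClosed (ψ.range : Set H) := by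
    rw [LinearMap.coe_range]
    exact hanti.isClosed_range ψ.uniformContinuous
  refine mem_resSet_of_bijective hcl (hz0 z h1) fun f => ?_
  have htop : ψ.range = ⊤ := by
    rw [← IsClosed.submodule_topologicalClosure_eq hcr, Submodule.topologicalClosure_eq_top_iff,
      Submodule.eq_bot_iff]
    intro v hv
    have hv' : ∀ u : A.domain, inner ℂ (conj z • v) (u : H) = inner ℂ v (A u) := by
      intro u
      have := (Submodule.mem_orthogonal' _ _).1 hv (ψ ⟨(u, A u), A.mem_graph u⟩) ⟨_, rfl⟩
      rw [hψ, inner_sub_right, sub_eq_zero, inner_smul_right] at this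
      rw [this, inner_smul_left, Complex.conj_conj]
    have hd : v ∈ A†.domain := LinearPMap.mem_adjoint_domain_of_exists _ ⟨_, hv'⟩
    have hmem : (v, conj z • v) ∈ A†.graph :=
      (LinearPMap.mem_graph_iff _).2 ⟨⟨v, hd⟩, rfl, LinearPMap.adjoint_apply_eq hA.dense_domain _ hv'⟩
    rw [LinearPMap.isSelfAdjoint_def.1 hA] at hmem
    obtain ⟨u, hu1, hu2⟩ := (LinearPMap.mem_graph_iff _).1 hmem
    simp only at hu1 hu2
    rw [← hu1]
    exact hz0 _ h2 u (by rw [hu2, hu1])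
  obtain ⟨p, hp⟩ : f ∈ ψ.range := htop ▸ Submodule.mem_top
  obtain ⟨u, hu1, hu2⟩ := hgr p
  refine ⟨u, ?_⟩
  rw [hu1, hu2, ← hψ]
  exact hp

theorem isFormalAdjoint_of_isSelfAdjoint (hA : IsSelfAdjoint A) : A.IsFormalAdjoint A := by
  have := LinearPMap.adjoint_isFormalAdjoint hA.dense_domain
  rwa [LinearPMap.isSelfAdjoint_def.1 hA] at this

theorem mem_resSet_of_im_ne_zero (hA : IsSelfAdjoint A) (hz : z.im ≠ 0) : z ∈ resSet A := by
  have h := isFormalAdjoint_of_isSelfAdjoint hA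
  refine mem_resSet_of_isSelfAdjoint hA (abs_pos.2 hz) (abs_im_mul_norm_le h z) fun u => ?_
  have := abs_im_mul_norm_le h (conj z) u
  rwa [Complex.conj_im, abs_neg] at this

/-! ### Boundary triples -/

section Triple

variable {S T : H →ₗ.[ℂ] H} {Γ₀ Γ₁ : T.domain →ₗ[ℂ] G}

/-- Symmetry of `P` makes the right side of Green's identity vanish on `ker (Γ₀ + P Γ₁)`, so the
restriction is symmetric. Conversely its adjoint is contained in `S* = T`, because the restriction
extends `S`; surjectivity supplies enough test elements in its domain to force the boundary
condition on every element of the adjoint domain. -/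
theorem isSelfAdjoint_restrictKer (hS : Dense (S.domain : Set H)) (hST : S† = T) (hle : S ≤ T)
    (green : ∀ f g : T.domain, inner ℂ (T f) (g : H) - inner ℂ (f : H) (T g) =
      inner ℂ (Γ₁ f) (Γ₀ g) - inner ℂ (Γ₀ f) (Γ₁ g))
    (surj : Function.Surjective fun f : T.domain => (Γ₀ f, Γ₁ f))
    {P : G →ₗ[ℂ] G} (hP : P.IsSymmetric) :
    S ≤ restrictKer T (Γ₀ + P ∘ₗ Γ₁) ∧ IsSelfAdjoint (restrictKer T (Γ₀ + P ∘ₗ Γ₁)) := by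
  subst hST
  set L := Γ₀ + P ∘ₗ Γ₁ with hL
  have hLe : S ≤ restrictKer (S†) L := by
    refine ⟨fun x hx => ?_, fun x y hxy => ?_⟩
    · refine mem_restrictKer_domain.2 ⟨hle.1 hx, ?_⟩
      set x' : S†.domain := ⟨x, hle.1 hx⟩
      -- With these data the right side of Green's identity is `‖Γ₁ x'‖² + ‖Γ₀ x'‖²`, while the left
      -- side is zero since `x'` lies in `dom S`.
      obtain ⟨g, hg⟩ := surj (Γ₁ x', -Γ₀ x')
      obtain ⟨hg0, hg1⟩ := Prod.ext_iff.1 hg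
      simp only at hg0 hg1
      have h1 := green x' g
      have h2 : S† x' = S ⟨x, hx⟩ := (hle.2 (x := ⟨x, hx⟩) (y := x') rfl).symm
      rw [h2, ← (LinearPMap.adjoint_isFormalAdjoint hS).symm ⟨x, hx⟩ g, sub_self, hg0, hg1,
        inner_neg_right, sub_neg_eq_add] at h1
      have h3 := congrArg Complex.re h1
      have hre : ∀ y : G, (inner ℂ y y).re = ‖y‖ ^ 2 := inner_self_eq_norm_sq (𝕜 := ℂ)
      rw [Complex.add_re, hre, hre, Complex.zero_re] at h3
      have h4 : Γ₁ x' = 0 := norm_eq_zero.1 (by nlinarith [norm_nonneg (Γ₁ x'), norm_nonneg (Γ₀ x')])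
      have h5 : Γ₀ x' = 0 := norm_eq_zero.1 (by nlinarith [norm_nonneg (Γ₁ x'), norm_nonneg (Γ₀ x')])
      rw [hL, LinearMap.add_apply, LinearMap.comp_apply, h4, h5, map_zero, add_zero]
    · rw [restrictKer_apply y (mem_restrictKer_domain.1 y.2).1]
      exact hle.2 hxy
  refine ⟨hLe, ?_⟩
  have hd : Dense ((restrictKer (S†) L).domain : Set H) := hS.mono hLe.1
  have hsymm : (restrictKer (S†) L).IsFormalAdjoint (restrictKer (S†) L) := by
    intro x y
    obtain ⟨hx, hx'⟩ := mem_restrictKer_domain.1 x.2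
    obtain ⟨hy, hy'⟩ := mem_restrictKer_domain.1 y.2
    rw [restrictKer_apply x hx, restrictKer_apply y hy, ← sub_eq_zero]
    refine (green ⟨x, hx⟩ ⟨y, hy⟩).trans ?_
    replace hx' : Γ₀ ⟨x, hx⟩ = -P (Γ₁ ⟨x, hx⟩) := add_eq_zero_iff_eq_neg.1 hx'
    replace hy' : Γ₀ ⟨y, hy⟩ = -P (Γ₁ ⟨y, hy⟩) := add_eq_zero_iff_eq_neg.1 hy'
    rw [hx', hy', inner_neg_left, inner_neg_right, hP]
    ring
  refine LinearPMap.isSelfAdjoint_def.2 (le_antisymm ?_ (hsymm.le_adjoint hd))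
  refine LinearPMap.le_of_le_graph fun p hp => ?_
  obtain ⟨v, w⟩ := p
  obtain ⟨⟨v', hv'⟩, rfl, hw⟩ := (LinearPMap.mem_graph_iff _).1 hp
  simp only at hw hp ⊢
  have hf : ∀ x : (restrictKer (S†) L).domain, inner ℂ (restrictKer (S†) L x) v' = inner ℂ (x : H) w := by
    intro x
    rw [(LinearPMap.adjoint_isFormalAdjoint hd).symm x ⟨v', hv'⟩, hw]
  have hfS : ∀ x : S.domain, inner ℂ w (x : H) = inner ℂ v' (S x) := by
    intro x
    have h := hf ⟨x, hLe.1 x.2⟩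
    rw [← hLe.2 (x := x) rfl] at h
    rw [← inner_conj_symm, ← h, inner_conj_symm]
  have hvd : v' ∈ S†.domain := LinearPMap.mem_adjoint_domain_of_exists _ ⟨w, hfS⟩
  have hvw : S† ⟨v', hvd⟩ = w := LinearPMap.adjoint_apply_eq hS _ hfS
  have hLv : L ⟨v', hvd⟩ = 0 := by
    refine ext_inner_left ℂ fun ξ => ?_
    -- These data satisfy the boundary condition for every `ξ`. Green's identity against `v'` then
    -- becomes `(ξ, L v') = 0`.
    obtain ⟨f, hfΓ⟩ := surj (-P ξ, ξ)
    obtain ⟨hf0, hf1⟩ := Prod.ext_iff.1 hfΓ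
    simp only at hf0 hf1
    have hfd : (f : H) ∈ (restrictKer (S†) L).domain := mem_restrictKer_domain.2 ⟨f.2, by
      simp [hL, hf0, hf1]⟩
    have h1 := green f ⟨v', hvd⟩
    have h2 := hf ⟨f, hfd⟩
    rw [restrictKer_apply _ f.2] at h2
    change inner ℂ (S† f) v' = _ at h2
    rw [hvw] at h1
    change inner ℂ (S† f) v' - _ = _ at h1
    rw [h2, sub_self, hf0, hf1, inner_neg_left, sub_neg_eq_add, hP, ← inner_add_right] at h1
    rw [inner_zero_right]
    exact h1.symm
  exact (LinearPMap.mem_graph_iff _).2 ⟨⟨v', mem_restrictKer_domain.2 ⟨hvd, hLv⟩⟩, rfl, by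
    rw [restrictKer_apply _ hvd, hvw]⟩

variable {P : G →ₗ[ℂ] G} {γ : G →ₗ[ℂ] T.domain}

/-- Krein's formula, as the solution of `(A - z) u = f`. -/
theorem krein_solution (hz : z ∈ resSet (restrictKer T Γ₀))
    (hγ : ∀ ξ, T (γ ξ) = z • (γ ξ : H)) (hγ₀ : ∀ ξ, Γ₀ (γ ξ) = ξ) (f : H)
    {h : resolventOp (restrictKer T Γ₀) z f ∈ T.domain} {c : G}
    (hc : c + P (Γ₁ (γ c)) = P (Γ₁ ⟨_, h⟩)) :
    ∃ u : (restrictKer T (Γ₀ + P ∘ₗ Γ₁)).domain,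
      (u : H) = resolventOp (restrictKer T Γ₀) z f - (γ c : H) ∧
        restrictKer T (Γ₀ + P ∘ₗ Γ₁) u - z • (u : H) = f := by
  obtain ⟨h', h0, hT⟩ := resolventOp_mem_restrictKer hz f
  let v : T.domain := ⟨_, h'⟩ - γ c
  have hv : (v : H) ∈ (restrictKer T (Γ₀ + P ∘ₗ Γ₁)).domain := by
    refine mem_restrictKer_domain.2 ⟨v.2, ?_⟩
    change (Γ₀ + P ∘ₗ Γ₁) (⟨_, h'⟩ - γ c) = 0
    rw [LinearMap.add_apply, LinearMap.comp_apply, map_sub, map_sub, map_sub, h0, hγ₀, ← hc]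
    abel
  refine ⟨⟨v, hv⟩, rfl, ?_⟩
  rw [restrictKer_apply _ v.2]
  change T (⟨_, h'⟩ - γ c) - z • (resolventOp (restrictKer T Γ₀) z f - (γ c : H)) = f
  rw [LinearPMap.map_sub, hT, hγ, smul_sub]
  abel

/-- An element of `ker (I + P M(z))` produces an eigenvector `γ ξ`. If that kernel is trivial,
finite dimension makes `I + P M(z)` surjective, Krein's formula solves `(A - z) u = f`, and the
closed graph theorem finishes. -/
theorem mem_resSet_restrictKer_iff [FiniteDimensional ℂ G] (hz : z ∈ resSet (restrictKer T Γ₀))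
    (hγ : ∀ ξ, T (γ ξ) = z • (γ ξ : H)) (hγ₀ : ∀ ξ, Γ₀ (γ ξ) = ξ)
    (hcl : (restrictKer T (Γ₀ + P ∘ₗ Γ₁)).IsClosed) :
    z ∈ resSet (restrictKer T (Γ₀ + P ∘ₗ Γ₁)) ↔ ∀ ξ, ξ + P (Γ₁ (γ ξ)) = 0 → ξ = 0 := by
  constructor
  · intro hzA ξ hξ
    obtain ⟨h1, h2⟩ := gamma_mem_restrictKer hγ hγ₀ hξ
    exact eq_zero_of_gamma_eq_zero hγ₀ (eq_zero_of_mem_resSet hzA ⟨_, h1⟩ h2)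
  · intro hinj
    let Q : G →ₗ[ℂ] G := LinearMap.id + P ∘ₗ Γ₁ ∘ₗ γ
    have hQ : Function.Injective Q := (injective_iff_map_eq_zero Q).2 hinj
    refine mem_resSet_of_bijective hcl (fun u hu => ?_) fun f => ?_
    · obtain ⟨h1, h2⟩ := mem_restrictKer_domain.1 u.2
      rw [restrictKer_apply u h1] at hu
      obtain ⟨hbij, -⟩ := gammaField_eq hz hγ hγ₀
      -- Both sides lie in `ker (T - z)` and have the same `Γ₀`, which is injective there.
      have e : (⟨u, h1⟩ : T.domain) = γ (Γ₀ ⟨u, h1⟩) := congrArg Subtype.val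
        (hbij.1 (a₁ := ⟨⟨u, h1⟩, mem_kerSub.2 hu⟩) (a₂ := ⟨γ (Γ₀ ⟨u, h1⟩), mem_kerSub.2 (hγ _)⟩)
          (hγ₀ _).symm)
      have h0 : Γ₀ ⟨u, h1⟩ = 0 := by
        refine hinj _ ?_
        rw [← e]
        exact h2
      rw [h0, map_zero] at e
      exact congrArg Subtype.val e
    · obtain ⟨h', -⟩ := resolventOp_mem_restrictKer hz f
      obtain ⟨c, hc⟩ := LinearMap.surjective_of_injective hQ (P (Γ₁ ⟨_, h'⟩))
      obtain ⟨u, -, hu⟩ := krein_solution hz hγ hγ₀ f (c := c) hc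
      exact ⟨u, hu⟩

/-- `γ(z̄)* = Γ₁ (A₀ - z)⁻¹`. -/
theorem inner_gamma_conj (green : ∀ f g : T.domain,
      inner ℂ (T f) (g : H) - inner ℂ (f : H) (T g) =
        inner ℂ (Γ₁ f) (Γ₀ g) - inner ℂ (Γ₀ f) (Γ₁ g))
    (hz : z ∈ resSet (restrictKer T Γ₀))
    {γ : G →ₗ[ℂ] T.domain} (hγ : ∀ ξ, T (γ ξ) = conj z • (γ ξ : H)) (hγ₀ : ∀ ξ, Γ₀ (γ ξ) = ξ) (f : H)
    {h : resolventOp (restrictKer T Γ₀) z f ∈ T.domain} (ξ : G) :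
    inner ℂ ξ (Γ₁ ⟨_, h⟩) = inner ℂ (γ ξ : H) f := by
  obtain ⟨h', h0, hT⟩ := resolventOp_mem_restrictKer hz f
  -- As `γ ξ` has eigenvalue `z̄`, the terms with `z` cancel, and `Γ₀` annihilates the resolvent of
  -- `A₀`.
  have := green (γ ξ) ⟨_, h'⟩
  rw [hγ, hT, h0, hγ₀, inner_zero_right, zero_sub, inner_smul_left, Complex.conj_conj,
    inner_add_right, inner_smul_right] at this
  rw [← neg_inj, ← this]
  ring

/-- The eigenspace embeds into `G` through `Γ₀`: an eigenvector with `Γ₀ u = 0` would be an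
eigenvector of `A₀` at a point of `ρ(A₀)`. -/
theorem kerSub_restrictKer [FiniteDimensional ℂ G] (hz : z ∈ resSet (restrictKer T Γ₀))
    (hγ : ∀ ξ, T (γ ξ) = z • (γ ξ : H)) (hγ₀ : ∀ ξ, Γ₀ (γ ξ) = ξ)
    {ξ : G} (hξ0 : ξ ≠ 0) (hξ : ξ + P (Γ₁ (γ ξ)) = 0) :
    kerSub (restrictKer T (Γ₀ + P ∘ₗ Γ₁)) z ≠ ⊥ ∧
      FiniteDimensional ℂ (kerSub (restrictKer T (Γ₀ + P ∘ₗ Γ₁)) z) := by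
  constructor
  · obtain ⟨h1, h2⟩ := gamma_mem_restrictKer hγ hγ₀ hξ
    intro hbot
    have h3 : (⟨_, h1⟩ : (restrictKer T (Γ₀ + P ∘ₗ Γ₁)).domain) ∈
      kerSub (restrictKer T (Γ₀ + P ∘ₗ Γ₁)) z := mem_kerSub.2 h2
    rw [hbot, Submodule.mem_bot] at h3
    exact hξ0 (eq_zero_of_gamma_eq_zero hγ₀ (congrArg Subtype.val h3))
  · have hle : (restrictKer T (Γ₀ + P ∘ₗ Γ₁)).domain ≤ T.domain := LinearPMap.domRestrict_le.1
    let J : kerSub (restrictKer T (Γ₀ + P ∘ₗ Γ₁)) z →ₗ[ℂ] G :=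
      Γ₀ ∘ₗ Submodule.inclusion hle ∘ₗ Submodule.subtype _
    refine FiniteDimensional.of_injective J ((injective_iff_map_eq_zero J).2 fun u hu => ?_)
    have hd : ((u : (restrictKer T (Γ₀ + P ∘ₗ Γ₁)).domain) : H) ∈ (restrictKer T Γ₀).domain :=
      mem_restrictKer_domain.2 ⟨hle u.1.2, hu⟩
    have hu2 := mem_kerSub.1 u.2
    rw [restrictKer_apply _ (hle u.1.2)] at hu2
    exact Subtype.ext (Subtype.ext (eq_zero_of_mem_resSet hz ⟨_, hd⟩
      ((restrictKer_apply _ (hle u.1.2)).trans hu2)))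

end Triple

end AbstractOperators

section

/-! ### Primitives of `L²`-functions and integration by parts -/

/-- The primitive of `g` with value `c` at `0`. -/
def primitive (g : L2) (c : Spinor) (x : ℝ) : Spinor := c + ∫ t in (0 : ℝ)..x, g t

/-- On `Ω`, the function `f` is the primitive of `g` with value `c` at `0`. -/
def IsPrimitiveOn (Ω : Set ℝ) (f g : L2) (c : Spinor) : Prop :=
  ∀ᵐ x, x ∈ Ω → f x = primitive g c x

theorem continuous_primitive (g : L2) (c : Spinor) : Continuous (primitive g c) :=
  continuous_const.add (continuous_primitive_coe g)

theorem primitive_zero (g : L2) (c : Spinor) : primitive g c 0 = c := by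
  simp [primitive]

theorem ae_hasDerivAt_primitive (g : L2) (c : Spinor) :
    ∀ᵐ x, HasDerivAt (primitive g c) (g x) x := by
  filter_upwards [LocallyIntegrable.ae_hasDerivAt_integral (locallyIntegrable_coe g)] with x hx
  exact (hx 0).const_add c

theorem absolutelyContinuousOnInterval_primitive (g : L2) (c : Spinor) (L : Spinor →L[ℝ] ℝ)
    (R : ℝ) : AbsolutelyContinuousOnInterval (fun x => L (primitive g c x)) 0 R := by
  have hLF : (fun x => L (primitive g c x)) = fun x => L c + ∫ t in (0 : ℝ)..x, L (g t) := by
    ext x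
    rw [primitive, map_add, L.intervalIntegral_comp_comm (intervalIntegrable_coe g 0 x)]
  have hLg : IntervalIntegrable (fun t => L (g t)) volume 0 R :=
    ⟨L.integrable_comp (intervalIntegrable_coe g 0 R).1,
      L.integrable_comp (intervalIntegrable_coe g 0 R).2⟩
  rw [hLF]
  exact ((LipschitzWith.const (L c)).lipschitzOnWith (s := uIcc 0 R)).absolutelyContinuousOnInterval.fun_add
    (hLg.absolutelyContinuousOnInterval_intervalIntegral left_mem_uIcc)

/-- The real part of the inner product is a sum of products of real coordinates, each absolutely
continuous; so it is the integral of its almost everywhere derivative. -/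
theorem integral_re_inner_primitive (f g : L2) (a b : Spinor) (R : ℝ) :
    ∫ x in (0 : ℝ)..R, (inner ℂ (f x) (primitive g b x) + inner ℂ (primitive f a x) (g x)).re =
      (inner ℂ (primitive f a R) (primitive g b R)).re - (inner ℂ a b).re := by
  let W : ℝ → ℝ := fun x => (inner ℂ (primitive f a x) (primitive g b x)).re
  let reL : Fin 2 → Spinor →L[ℝ] ℝ := fun i =>
    Complex.reCLM ∘L (EuclideanSpace.proj i : Spinor →L[ℂ] ℂ).restrictScalars ℝ
  let imL : Fin 2 → Spinor →L[ℝ] ℝ := fun i =>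
    Complex.imCLM ∘L (EuclideanSpace.proj i : Spinor →L[ℂ] ℂ).restrictScalars ℝ
  have hW : W = fun x => (reL 0 (primitive f a x) * reL 0 (primitive g b x) +
      imL 0 (primitive f a x) * imL 0 (primitive g b x)) +
      (reL 1 (primitive f a x) * reL 1 (primitive g b x) +
      imL 1 (primitive f a x) * imL 1 (primitive g b x)) := by
    ext x
    simp only [W, PiLp.inner_apply, Fin.sum_univ_two, Complex.add_re, RCLike.inner_apply,
      Complex.mul_re, Complex.conj_re, Complex.conj_im, reL, imL, ContinuousLinearMap.comp_apply,
      ContinuousLinearMap.coe_restrictScalars', EuclideanSpace.proj, PiLp.proj_apply,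
      Complex.reCLM_apply, Complex.imCLM_apply]
    ring
  have hac : AbsolutelyContinuousOnInterval W 0 R := by
    have H := fun L => absolutelyContinuousOnInterval_primitive f a L R
    have K := fun L => absolutelyContinuousOnInterval_primitive g b L R
    rw [hW]
    exact (((H _).fun_mul (K _)).fun_add ((H _).fun_mul (K _))).fun_add
      (((H _).fun_mul (K _)).fun_add ((H _).fun_mul (K _)))
  have h1 := hac.integral_deriv_eq_sub
  have h2 : W 0 = (inner ℂ a b).re := by simp only [W, primitive_zero]
  rw [h2] at h1
  refine Eq.trans ?_ h1
  refine intervalIntegral.integral_congr_ae ?_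
  filter_upwards [ae_hasDerivAt_primitive f a, ae_hasDerivAt_primitive g b] with x hf hg _
  have h3 := (hf.inner ℂ hg)
  have h4 : HasDerivAt W _ x := Complex.reCLM.hasFDerivAt.comp_hasDerivAt x h3
  rw [h4.deriv, Complex.reCLM_apply, add_comm]

variable {Ω : Set ℝ} {f g u v : L2} {a b : Spinor}

theorem IsPrimitiveOn.smul (h : IsPrimitiveOn Ω f u a) (c : ℂ) :
    IsPrimitiveOn Ω (c • f) (c • u) (c • a) := by
  filter_upwards [h, Lp.coeFn_smul c f] with x h1 h2 hx
  rw [h2, Pi.smul_apply, h1 hx, primitive, primitive, smul_add, ← intervalIntegral.integral_smul]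
  congr 1
  refine intervalIntegral.integral_congr_ae ?_
  filter_upwards [Lp.coeFn_smul c u] with t ht _
  rw [ht, Pi.smul_apply]

theorem IsPrimitiveOn.sub (h : IsPrimitiveOn Ω f u a) (h' : IsPrimitiveOn Ω g v b) :
    IsPrimitiveOn Ω (f - g) (u - v) (a - b) := by
  filter_upwards [h, h', Lp.coeFn_sub f g] with x h1 h1' h2 hx
  rw [h2, Pi.sub_apply, h1 hx, h1' hx, primitive, primitive, primitive, add_sub_add_comm,
    ← intervalIntegral.integral_sub (intervalIntegrable_coe u 0 x) (intervalIntegrable_coe v 0 x)]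
  congr 1
  refine intervalIntegral.integral_congr_ae ?_
  filter_upwards [Lp.coeFn_sub u v] with t ht _
  rw [ht, Pi.sub_apply]

theorem coeFn_matL2 (B : Matrix (Fin 2) (Fin 2) ℂ) (f : L2) :
    (matL2 B f : ℝ → Spinor) =ᵐ[volume] fun x => mat B (f x) :=
  ContinuousLinearMap.coeFn_compLpL (mat B) f

theorem IsPrimitiveOn.mat (h : IsPrimitiveOn Ω f u a) (B : Matrix (Fin 2) (Fin 2) ℂ) :
    IsPrimitiveOn Ω (matL2 B f) (matL2 B u) (mat B a) := by
  filter_upwards [h, coeFn_matL2 B f] with x h1 h2 hx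
  rw [h2, h1 hx, primitive, primitive, map_add,
    ← ContinuousLinearMap.intervalIntegral_comp_comm _ (intervalIntegrable_coe u 0 x)]
  congr 1
  refine intervalIntegral.integral_congr_ae ?_
  filter_upwards [coeFn_matL2 B u] with t ht _
  rw [ht]

theorem IsPrimitiveOn.isTrace (hΩ : MeasurableSet Ω) (h : IsPrimitiveOn Ω f u a) :
    IsTrace Ω f a :=
  ⟨_, (continuous_primitive u a).continuousOn, (ae_restrict_iff' hΩ).2 h, by
    have := (continuous_primitive u a).tendsto 0
    rw [primitive_zero] at this
    exact this.mono_left nhdsWithin_le_nhds⟩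

theorem IsPrimitiveOn.hasWeakDerivOn (hΩ : MeasurableSet Ω) (h : IsPrimitiveOn Ω f u a) :
    HasWeakDerivOn Ω f u := by
  intro φ hφ
  have hd : tsupport (deriv φ) ⊆ Ω :=
    (closure_minimal support_deriv_subset (isClosed_tsupport φ)).trans hφ.2.2
  have h1 : ∫ x in Ω, deriv φ x • f x = ∫ x in Ω, deriv φ x • primitive u a x := by
    refine setIntegral_congr_ae hΩ ?_
    filter_upwards [h] with x hx hxΩ
    rw [hx hxΩ]
  rw [h1, setIntegral_eq_integral_of_test hd, setIntegral_eq_integral_of_test hφ.2.2,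
    ← integral_deriv_smul_primitive u ⟨hφ.1, hφ.2.1, subset_univ _⟩]
  simp only [primitive, smul_add]
  have h2 : ∫ x, deriv φ x • a = 0 := by
    rw [integral_smul_const, integral_eq_zero_of_hasDerivAt_of_integrable
      (fun x => (hφ.1.differentiable (by simp) x).hasDerivAt)
      (hφ.continuous_deriv.integrable_of_hasCompactSupport hφ.2.1.deriv)
      (hφ.1.continuous.integrable_of_hasCompactSupport hφ.2.1), zero_smul]
  rw [integral_add, h2, zero_add]
  · exact (hφ.continuous_deriv.integrable_of_hasCompactSupport hφ.2.1.deriv).smul_const a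
  · exact (continuous_primitive_coe u).locallyIntegrable.integrable_smul_left_of_hasCompactSupport
      hφ.continuous_deriv hφ.2.1.deriv

/-! ### `H¹` in terms of primitives. -/

theorem hasWeakDerivOn_Ioi_iff : HasWeakDerivOn (Ioi 0) f u ↔ ∃ a, IsPrimitiveOn (Ioi 0) f u a :=
  ⟨HasWeakDerivOn.exists_ae_eq isOpen_Ioi ordConnected_Ioi ⟨1, by simp⟩,
    fun ⟨_, h⟩ => h.hasWeakDerivOn measurableSet_Ioi⟩

theorem hasWeakDerivOn_Iio_iff : HasWeakDerivOn (Iio 0) f u ↔ ∃ a, IsPrimitiveOn (Iio 0) f u a :=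
  ⟨HasWeakDerivOn.exists_ae_eq isOpen_Iio ordConnected_Iio ⟨-1, by simp⟩,
    fun ⟨_, h⟩ => h.hasWeakDerivOn measurableSet_Iio⟩

/-- Gluing criterion: two `H¹` halves form an `H¹` function on the line precisely when their
boundary values at `0` agree. This is what identifies `ker Γ₀` with `dom A₀`. -/
theorem hasWeakDerivOn_univ_iff : HasWeakDerivOn univ f u ↔
    ∃ a, IsPrimitiveOn (Ioi 0) f u a ∧ IsPrimitiveOn (Iio 0) f u a := by
  constructor
  · intro h
    obtain ⟨a, ha⟩ := HasWeakDerivOn.exists_ae_eq isOpen_univ ordConnected_univ ⟨0, trivial⟩ h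
    refine ⟨a, ?_, ?_⟩ <;>
    · filter_upwards [ha] with x hx _ using hx trivial
  · rintro ⟨a, h1, h2⟩
    refine IsPrimitiveOn.hasWeakDerivOn (a := a) MeasurableSet.univ ?_
    filter_upwards [h1, h2, (countable_singleton (0 : ℝ)).ae_notMem volume] with x h1 h2 h3 _
    rcases lt_trichotomy x 0 with h | h | h
    · exact h2 h
    · exact absurd h h3
    · exact h1 h

/-! ### Integration by parts and boundary values on the half-lines. -/

theorem setIntegral_re_inner_congr {R : ℝ} {s : Set ℝ} (hs : ∀ᵐ x, x ∈ uIoc 0 R → x ∈ s)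
    (hf : IsPrimitiveOn s f u a) (hg : IsPrimitiveOn s g v b) :
    ∫ x in (0 : ℝ)..R, (inner ℂ (u x) (g x) + inner ℂ (f x) (v x)).re =
      (inner ℂ (primitive u a R) (primitive v b R)).re - (inner ℂ a b).re := by
  rw [← integral_re_inner_primitive]
  refine intervalIntegral.integral_congr_ae ?_
  filter_upwards [hs, hf, hg] with x h1 h2 h3 hx
  rw [h2 (h1 hx), h3 (h1 hx)]

theorem integrable_inner_add (f g u v : L2) :
    Integrable fun x => inner ℂ (u x) (g x) + inner ℂ (f x) (v x) :=
  (L2.integrable_inner u g).add (L2.integrable_inner f v)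

/-- No boundary term at infinity: `Re (f, g)` has a limit there because its derivative is
integrable, and it is itself integrable near infinity, so the limit is `0`. -/
theorem integral_Ioi_re_inner (hf : IsPrimitiveOn (Ioi 0) f u a) (hg : IsPrimitiveOn (Ioi 0) g v b) :
    ∫ x in Ioi (0 : ℝ), (inner ℂ (u x) (g x) + inner ℂ (f x) (v x)).re = -(inner ℂ a b).re := by
  have h1 := intervalIntegral_tendsto_integral_Ioi 0
    (integrable_inner_add f g u v).re.integrableOn tendsto_id
  have h2 : Tendsto (fun R => (inner ℂ (primitive u a R) (primitive v b R)).re) atTop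
      (𝓝 ((∫ x in Ioi (0 : ℝ), (inner ℂ (u x) (g x) + inner ℂ (f x) (v x)).re) +
        (inner ℂ a b).re)) := by
    refine (h1.add_const _).congr' ?_
    filter_upwards [eventually_gt_atTop 0] with R hR
    have := setIntegral_re_inner_congr (R := R) (Eventually.of_forall fun x hx => by
      rw [uIoc_of_le hR.le] at hx; exact hx.1) hf hg
    simp only [id]
    exact eq_sub_iff_add_eq.1 this
  have h3 : IntegrableOn (fun R => (inner ℂ (primitive u a R) (primitive v b R)).re) (Ioi 0) := by
    refine (L2.integrable_inner (𝕜 := ℂ) f g).re.integrableOn.congr_fun_ae ?_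
    refine (ae_restrict_iff' measurableSet_Ioi).2 ?_
    filter_upwards [hf, hg] with x h2 h3 hx
    rw [h2 hx, h3 hx]
    rfl
  have h4 := IntegrableAtFilter.eq_zero_of_tendsto ⟨_, Ioi_mem_atTop 0, h3⟩ (fun s hs => by
    obtain ⟨c, hc⟩ := mem_atTop_sets.1 hs
    rw [← top_le_iff, ← Real.volume_Ici (a := c)]
    exact measure_mono hc) h2
  linarith

theorem integral_Iio_re_inner (hf : IsPrimitiveOn (Iio 0) f u a) (hg : IsPrimitiveOn (Iio 0) g v b) :
    ∫ x in Iio (0 : ℝ), (inner ℂ (u x) (g x) + inner ℂ (f x) (v x)).re = (inner ℂ a b).re := by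
  have h1 := intervalIntegral_tendsto_integral_Iic 0
    (integrable_inner_add f g u v).re.integrableOn tendsto_id
  rw [← integral_Iic_eq_integral_Iio]
  have h2 : Tendsto (fun R => (inner ℂ (primitive u a R) (primitive v b R)).re) atBot
      (𝓝 ((inner ℂ a b).re -
        (∫ x in Iic (0 : ℝ), (inner ℂ (u x) (g x) + inner ℂ (f x) (v x)).re))) := by
    refine (h1.const_sub _).congr' ?_
    filter_upwards [eventually_lt_atBot 0] with R hR
    have := setIntegral_re_inner_congr (R := R) (s := Iio 0) (by
      filter_upwards [(countable_singleton (0 : ℝ)).ae_notMem volume] with x hx0 hx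
      rw [uIoc_of_ge hR.le] at hx
      exact lt_of_le_of_ne hx.2 hx0) hf hg
    rw [intervalIntegral.integral_symm] at this
    simp only [id]
    change _ - (∫ x in R..(0 : ℝ), (inner ℂ (u x) (g x) + inner ℂ (f x) (v x)).re) = _
    linarith
  have h3 : IntegrableOn (fun R => (inner ℂ (primitive u a R) (primitive v b R)).re) (Iio 0) := by
    refine (L2.integrable_inner (𝕜 := ℂ) f g).re.integrableOn.congr_fun_ae ?_
    refine (ae_restrict_iff' measurableSet_Iio).2 ?_
    filter_upwards [hf, hg] with x h2 h3 hx
    rw [h2 hx, h3 hx]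
    rfl
  have h4 := IntegrableAtFilter.eq_zero_of_tendsto ⟨_, Iio_mem_atBot 0, h3⟩ (fun s hs => by
    obtain ⟨c, hc⟩ := mem_atBot_sets.1 hs
    rw [← top_le_iff, ← Real.volume_Iic (a := c)]
    exact measure_mono hc) h2
  change ∫ x in Iic (0 : ℝ), (inner ℂ (u x) (g x) + inner ℂ (f x) (v x)).re = _
  linarith

theorem re_inner_add_inner {a' b' : Spinor} (hf : IsPrimitiveOn (Ioi 0) f u a)
    (hf' : IsPrimitiveOn (Iio 0) f u a') (hg : IsPrimitiveOn (Ioi 0) g v b)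
    (hg' : IsPrimitiveOn (Iio 0) g v b') :
    (inner ℂ u g + inner ℂ f v : ℂ).re = (inner ℂ a' b' - inner ℂ a b : ℂ).re := by
  have hint := integrable_inner_add f g u v
  have h0 : (inner ℂ u g + inner ℂ f v : ℂ) = ∫ x, inner ℂ (u x) (g x) + inner ℂ (f x) (v x) := by
    rw [L2.inner_def, L2.inner_def, integral_add (L2.integrable_inner u g) (L2.integrable_inner f v)]
  have h1 : (inner ℂ u g + inner ℂ f v : ℂ).re =
      ∫ x, (inner ℂ (u x) (g x) + inner ℂ (f x) (v x)).re := by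
    rw [h0]
    exact (integral_re hint).symm
  have h2 := integral_add_compl (μ := volume) (s := Ioi (0 : ℝ)) measurableSet_Ioi hint.re
  rw [compl_Ioi, integral_Iic_eq_integral_Iio] at h2
  have h3 := integral_Ioi_re_inner hf hg
  have h4 := integral_Iio_re_inner hf' hg'
  rw [h1, Complex.sub_re, ← h4, ← neg_add_eq_sub, ← h3]
  exact h2.symm

/-- Integration by parts on `(-∞, 0) ∪ (0, ∞)`. -/
theorem inner_add_inner {a' b' : Spinor} (hf : IsPrimitiveOn (Ioi 0) f u a)
    (hf' : IsPrimitiveOn (Iio 0) f u a') (hg : IsPrimitiveOn (Ioi 0) g v b)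
    (hg' : IsPrimitiveOn (Iio 0) g v b') :
    (inner ℂ u g + inner ℂ f v : ℂ) = inner ℂ a' b' - inner ℂ a b := by
  refine Complex.ext (re_inner_add_inner hf hf' hg hg') ?_
  -- The imaginary part is obtained from the real part after replacing `g` by `-i g`, as `Re (-i w)
  -- = Im w`.
  have := re_inner_add_inner hf hf' (hg.smul (-Complex.I)) (hg'.smul (-Complex.I))
  rwa [inner_smul_right, inner_smul_right, inner_smul_right, inner_smul_right, ← mul_add, ← mul_sub,
    neg_mul, neg_mul, Complex.neg_re, Complex.neg_re, Complex.I_mul_re, Complex.I_mul_re, neg_neg,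
    neg_neg] at this

/-- A continuously differentiable representative gives a primitive. -/
theorem isPrimitiveOn_of_hasDerivAt {w w' : ℝ → Spinor} (hΩ : Ω = Ioi 0 ∨ Ω = Iio 0)
    (hw : ∀ x, HasDerivAt w (w' x) x) (hc : Continuous w') (hf : ∀ᵐ x, x ∈ Ω → f x = w x)
    (hu : ∀ᵐ x, x ∈ Ω → u x = w' x) : IsPrimitiveOn Ω f u (w 0) := by
  have key : ∀ x ∈ Ω, ∀ᵐ t, t ∈ uIoc 0 x → t ∈ Ω := by
    intro x hx
    filter_upwards [(countable_singleton (0 : ℝ)).ae_notMem volume] with t ht0 ht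
    rcases hΩ with rfl | rfl
    · rw [uIoc_of_le (le_of_lt hx)] at ht
      exact ht.1
    · rw [uIoc_of_ge (le_of_lt hx)] at ht
      exact lt_of_le_of_ne ht.2 ht0
  filter_upwards [hf] with x hfx hx
  have h1 : ∫ t in (0 : ℝ)..x, u t = ∫ t in (0 : ℝ)..x, w' t := by
    refine intervalIntegral.integral_congr_ae ?_
    filter_upwards [hu, key x hx] with t h1 h2 h3 using h1 (h2 h3)
  rw [hfx hx, primitive, h1, intervalIntegral.integral_eq_sub_of_hasDerivAt (fun t _ => hw t)
    (hc.intervalIntegrable 0 x), add_sub_cancel]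

/-- Trace inequality: integrating `(|f|²)' = 2 Re (f, f')` over the half-line gives `± |f(0)|²`, and
Cauchy–Schwarz bounds the integral. It makes the boundary value continuous in the `H¹` norm. -/
theorem norm_sq_le_of_isPrimitiveOn (hΩ : Ω = Ioi 0 ∨ Ω = Iio 0) (hf : IsPrimitiveOn Ω f u a) :
    ‖a‖ ^ 2 ≤ 2 * ((eLpNorm f 2 (volume.restrict Ω)).toReal *
      (eLpNorm u 2 (volume.restrict Ω)).toReal) := by
  have hmf : MemLp f 2 (volume.restrict Ω) := (Lp.memLp f).restrict Ω
  have hmu : MemLp u 2 (volume.restrict Ω) := (Lp.memLp u).restrict Ω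
  set f' := hmf.toLp f
  set u' := hmu.toLp u
  have h1 : ∫ x in Ω, (inner ℂ (u x) (f x) + inner ℂ (f x) (u x)).re =
      (inner ℂ u' f' + inner ℂ f' u' : ℂ).re := by
    rw [L2.inner_def, L2.inner_def, ← integral_add (L2.integrable_inner u' f')
      (L2.integrable_inner f' u')]
    have h6 := integral_re (𝕜 := ℂ)
      ((L2.integrable_inner (𝕜 := ℂ) u' f').add (L2.integrable_inner (𝕜 := ℂ) f' u'))
    refine Eq.trans ?_ h6
    refine integral_congr_ae ?_
    filter_upwards [hmf.coeFn_toLp, hmu.coeFn_toLp] with x h1 h2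
    simp only [Pi.add_apply, f', u', h1, h2]
    rfl
  have h2 : |∫ x in Ω, (inner ℂ (u x) (f x) + inner ℂ (f x) (u x)).re| = (inner ℂ a a).re := by
    have h0 : (0 : ℝ) ≤ (inner ℂ a a).re := inner_self_nonneg (𝕜 := ℂ) (x := a)
    rcases hΩ with rfl | rfl
    · rw [integral_Ioi_re_inner hf hf, abs_neg, abs_of_nonneg h0]
    · rw [integral_Iio_re_inner hf hf, abs_of_nonneg h0]
  have h3 : (inner ℂ a a).re = ‖a‖ ^ 2 := inner_self_eq_norm_sq (𝕜 := ℂ) a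
  rw [← h3, ← h2, h1, ← Lp.norm_toLp f hmf, ← Lp.norm_toLp u hmu]
  refine (Complex.abs_re_le_norm _).trans ((norm_add_le _ _).trans ?_)
  have h4 := norm_inner_le_norm (𝕜 := ℂ) u' f'
  have h5 := norm_inner_le_norm (𝕜 := ℂ) f' u'
  change _ ≤ 2 * (‖f'‖ * ‖u'‖)
  linarith

theorem IsTestFunction.memLp {φ : ℝ → Spinor} (hφ : IsTestFunction Ω φ) :
    MemLp φ 2 (volume : Measure ℝ) :=
  hφ.1.continuous.memLp_of_hasCompactSupport hφ.2.1

theorem IsTestFunction.memLp_deriv {φ : ℝ → Spinor} (hφ : IsTestFunction Ω φ) :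
    MemLp (deriv φ) 2 (volume : Measure ℝ) :=
  (hφ.1.continuous_deriv (by simp)).memLp_of_hasCompactSupport hφ.2.1.deriv

theorem IsTestFunction.isPrimitiveOn {Ω Ω' : Set ℝ} {φ : ℝ → Spinor} (hφ : IsTestFunction Ω φ)
    (h0 : (0 : ℝ) ∉ Ω) (hΩ' : Ω' = Ioi 0 ∨ Ω' = Iio 0) :
    IsPrimitiveOn Ω' (hφ.memLp.toLp φ) (hφ.memLp_deriv.toLp (deriv φ)) 0 := by
  have h1 : φ 0 = 0 := image_eq_zero_of_notMem_tsupport fun h => h0 (hφ.2.2 h)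
  rw [← h1]
  refine isPrimitiveOn_of_hasDerivAt hΩ' (fun x => (hφ.1.differentiable (by simp) x).hasDerivAt)
    (hφ.1.continuous_deriv (by simp)) ?_ ?_
  · filter_upwards [hφ.memLp.coeFn_toLp] with x hx _ using hx
  · filter_upwards [hφ.memLp_deriv.coeFn_toLp] with x hx _ using hx

/-- The value at `0` of a function in `H₀¹` vanishes. -/
theorem IsPrimitiveOn.eq_zero_of_isLimit (hΩ : Ω = Ioi 0 ∨ Ω = Iio 0)
    (hf : IsPrimitiveOn Ω f u a) (hlim : IsLimitOfTestFunctions Ω f u) : a = 0 := by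
  have h0 : (0 : ℝ) ∉ Ω := by rcases hΩ with rfl | rfl <;> simp
  have key : ∀ ε : ℝ, 0 < ε → ‖a‖ ^ 2 ≤ 2 * (ε * ε) := by
    intro ε hε
    obtain ⟨φ, hφ, h1, h2⟩ := hlim (ENNReal.ofReal ε) (by simpa using hε)
    have h3 := norm_sq_le_of_isPrimitiveOn hΩ (hf.sub (hφ.isPrimitiveOn h0 hΩ))
    rw [sub_zero] at h3
    have bound : ∀ (g : L2) {θ : ℝ → Spinor} (hθ : MemLp θ 2 (volume : Measure ℝ)),
        eLpNorm (fun x => g x - θ x) 2 (volume.restrict Ω) < ENNReal.ofReal ε →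
        (eLpNorm (g - hθ.toLp θ : L2) 2 (volume.restrict Ω)).toReal ≤ ε := by
      intro g θ hθ h
      have e : ((g - hθ.toLp θ : L2) : ℝ → Spinor) =ᵐ[volume.restrict Ω] fun x => g x - θ x := by
        refine ae_restrict_of_ae ?_
        filter_upwards [Lp.coeFn_sub g (hθ.toLp θ), hθ.coeFn_toLp] with x h1 h2
        rw [h1, Pi.sub_apply, h2]
      rw [eLpNorm_congr_ae e]
      exact ENNReal.toReal_le_of_le_ofReal hε.le h.le
    refine h3.trans (mul_le_mul_of_nonneg_left ?_ zero_le_two)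
    exact mul_le_mul (bound f hφ.memLp h1) (bound u hφ.memLp_deriv h2) ENNReal.toReal_nonneg hε.le
  by_contra ha
  have hpos : 0 < ‖a‖ := norm_pos_iff.2 ha
  -- This choice gives `‖a‖² ≤ ‖a‖² / 2`.
  have := key (‖a‖ / 2) (by linarith)
  nlinarith

end

section

/-! ### Constant matrices -/

theorem mat_mul_apply (A B : Matrix (Fin 2) (Fin 2) ℂ) (x : Spinor) :
    mat (A * B) x = mat A (mat B x) := by
  simp only [map_mul, mul_apply_eq_comp]

theorem mat_one_apply (x : Spinor) : mat 1 x = x := by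
  simp only [map_one, one_apply_eq_self]

theorem mat_neg_apply (A : Matrix (Fin 2) (Fin 2) ℂ) (x : Spinor) : mat (-A) x = -mat A x := by
  simp only [map_neg, neg_apply]

theorem inner_mat_left (A : Matrix (Fin 2) (Fin 2) ℂ) (x y : Spinor) :
    inner ℂ (mat A x) y = inner ℂ x (mat Aᴴ y) := by
  have h : mat Aᴴ = ContinuousLinearMap.adjoint (mat A) := by
    exact map_star (Matrix.toEuclideanCLM (n := Fin 2) (𝕜 := ℂ)) A
  rw [h, ContinuousLinearMap.adjoint_inner_right]

theorem matL2_mul_apply (A B : Matrix (Fin 2) (Fin 2) ℂ) (f : L2) :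
    matL2 A (matL2 B f) = matL2 (A * B) f := by
  refine Lp.ext ?_
  filter_upwards [coeFn_matL2 A (matL2 B f), coeFn_matL2 B f, coeFn_matL2 (A * B) f] with x h1 h2 h3
  rw [h1, h2, h3, mat_mul_apply]

theorem matL2_one_apply (f : L2) : matL2 1 f = f := by
  refine Lp.ext ?_
  filter_upwards [coeFn_matL2 1 f] with x h1
  rw [h1, mat_one_apply]

theorem matL2_neg_apply (A : Matrix (Fin 2) (Fin 2) ℂ) (f : L2) : matL2 (-A) f = -matL2 A f := by
  refine Lp.ext ?_
  filter_upwards [coeFn_matL2 (-A) f, coeFn_matL2 A f, Lp.coeFn_neg (matL2 A f)] with x h1 h2 h3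
  rw [h1, h3, Pi.neg_apply, h2, mat_neg_apply]

theorem inner_matL2_left (A : Matrix (Fin 2) (Fin 2) ℂ) (f g : L2) :
    inner ℂ (matL2 A f) g = inner ℂ f (matL2 Aᴴ g) := by
  rw [L2.inner_def, L2.inner_def]
  refine integral_congr_ae ?_
  filter_upwards [coeFn_matL2 A f, coeFn_matL2 Aᴴ g] with x h1 h2
  rw [h1, h2, inner_mat_left]

theorem conjTranspose_neg_I_smul_σ₁ : (-Complex.I • σ₁)ᴴ = -(-Complex.I • σ₁) := by
  ext i j
  fin_cases i <;> fin_cases j <;> simp [σ₁]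

theorem neg_I_smul_σ₁_mul_self : (-Complex.I • σ₁) * (-Complex.I • σ₁) = -1 := by
  ext i j
  fin_cases i <;> fin_cases j <;> simp [σ₁, Matrix.mul_apply, Fin.sum_univ_two]

theorem conjTranspose_smul_σ₃ (m : ℝ) : ((m : ℂ) • σ₃)ᴴ = (m : ℂ) • σ₃ := by
  ext i j
  fin_cases i <;> fin_cases j <;> simp [σ₃]

theorem inner_mat_neg_I_smul_σ₁ (x y : Spinor) :
    inner ℂ (mat (-Complex.I • σ₁) x) y = -inner ℂ x (mat (-Complex.I • σ₁) y) := by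
  rw [inner_mat_left, conjTranspose_neg_I_smul_σ₁, mat_neg_apply, inner_neg_right]

theorem mat_neg_I_smul_σ₁_self (x : Spinor) :
    mat (-Complex.I • σ₁) (mat (-Complex.I • σ₁) x) = -x := by
  rw [← mat_mul_apply, neg_I_smul_σ₁_mul_self, mat_neg_apply, mat_one_apply]

theorem inner_matL2_neg_I_smul_σ₁ (f g : L2) :
    inner ℂ (matL2 (-Complex.I • σ₁) f) g = -inner ℂ f (matL2 (-Complex.I • σ₁) g) := by
  rw [inner_matL2_left, conjTranspose_neg_I_smul_σ₁, matL2_neg_apply, inner_neg_right]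

theorem matL2_neg_I_smul_σ₁_self (f : L2) :
    matL2 (-Complex.I • σ₁) (matL2 (-Complex.I • σ₁) f) = -f := by
  rw [matL2_mul_apply, neg_I_smul_σ₁_mul_self, matL2_neg_apply, matL2_one_apply]

theorem inner_matL2_smul_σ₃ (m : ℝ) (f g : L2) :
    inner ℂ (matL2 ((m : ℂ) • σ₃) f) g = inner ℂ f (matL2 ((m : ℂ) • σ₃) g) := by
  rw [inner_matL2_left, conjTranspose_smul_σ₃]

/-! ### The maximal operator and its traces -/

theorem mem_graph_derivMax {f u : L2} : (f, u) ∈ derivMax.graph ↔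
    ∃ a b, IsPrimitiveOn (Ioi 0) f u a ∧ IsPrimitiveOn (Iio 0) f u b := by
  rw [graph_derivMax]
  constructor
  · rintro ⟨h1, h2⟩
    obtain ⟨a, ha⟩ := hasWeakDerivOn_Ioi_iff.1 h1
    obtain ⟨b, hb⟩ := hasWeakDerivOn_Iio_iff.1 h2
    exact ⟨a, b, ha, hb⟩
  · rintro ⟨a, b, ha, hb⟩
    exact ⟨hasWeakDerivOn_Ioi_iff.2 ⟨a, ha⟩, hasWeakDerivOn_Iio_iff.2 ⟨b, hb⟩⟩

theorem traceRight_eq {f : derivMax.domain} {u : L2} {a : Spinor}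
    (h : IsPrimitiveOn (Ioi 0) f u a) : traceRight f = a :=
  IsTrace.unique isOpen_Ioi inferInstance (isTrace_traceRight f) (h.isTrace measurableSet_Ioi)

theorem traceLeft_eq {f : derivMax.domain} {u : L2} {a : Spinor}
    (h : IsPrimitiveOn (Iio 0) f u a) : traceLeft f = a :=
  IsTrace.unique isOpen_Iio inferInstance (isTrace_traceLeft f) (h.isTrace measurableSet_Iio)

theorem isPrimitiveOn_traceRight (f : derivMax.domain) :
    IsPrimitiveOn (Ioi 0) f (derivMax f) (traceRight f) := by
  obtain ⟨a, -, ha, -⟩ := mem_graph_derivMax.1 (derivMax.mem_graph f)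
  rwa [traceRight_eq ha]

theorem isPrimitiveOn_traceLeft (f : derivMax.domain) :
    IsPrimitiveOn (Iio 0) f (derivMax f) (traceLeft f) := by
  obtain ⟨-, a, -, ha⟩ := mem_graph_derivMax.1 (derivMax.mem_graph f)
  rwa [traceLeft_eq ha]

theorem exists_mem_derivMax {f u : L2} {a b : Spinor} (ha : IsPrimitiveOn (Ioi 0) f u a)
    (hb : IsPrimitiveOn (Iio 0) f u b) : ∃ h : f ∈ derivMax.domain,
      derivMax ⟨f, h⟩ = u ∧ traceRight ⟨f, h⟩ = a ∧ traceLeft ⟨f, h⟩ = b := by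
  obtain ⟨⟨f', h⟩, rfl, h2⟩ := (LinearPMap.mem_graph_iff _).1 (mem_graph_derivMax.2 ⟨a, b, ha, hb⟩)
  exact ⟨h, h2, traceRight_eq ha, traceLeft_eq hb⟩

variable (m : ℝ)

theorem diracOp_spec {D : L2 →ₗ.[ℂ] L2} (f : (diracOp m D).domain) :
    ∃ u, ((f : L2), u) ∈ D.graph ∧
      diracOp m D f = matL2 (-Complex.I • σ₁) u + matL2 ((m : ℂ) • σ₃) (f : L2) := by
  exact ⟨_, D.mem_graph (f : D.domain), rfl⟩

theorem mem_diracOp {D : L2 →ₗ.[ℂ] L2} {f u : L2} (hf : (f, u) ∈ D.graph) :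
    ∃ h : f ∈ (diracOp m D).domain, diracOp m D ⟨f, h⟩ =
      matL2 (-Complex.I • σ₁) u + matL2 ((m : ℂ) • σ₃) f := by
  obtain ⟨y, rfl, rfl⟩ := (LinearPMap.mem_graph_iff _).1 hf
  exact ⟨y.2, rfl⟩

/-- Since `(-i σ₁)² = -1`, the equation `w = -i σ₁ f' + m σ₃ f` can be solved for `f'`. Questions
about the graph of a Dirac operator thus become questions about weak derivatives. -/
theorem mem_graph_diracOp {D : L2 →ₗ.[ℂ] L2} {f w : L2} : (f, w) ∈ (diracOp m D).graph ↔
    (f, -matL2 (-Complex.I • σ₁) (w - matL2 ((m : ℂ) • σ₃) f)) ∈ D.graph := by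
  constructor
  · intro h
    obtain ⟨y, rfl, rfl⟩ := (LinearPMap.mem_graph_iff _).1 h
    obtain ⟨u, hu, h2⟩ := diracOp_spec m y
    rwa [h2, add_sub_cancel_right, matL2_neg_I_smul_σ₁_self, neg_neg]
  · intro h
    obtain ⟨h1, h2⟩ := mem_diracOp m h
    refine (LinearPMap.mem_graph_iff _).2 ⟨⟨f, h1⟩, rfl, ?_⟩
    rw [h2, map_neg, matL2_neg_I_smul_σ₁_self, neg_neg, sub_add_cancel]

theorem diracMax_spec (f : (diracMax m).domain) :
    ∃ u a b, IsPrimitiveOn (Ioi 0) f u a ∧ IsPrimitiveOn (Iio 0) f u b ∧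
      diracMax m f = matL2 (-Complex.I • σ₁) u + matL2 ((m : ℂ) • σ₃) (f : L2) ∧
      Gamma₀ m f = mat (-Complex.I • σ₁) (a - b) ∧ Gamma₁ m f = (1 / 2 : ℂ) • (a + b) :=
  ⟨_, _, _, isPrimitiveOn_traceRight f, isPrimitiveOn_traceLeft f, rfl, rfl, rfl⟩

theorem mem_diracMax {f u : L2} {a b : Spinor} (ha : IsPrimitiveOn (Ioi 0) f u a)
    (hb : IsPrimitiveOn (Iio 0) f u b) : ∃ h : f ∈ (diracMax m).domain,
      diracMax m ⟨f, h⟩ = matL2 (-Complex.I • σ₁) u + matL2 ((m : ℂ) • σ₃) f ∧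
      Gamma₀ m ⟨f, h⟩ = mat (-Complex.I • σ₁) (a - b) ∧
      Gamma₁ m ⟨f, h⟩ = (1 / 2 : ℂ) • (a + b) := by
  obtain ⟨h, rfl, rfl, rfl⟩ := exists_mem_derivMax ha hb
  exact ⟨h, rfl, rfl, rfl⟩

/-- The Hermitian term `m σ₃` cancels. As `J = -i σ₁` is skew-Hermitian, integration by parts leaves
`(f(0+), J g(0+)) - (f(0-), J g(0-))`, which is rewritten through the jump and the mean of the
boundary values. -/
theorem green_diracMax (f g : (diracMax m).domain) :
    inner ℂ (diracMax m f) (g : L2) - inner ℂ (f : L2) (diracMax m g) =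
      inner ℂ (Gamma₁ m f) (Gamma₀ m g) - inner ℂ (Gamma₀ m f) (Gamma₁ m g) := by
  obtain ⟨u, a, b, ha, hb, hf, hf0, hf1⟩ := diracMax_spec m f
  obtain ⟨v, c, d, hc, hd, hg, hg0, hg1⟩ := diracMax_spec m g
  rw [hf, hf0, hf1, hg, hg0, hg1, inner_add_left, inner_add_right, inner_matL2_smul_σ₃,
    inner_matL2_neg_I_smul_σ₁, inner_mat_neg_I_smul_σ₁]
  have h := inner_add_inner ha hb (hc.mat (-Complex.I • σ₁)) (hd.mat (-Complex.I • σ₁))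
  generalize mat (-Complex.I • σ₁) = J at h ⊢
  simp only [inner_smul_left, inner_smul_right, inner_add_left, inner_add_right, inner_sub_left,
    inner_sub_right, map_sub, map_add, map_smul, one_div, map_inv₀, Complex.conj_ofNat]
  linear_combination -h

theorem derivMin_le_derivMax : derivMin ≤ derivMax := by
  refine LinearPMap.le_of_le_graph fun p hp => ?_
  rw [graph_derivMin] at hp
  rw [graph_derivMax]
  exact ⟨hp.1.1, hp.2.1⟩

theorem diracOp_mono {D D' : L2 →ₗ.[ℂ] L2} (h : D ≤ D') : diracOp m D ≤ diracOp m D' := by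
  refine ⟨h.1, fun x y hxy => ?_⟩
  have h1 : D x = D' y := h.2 hxy
  change matL2 (-Complex.I • σ₁) (D x) + matL2 ((m : ℂ) • σ₃) (x : L2) =
    matL2 (-Complex.I • σ₁) (D' y) + matL2 ((m : ℂ) • σ₃) (y : L2)
  rw [h1, hxy]

theorem diracMin_le_diracMax : diracMin m ≤ diracMax m := diracOp_mono m derivMin_le_derivMax

theorem Gamma_eq_zero_of_mem_diracMin {f : (diracMax m).domain}
    (hf : (f : L2) ∈ (diracMin m).domain) : Gamma₀ m f = 0 ∧ Gamma₁ m f = 0 := by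
  obtain ⟨u, hu, -⟩ := diracOp_spec m (D := derivMin) ⟨f, hf⟩
  rw [graph_derivMin] at hu
  obtain ⟨a, ha⟩ := hasWeakDerivOn_Ioi_iff.1 hu.1.1
  obtain ⟨b, hb⟩ := hasWeakDerivOn_Iio_iff.1 hu.2.1
  obtain ⟨_, _, h0, h1⟩ := mem_diracMax m ha hb
  rw [ha.eq_zero_of_isLimit (.inl rfl) hu.1.2, hb.eq_zero_of_isLimit (.inr rfl) hu.2.2] at h0 h1
  exact ⟨h0.trans (by rw [sub_zero, map_zero]), h1.trans (by rw [add_zero, smul_zero])⟩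

/-! ### Test functions in the domain of the minimal operator -/

theorem IsTestFunction.smul_const {Ω : Set ℝ} {φ : ℝ → ℝ} (hφ : IsTestFunction Ω φ) (e : Spinor) :
    IsTestFunction Ω fun x => φ x • e :=
  ⟨hφ.1.smul contDiff_const, hφ.2.1.smul_right,
    (closure_mono (Function.support_smul_subset_left φ _)).trans hφ.2.2⟩

/-- On the half-line carrying its support `φ` is its own approximant in `H₀¹`; on the other
half-line it vanishes and the approximant is `0`. -/
theorem mem_graph_derivMin_of_isTestFunction {Ω : Set ℝ} {φ : ℝ → Spinor}
    (hφ : IsTestFunction Ω φ) (hΩ : Ω = Ioi 0 ∨ Ω = Iio 0) :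
    (hφ.memLp.toLp φ, hφ.memLp_deriv.toLp (deriv φ)) ∈ derivMin.graph := by
  have h0 : (0 : ℝ) ∉ Ω := by rcases hΩ with rfl | rfl <;> simp
  rw [graph_derivMin]
  have key : ∀ Ω', (Ω' = Ioi 0 ∨ Ω' = Iio 0) →
      (hφ.memLp.toLp φ, hφ.memLp_deriv.toLp (deriv φ)) ∈ weakDerivGraph₀ Ω' := by
    intro Ω' hΩ'
    have hm : MeasurableSet Ω' := by
      rcases hΩ' with rfl | rfl
      · exact measurableSet_Ioi
      · exact measurableSet_Iio
    refine ⟨(hφ.isPrimitiveOn h0 hΩ').hasWeakDerivOn hm, fun ε hε => ?_⟩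
    have e1 := ae_restrict_of_ae (s := Ω') hφ.memLp.coeFn_toLp
    have e2 := ae_restrict_of_ae (s := Ω') hφ.memLp_deriv.coeFn_toLp
    by_cases hΩΩ : Ω' = Ω
    · refine ⟨φ, hΩΩ ▸ hφ, ?_, ?_⟩
      · rw [eLpNorm_congr_ae (g := fun _ => (0 : Spinor))]
        · simpa using hε
        · filter_upwards [e1] with x hx
          rw [hx, sub_self]
      · rw [eLpNorm_congr_ae (g := fun _ => (0 : Spinor))]
        · simpa using hε
        · filter_upwards [e2] with x hx
          rw [hx, sub_self]
    · have hdisj : ∀ x ∈ Ω', x ∉ Ω := by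
        rcases hΩ with rfl | rfl <;> rcases hΩ' with rfl | rfl
        · exact absurd rfl hΩΩ
        · exact fun x hx hx' => lt_asymm (mem_Iio.1 hx) (mem_Ioi.1 hx')
        · exact fun x hx hx' => lt_asymm (mem_Iio.1 hx') (mem_Ioi.1 hx)
        · exact absurd rfl hΩΩ
      have z1 : ∀ x ∈ Ω', φ x = 0 := fun x hx =>
        image_eq_zero_of_notMem_tsupport fun h => hdisj x hx (hφ.2.2 h)
      have z2 : ∀ x ∈ Ω', deriv φ x = 0 := fun x hx =>
        Function.notMem_support.1 fun h => hdisj x hx (hφ.2.2 (support_deriv_subset h))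
      refine ⟨0, ⟨contDiff_const, HasCompactSupport.zero, by simp⟩, ?_, ?_⟩
      · rw [eLpNorm_congr_ae (g := fun _ => (0 : Spinor))]
        · simpa using hε
        · filter_upwards [e1, ae_restrict_mem hm] with x hx hx'
          rw [hx, z1 x hx', Pi.zero_apply, sub_zero]
      · rw [eLpNorm_congr_ae (g := fun _ => (0 : Spinor))]
        · simpa using hε
        · filter_upwards [e2, ae_restrict_mem hm] with x hx hx'
          rw [hx, z2 x hx', Pi.zero_def, deriv_const, sub_zero]
  exact ⟨key _ (.inl rfl), key _ (.inr rfl)⟩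

/-! ### Density, adjoint and closedness of `S`. -/

theorem inner_toLp_smul_const {φ : ℝ → ℝ} (hc : Continuous φ) (hs : HasCompactSupport φ)
    (e : Spinor) (h : MemLp (fun x => φ x • e) 2 (volume : Measure ℝ)) (v : L2) :
    inner ℂ (h.toLp _) v = inner ℂ e (∫ x, φ x • v x) := by
  rw [L2.inner_def, ← integral_inner
    ((locallyIntegrable_coe v).integrable_smul_left_of_hasCompactSupport hc hs)]
  refine integral_congr_ae ?_
  filter_upwards [h.coeFn_toLp] with x hx
  rw [hx, ← Complex.coe_smul, ← Complex.coe_smul, inner_smul_left, inner_smul_right,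
    Complex.conj_ofReal]

/-- A function orthogonal to all `φ e`, with `φ` a scalar test function on either half-line and `e`
in `ℂ²`, vanishes almost everywhere on both. -/
theorem dense_diracMin_domain : Dense ((diracMin m).domain : Set L2) := by
  rw [Submodule.dense_iff_topologicalClosure_eq_top, Submodule.topologicalClosure_eq_top_iff,
    Submodule.eq_bot_iff]
  intro v hv
  have key : ∀ Ω : Set ℝ, IsOpen Ω → (Ω = Ioi 0 ∨ Ω = Iio 0) → ∀ᵐ x, x ∈ Ω → v x = 0 := by
    intro Ω ho hΩ
    refine ho.ae_eq_zero_of_integral_contDiff_smul_eq_zero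
      ((locallyIntegrable_coe v).locallyIntegrableOn Ω) fun φ h1 h2 h3 => ?_
    have hφ : IsTestFunction Ω φ := ⟨h1, h2, h3⟩
    refine ext_inner_left ℂ fun e => ?_
    obtain ⟨y, hy, -⟩ := (LinearPMap.mem_graph_iff _).1
      (mem_graph_derivMin_of_isTestFunction (hφ.smul_const e) hΩ)
    rw [← inner_toLp_smul_const h1.continuous h2 e (hφ.smul_const e).memLp, inner_zero_right]
    simp only at hy
    rw [← hy]
    exact (Submodule.mem_orthogonal _ _).1 hv y y.2
  refine Lp.ext ?_
  filter_upwards [key _ isOpen_Ioi (.inl rfl), key _ isOpen_Iio (.inr rfl),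
    (countable_singleton (0 : ℝ)).ae_notMem volume,
    Lp.coeFn_zero Spinor 2 (volume : Measure ℝ)] with x h1 h2 h3 h4
  rw [h4]
  rcases lt_trichotomy x 0 with h | h | h
  · exact h2 h
  · exact absurd h h3
  · exact h1 h

theorem matL2_toLp_smul_const {φ : ℝ → ℝ} (B : Matrix (Fin 2) (Fin 2) ℂ) (e : Spinor)
    (h : MemLp (fun x => φ x • e) 2 (volume : Measure ℝ))
    (h' : MemLp (fun x => φ x • mat B e) 2 (volume : Measure ℝ)) :
    matL2 B (h.toLp _) = h'.toLp _ := by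
  refine Lp.ext ?_
  filter_upwards [coeFn_matL2 B (h.toLp _), h.coeFn_toLp, h'.coeFn_toLp] with x h1 h2 h3
  rw [h1, h2, h3, ← Complex.coe_smul, map_smul, Complex.coe_smul]

/-- `S* = T`. -/
theorem adjoint_diracMin : (diracMin m)† = diracMax m := by
  have hd := dense_diracMin_domain m
  refine le_antisymm ?_ (LinearPMap.IsFormalAdjoint.le_adjoint hd ?_)
  · refine LinearPMap.le_of_le_graph fun p hp => ?_
    obtain ⟨u', hu, hw⟩ := (LinearPMap.mem_graph_iff _).1 hp
    obtain ⟨u, w⟩ := p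
    simp only at hu hw
    -- The only candidate for the derivative of `u`, obtained by solving `w = -i σ₁ q + m σ₃ u`.
    set q := -matL2 (-Complex.I • σ₁) (w - matL2 ((m : ℂ) • σ₃) u) with hq
    have key : ∀ Ω : Set ℝ, (Ω = Ioi 0 ∨ Ω = Iio 0) → HasWeakDerivOn Ω u q := by
      intro Ω hΩ φ hφ
      have hd' : tsupport (deriv φ) ⊆ Ω :=
        (closure_minimal support_deriv_subset (isClosed_tsupport φ)).trans hφ.2.2
      rw [setIntegral_eq_integral_of_test hd', setIntegral_eq_integral_of_test hφ.2.2]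
      refine ext_inner_left ℂ fun e => ?_
      have hder : ∀ e : Spinor, deriv (fun x => φ x • e) = fun x => deriv φ x • e := fun e =>
        funext fun x => ((hφ.1.differentiable (by simp) x).hasDerivAt.smul_const e).deriv
      have hm : ∀ e : Spinor, MemLp (fun x => deriv φ x • e) 2 (volume : Measure ℝ) := fun e =>
        hder e ▸ (hφ.smul_const e).memLp_deriv
      -- Testing with `φ J e`, where `J = -i σ₁`, makes the leading term `φ' J² e = -φ' e`, so the
      -- adjoint relation directly becomes the weak derivative identity paired with `e`.
      obtain ⟨hy, hy2⟩ := mem_diracOp m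
        (mem_graph_derivMin_of_isTestFunction (hφ.smul_const (mat (-Complex.I • σ₁) e)) hΩ)
      simp only [hder] at hy2
      have h1 := (LinearPMap.adjoint_isFormalAdjoint hd).symm ⟨_, hy⟩ u'
      rw [hw, hu] at h1
      replace h1 := (congrArg (fun t => inner ℂ t u) hy2).symm.trans h1
      simp only at h1
      rw [inner_add_left, inner_matL2_smul_σ₃, matL2_toLp_smul_const _ _ _ (hm _)] at h1
      simp only [mat_neg_I_smul_σ₁_self] at h1
      rw [← eq_sub_iff_add_eq, ← inner_sub_right,
        inner_toLp_smul_const hφ.continuous_deriv hφ.2.1.deriv, inner_neg_left,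
        ← matL2_toLp_smul_const _ e (hφ.smul_const e).memLp, inner_matL2_neg_I_smul_σ₁] at h1
      rw [inner_neg_right, ← inner_toLp_smul_const hφ.1.continuous hφ.2.1 e
        (hφ.smul_const e).memLp, hq, inner_neg_right, ← h1, neg_neg]
    refine (mem_graph_diracOp m).2 ?_
    rw [graph_derivMax]
    exact ⟨key _ (.inl rfl), key _ (.inr rfl)⟩
  -- `S` and `T` are formally adjoint: elements of `dom S` have zero boundary values, so Green's
  -- identity has zero right side.
  · intro x y
    have hx : (x : L2) ∈ (diracMax m).domain := (diracMin_le_diracMax m).1 x.2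
    have h1 := green_diracMax m ⟨x, hx⟩ y
    obtain ⟨h2, h3⟩ := Gamma_eq_zero_of_mem_diracMin m (f := ⟨x, hx⟩) x.2
    rw [h2, h3, inner_zero_left, inner_zero_left, sub_zero, sub_eq_zero] at h1
    rw [(diracMin_le_diracMax m).2 (x := x) (y := ⟨x, hx⟩) rfl]
    exact h1

theorem isLimitOfTestFunctions_of_mem_closure {Ω : Set ℝ} {q : L2 × L2}
    (hq : q ∈ closure {p : L2 × L2 | IsLimitOfTestFunctions Ω p.1 p.2}) :
    IsLimitOfTestFunctions Ω q.1 q.2 := by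
  intro ε hε
  obtain ⟨p, hp, hqp⟩ := EMetric.mem_closure_iff.1 hq (ε / 2) (ENNReal.half_pos hε.ne')
  obtain ⟨φ, hφ, h1, h2⟩ := hp (ε / 2) (ENNReal.half_pos hε.ne')
  rw [Prod.edist_eq, max_lt_iff, Lp.edist_def, Lp.edist_def] at hqp
  have key : ∀ (f g : L2) (a : ℝ → Spinor), Continuous a →
      eLpNorm ((f : ℝ → Spinor) - (g : ℝ → Spinor)) 2 volume < ε / 2 →
      eLpNorm (fun x => g x - a x) 2 (volume.restrict Ω) < ε / 2 →
      eLpNorm (fun x => f x - a x) 2 (volume.restrict Ω) < ε := by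
    intro f g a ha h h'
    have e : (fun x => f x - a x) = ((f : ℝ → Spinor) - (g : ℝ → Spinor)) + fun x => g x - a x := by
      ext1 x
      simp
    rw [e]
    calc _ ≤ _ := eLpNorm_add_le ((Lp.aestronglyMeasurable f).sub
            (Lp.aestronglyMeasurable g)).restrict ((Lp.aestronglyMeasurable g).restrict.sub
            ha.aestronglyMeasurable) (by norm_num)
      _ < ε / 2 + ε / 2 := ENNReal.add_lt_add
          ((eLpNorm_mono_measure _ Measure.restrict_le_self).trans_lt h) h'
      _ = ε := ENNReal.add_halves ε
  exact ⟨φ, hφ, key _ _ _ hφ.1.continuous hqp.1 h1,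
    key _ _ _ (hφ.1.continuous_deriv (by simp)) hqp.2 h2⟩

/-- A limit of points of the graph of `S` lies in the graph of `T`, which is closed as an adjoint;
this supplies the weak derivative. The `H₀¹` condition survives because `Φ` maps `(f, S f)`
continuously to `(f, f')`. -/
theorem isClosed_diracMin : (diracMin m).IsClosed := by
  have hT : (diracMax m).IsClosed := adjoint_diracMin m ▸
    LinearPMap.adjoint_isClosed (dense_diracMin_domain m)
  refine isClosed_of_closure_subset fun p hp => ?_
  have hpT : p ∈ (diracMax m).graph :=
    closure_minimal (LinearPMap.le_graph_of_le (diracMin_le_diracMax m)) hT hp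
  let Φ : L2 × L2 → L2 × L2 := fun p =>
    (p.1, -matL2 (-Complex.I • σ₁) (p.2 - matL2 ((m : ℂ) • σ₃) p.1))
  have hΦ : Continuous Φ := by fun_prop
  have hlim : ∀ Ω, (Ω = Ioi 0 ∨ Ω = Iio 0) →
      IsLimitOfTestFunctions Ω (Φ p).1 (Φ p).2 := by
    intro Ω hΩ
    refine isLimitOfTestFunctions_of_mem_closure (map_mem_closure hΦ hp fun r hr => ?_)
    have h3 := (mem_graph_diracOp m).1 hr
    rw [graph_derivMin] at h3
    rcases hΩ with rfl | rfl
    · exact h3.1.2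
    · exact h3.2.2
  have h := (mem_graph_diracOp m).1 hpT
  rw [graph_derivMax] at h
  refine (mem_graph_diracOp m).2 ?_
  rw [graph_derivMin]
  exact ⟨⟨h.1, hlim _ (.inl rfl)⟩, ⟨h.2, hlim _ (.inr rfl)⟩⟩

/-! ### The free operator -/

theorem mat_neg_I_smul_σ₁_eq_zero {x : Spinor} : mat (-Complex.I • σ₁) x = 0 ↔ x = 0 := by
  refine ⟨fun h => ?_, fun h => by rw [h, map_zero]⟩
  rw [← neg_eq_zero, ← mat_neg_I_smul_σ₁_self, h, map_zero]

theorem diracFree_spec (f : (diracFree m).domain) :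
    ∃ u a, IsPrimitiveOn (Ioi 0) f u a ∧ IsPrimitiveOn (Iio 0) f u a ∧
      diracFree m f = matL2 (-Complex.I • σ₁) u + matL2 ((m : ℂ) • σ₃) (f : L2) := by
  obtain ⟨u, hu, h⟩ := diracOp_spec m f
  rw [graph_derivFree] at hu
  obtain ⟨a, ha, hb⟩ := hasWeakDerivOn_univ_iff.1 hu
  exact ⟨u, a, ha, hb, h⟩

theorem mem_diracFree {f u : L2} {a : Spinor} (ha : IsPrimitiveOn (Ioi 0) f u a)
    (hb : IsPrimitiveOn (Iio 0) f u a) : f ∈ (diracFree m).domain := by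
  have : (f, u) ∈ derivFree.graph := by
    rw [graph_derivFree]
    exact hasWeakDerivOn_univ_iff.2 ⟨a, ha, hb⟩
  exact (mem_diracOp m this).1

theorem derivFree_le_derivMax : derivFree ≤ derivMax := by
  refine LinearPMap.le_of_le_graph fun p hp => ?_
  rw [graph_derivFree] at hp
  obtain ⟨a, h1, h2⟩ := hasWeakDerivOn_univ_iff.1 hp
  exact mem_graph_derivMax.2 ⟨a, a, h1, h2⟩

theorem restrictKer_Gamma₀ : restrictKer (diracMax m) (Gamma₀ m) = diracFree m := by
  have hle : diracFree m ≤ diracMax m := diracOp_mono m derivFree_le_derivMax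
  refine LinearPMap.ext (Submodule.ext fun x => ?_) fun x hx hy => ?_
  · rw [mem_restrictKer_domain]
    constructor
    · rintro ⟨h, h0⟩
      obtain ⟨u, a, b, ha, hb, -, h1, -⟩ := diracMax_spec m ⟨x, h⟩
      rw [h0, eq_comm, mat_neg_I_smul_σ₁_eq_zero, sub_eq_zero] at h1
      subst h1
      exact mem_diracFree m ha hb
    · intro h
      obtain ⟨u, a, ha, hb, -⟩ := diracFree_spec m ⟨x, h⟩
      obtain ⟨h1, -, h2, -⟩ := mem_diracMax m ha hb
      exact ⟨h1, h2.trans (by rw [sub_self, map_zero])⟩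
  · obtain ⟨h1, -⟩ := mem_restrictKer_domain.1 hx
    rw [restrictKer_apply ⟨x, hx⟩ h1]
    exact (hle.2 (x := ⟨x, hy⟩) (y := ⟨x, h1⟩) rfl).symm

end

section

variable (m : ℝ)

/-! ### The spectral gap of the free operator. -/

theorem matL2_smul_apply (c : ℂ) (A : Matrix (Fin 2) (Fin 2) ℂ) (f : L2) :
    matL2 (c • A) f = c • matL2 A f := by
  refine Lp.ext ?_
  filter_upwards [coeFn_matL2 (c • A) f, coeFn_matL2 A f, Lp.coeFn_smul c (matL2 A f)] with x h1 h2 h3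
  rw [h1, h3, Pi.smul_apply, h2]
  simp only [map_smul, smul_apply]

/-- In fact `‖A₀ f‖² = ‖σ₁ f'‖² + m² ‖f‖²`: the cross term vanishes because `σ₁` and `σ₃`
anticommute and `f` has no jump at `0`. -/
theorem mul_norm_le_norm_diracFree (f : (diracFree m).domain) :
    |m| * ‖(f : L2)‖ ≤ ‖diracFree m f‖ := by
  obtain ⟨u, a, ha, hb, hf⟩ := diracFree_spec m f
  -- Anticommutation makes `W` Hermitian, so `(f', W f) + (f, W f') = 0` says that the real part of
  -- the cross term is zero.
  set W : Matrix (Fin 2) (Fin 2) ℂ := (-Complex.I • σ₁) * ((m : ℂ) • σ₃) with hW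
  have hWH : Wᴴ = W := by
    ext i j
    fin_cases i <;> fin_cases j <;> simp [W, σ₁, σ₃]
  have hV : ((m : ℂ) • σ₃) * ((m : ℂ) • σ₃) = ((m ^ 2 : ℝ) : ℂ) • (1 : Matrix (Fin 2) (Fin 2) ℂ) := by
    ext i j
    fin_cases i <;> fin_cases j <;> simp [σ₃, Matrix.mul_apply, Fin.sum_univ_two, sq]
  have h1 := inner_add_inner ha hb (ha.mat W) (hb.mat W)
  rw [sub_self] at h1
  have h2 : (inner ℂ u (matL2 W f) : ℂ).re = 0 := by
    have h3 : (inner ℂ (f : L2) (matL2 W u) : ℂ).re = (inner ℂ u (matL2 W f) : ℂ).re := by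
      rw [← inner_conj_symm, Complex.conj_re, inner_matL2_left, hWH]
    have h4 := congrArg Complex.re h1
    rw [Complex.add_re, h3, Complex.zero_re] at h4
    linarith
  have h3 : (inner ℂ (matL2 (-Complex.I • σ₁) u) (matL2 ((m : ℂ) • σ₃) f) : ℂ).re = 0 := by
    rw [inner_matL2_neg_I_smul_σ₁, matL2_mul_apply, Complex.neg_re, h2, neg_zero]
  have h4 : ‖matL2 ((m : ℂ) • σ₃) (f : L2)‖ ^ 2 = m ^ 2 * ‖(f : L2)‖ ^ 2 := by
    have e1 : (inner ℂ (matL2 ((m : ℂ) • σ₃) (f : L2)) (matL2 ((m : ℂ) • σ₃) (f : L2)) : ℂ).re =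
        ‖matL2 ((m : ℂ) • σ₃) (f : L2)‖ ^ 2 := inner_self_eq_norm_sq (𝕜 := ℂ) _
    have e2 : (inner ℂ (f : L2) (f : L2) : ℂ).re = ‖(f : L2)‖ ^ 2 := inner_self_eq_norm_sq (𝕜 := ℂ) _
    rw [← e1, ← e2, inner_matL2_smul_σ₃, matL2_mul_apply, hV, matL2_smul_apply, matL2_one_apply,
      inner_smul_right, Complex.re_ofReal_mul]
  have h5 := norm_add_sq (𝕜 := ℂ) (matL2 (-Complex.I • σ₁) u) (matL2 ((m : ℂ) • σ₃) (f : L2))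
  rw [← hf, h4] at h5
  change _ = _ + 2 * (inner ℂ (matL2 (-Complex.I • σ₁) u) (matL2 ((m : ℂ) • σ₃) f) : ℂ).re + _ at h5
  rw [h3] at h5
  refine abs_le_of_sq_le_sq' ?_ (norm_nonneg _) |>.2
  rw [mul_pow, sq_abs, h5]
  nlinarith [sq_nonneg ‖matL2 (-Complex.I • σ₁) u‖]

/-! ### Exponentials on the two half-lines -/

/-- The function `e^{c|x|} v` for `x > 0` and `e^{c|x|} w` for `x < 0`. -/
def expFun (c : ℂ) (v w : Spinor) (x : ℝ) : Spinor :=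
  Complex.exp (c * (|x| : ℝ)) • if 0 < x then v else w

theorem measurable_expFun (c : ℂ) (v w : Spinor) : Measurable (expFun c v w) := by
  refine Measurable.smul (f := fun x : ℝ => Complex.exp (c * (|x| : ℝ)))
    (Continuous.measurable (by fun_prop)) ?_
  exact Measurable.ite measurableSet_Ioi measurable_const measurable_const

theorem norm_expFun (c : ℂ) (v w : Spinor) (x : ℝ) :
    ‖expFun c v w x‖ ^ 2 = Real.exp (2 * c.re * |x|) * ‖if 0 < x then v else w‖ ^ 2 := by
  rw [expFun, norm_smul, mul_pow, Complex.norm_exp, ← Real.exp_nat_mul, Complex.re_mul_ofReal]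
  congr 2
  push_cast
  ring

theorem memLp_expFun {c : ℂ} (hc : c.re < 0) (v w : Spinor) :
    MemLp (expFun c v w) 2 (volume : Measure ℝ) := by
  rw [memLp_two_iff_integrable_sq_norm (measurable_expFun c v w).aestronglyMeasurable]
  have h1 : ∀ v : Spinor, IntegrableOn (fun x : ℝ => Real.exp (2 * c.re * x) * ‖v‖ ^ 2) (Ioi 0) :=
    fun v => (integrableOn_exp_mul_Ioi (by linarith) 0).mul_const _
  have h2 : IntegrableOn (fun x => ‖expFun c v w x‖ ^ 2) (Ioi 0) := by
    refine (h1 v).congr_fun (fun x hx => ?_) measurableSet_Ioi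
    simp only
    rw [norm_expFun, if_pos (mem_Ioi.1 hx), abs_of_pos (mem_Ioi.1 hx)]
  have h3 : IntegrableOn (fun x => ‖expFun c v w x‖ ^ 2) (Iic 0) := by
    have h4 : IntegrableOn (fun x : ℝ => Real.exp (-(2 * c.re) * x) * ‖w‖ ^ 2) (Iic 0) :=
      (integrableOn_exp_mul_Iic (by linarith) 0).mul_const _
    refine h4.congr_fun (fun x hx => ?_) measurableSet_Iic
    simp only
    rw [norm_expFun, if_neg (not_lt.2 (mem_Iic.1 hx)), abs_of_nonpos (mem_Iic.1 hx), mul_neg, neg_mul]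
  rw [← integrableOn_univ, ← Iic_union_Ioi (a := (0 : ℝ))]
  exact h3.union h2

/-- `expFun` as an element of `L²`. -/
def expL2 {c : ℂ} (hc : c.re < 0) (v w : Spinor) : L2 := (memLp_expFun hc v w).toLp _

variable {c : ℂ} (hc : c.re < 0) (v w : Spinor)

theorem coeFn_expL2 : (expL2 hc v w : ℝ → Spinor) =ᵐ[volume] expFun c v w :=
  (memLp_expFun hc v w).coeFn_toLp

theorem expL2_add (v' w' : Spinor) :
    expL2 hc (v + v') (w + w') = expL2 hc v w + expL2 hc v' w' := by
  rw [expL2, expL2, expL2, ← MemLp.toLp_add]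
  congr 1
  ext1 x
  simp only [expFun, Pi.add_apply]
  split_ifs <;> rw [smul_add]

theorem expL2_smul (a : ℂ) : expL2 hc (a • v) (a • w) = a • expL2 hc v w := by
  rw [expL2, expL2, ← MemLp.toLp_const_smul]
  congr 1
  ext1 x
  simp only [expFun, Pi.smul_apply]
  split_ifs <;> rw [smul_comm]

theorem matL2_expL2 (B : Matrix (Fin 2) (Fin 2) ℂ) :
    matL2 B (expL2 hc v w) = expL2 hc (mat B v) (mat B w) := by
  refine Lp.ext ?_
  filter_upwards [coeFn_matL2 B (expL2 hc v w), coeFn_expL2 hc v w,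
    coeFn_expL2 hc (mat B v) (mat B w)] with x h1 h2 h3
  rw [h1, h2, h3, expFun, expFun, map_smul]
  split_ifs <;> rfl

/-- The exact norm is needed to compare two decay rates in the construction of approximate
eigenvectors. -/
theorem norm_expL2_right : ‖expL2 hc v 0‖ ^ 2 = ‖v‖ ^ 2 / (-(2 * c.re)) := by
  have e1 : (inner ℂ (expL2 hc v 0) (expL2 hc v 0) : ℂ).re = ‖expL2 hc v 0‖ ^ 2 :=
    inner_self_eq_norm_sq (𝕜 := ℂ) _
  have e2 : ∫ x, (inner ℂ (expL2 hc v 0 x) (expL2 hc v 0 x) : ℂ).re =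
      (inner ℂ (expL2 hc v 0) (expL2 hc v 0) : ℂ).re := by
    rw [L2.inner_def]
    exact integral_re (L2.integrable_inner (𝕜 := ℂ) (expL2 hc v 0) (expL2 hc v 0))
  have e3 : ∫ x, (inner ℂ (expL2 hc v 0 x) (expL2 hc v 0 x) : ℂ).re =
      ∫ x in Ioi (0 : ℝ), Real.exp (2 * c.re * x) * ‖v‖ ^ 2 := by
    rw [← integral_indicator measurableSet_Ioi]
    refine integral_congr_ae ?_
    filter_upwards [coeFn_expL2 hc v 0] with x hx
    have e4 : (inner ℂ (expFun c v 0 x) (expFun c v 0 x) : ℂ).re = ‖expFun c v 0 x‖ ^ 2 :=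
      inner_self_eq_norm_sq (𝕜 := ℂ) (expFun c v 0 x)
    rw [hx, e4, norm_expFun]
    by_cases h : 0 < x
    · rw [if_pos h, indicator_of_mem (mem_Ioi.2 h), abs_of_pos h]
    · rw [if_neg h, indicator_of_notMem (by simpa using h)]
      simp
  rw [← e1, ← e2, e3, integral_mul_const, integral_exp_mul_Ioi (by linarith), mul_zero, Real.exp_zero]
  rw [div_neg, neg_div]
  ring

theorem isPrimitiveOn_expL2_Ioi :
    IsPrimitiveOn (Ioi 0) (expL2 hc v w) (expL2 hc (c • v) (-(c • w))) v := by
  have h := isPrimitiveOn_of_hasDerivAt (Ω := Ioi 0) (f := expL2 hc v w)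
    (u := expL2 hc (c • v) (-(c • w)))
    (w := fun x : ℝ => Complex.exp (c * x) • v) (w' := fun x : ℝ => (Complex.exp (c * x) * c) • v)
    (.inl rfl) (fun x => ?_) (by fun_prop) ?_ ?_
  · simpa using h
  · have h1 : HasDerivAt (fun x : ℝ => c * (x : ℂ)) c x := by
      simpa using (Complex.ofRealCLM.hasDerivAt (x := x)).const_mul c
    exact h1.cexp.smul_const v
  · filter_upwards [coeFn_expL2 hc v w] with x hx hx0
    rw [hx, expFun, if_pos (mem_Ioi.1 hx0), abs_of_pos (mem_Ioi.1 hx0)]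
  · filter_upwards [coeFn_expL2 hc (c • v) (-(c • w))] with x hx hx0
    rw [hx, expFun, if_pos (mem_Ioi.1 hx0), abs_of_pos (mem_Ioi.1 hx0), smul_smul]

theorem isPrimitiveOn_expL2_Iio :
    IsPrimitiveOn (Iio 0) (expL2 hc v w) (expL2 hc (c • v) (-(c • w))) w := by
  have h := isPrimitiveOn_of_hasDerivAt (Ω := Iio 0) (f := expL2 hc v w)
    (u := expL2 hc (c • v) (-(c • w)))
    (w := fun x : ℝ => Complex.exp (-c * x) • w)
    (w' := fun x : ℝ => (Complex.exp (-c * x) * -c) • w)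
    (.inr rfl) (fun x => ?_) (by fun_prop) ?_ ?_
  · simpa using h
  · have h1 : HasDerivAt (fun x : ℝ => -c * (x : ℂ)) (-c) x := by
      simpa using (Complex.ofRealCLM.hasDerivAt (x := x)).const_mul (-c)
    exact h1.cexp.smul_const w
  · filter_upwards [coeFn_expL2 hc v w] with x hx hx0
    rw [hx, expFun, if_neg (not_lt.2 (le_of_lt hx0)), abs_of_neg hx0, Complex.ofReal_neg, mul_neg,
      neg_mul]
  · filter_upwards [coeFn_expL2 hc (c • v) (-(c • w))] with x hx hx0
    rw [hx, expFun, if_neg (not_lt.2 (le_of_lt hx0)), abs_of_neg hx0, Complex.ofReal_neg, mul_neg,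
      neg_mul, mul_neg, neg_smul, mul_smul, smul_neg]

theorem expL2_mem_diracMax : ∃ h : expL2 hc v w ∈ (diracMax m).domain,
    diracMax m ⟨_, h⟩ = expL2 hc
      (c • mat (-Complex.I • σ₁) v + mat ((m : ℂ) • σ₃) v)
      (-(c • mat (-Complex.I • σ₁) w) + mat ((m : ℂ) • σ₃) w) ∧
    Gamma₀ m ⟨_, h⟩ = mat (-Complex.I • σ₁) (v - w) ∧
    Gamma₁ m ⟨_, h⟩ = (1 / 2 : ℂ) • (v + w) := by
  obtain ⟨h, h1, h2⟩ := mem_diracMax m (isPrimitiveOn_expL2_Ioi hc v w)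
    (isPrimitiveOn_expL2_Iio hc v w)
  refine ⟨h, h1.trans ?_, h2⟩
  rw [matL2_expL2, matL2_expL2, ← expL2_add, ContinuousLinearMap.map_neg,
    ContinuousLinearMap.map_smul, ContinuousLinearMap.map_smul]

/-! ### The boundary triple -/

theorem surjective_Gamma :
    Function.Surjective fun f : (diracMax m).domain => (Gamma₀ m f, Gamma₁ m f) := by
  rintro ⟨ξ, η⟩
  set J := mat (-Complex.I • σ₁) with hJ
  -- The boundary values solve `J (v - w) = ξ` and `(v + w) / 2 = η`, using `J⁻¹ = -J`. The decay
  -- rate is arbitrary.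
  obtain ⟨h, -, h0, h1⟩ := expL2_mem_diracMax m (c := -1) (by simp)
    (η - (1 / 2 : ℂ) • J ξ) (η + (1 / 2 : ℂ) • J ξ)
  refine ⟨⟨_, h⟩, Prod.ext (h0.trans ?_) (h1.trans ?_)⟩
  · have : η - (1 / 2 : ℂ) • J ξ - (η + (1 / 2 : ℂ) • J ξ) = -J ξ := by module
    rw [this, ContinuousLinearMap.map_neg, mat_neg_I_smul_σ₁_self, neg_neg]
  · module

theorem isSelfAdjoint_restrictKer_diracMax {P : Spinor →ₗ[ℂ] Spinor} (hP : P.IsSymmetric) :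
    IsSelfAdjoint (restrictKer (diracMax m) (Gamma₀ m + P ∘ₗ Gamma₁ m)) :=
  (isSelfAdjoint_restrictKer (dense_diracMin_domain m) (adjoint_diracMin m)
    (diracMin_le_diracMax m) (green_diracMax m) (surjective_Gamma m) hP).2

theorem restrictKer_Gamma₀_eq_add :
    restrictKer (diracMax m) (Gamma₀ m) =
      restrictKer (diracMax m) (Gamma₀ m + (0 : Spinor →ₗ[ℂ] Spinor) ∘ₗ Gamma₁ m) := by
  rw [LinearMap.zero_comp, add_zero]

theorem isSelfAdjoint_restrictKer_Gamma₀ :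
    IsSelfAdjoint (restrictKer (diracMax m) (Gamma₀ m)) := by
  rw [restrictKer_Gamma₀_eq_add]
  exact isSelfAdjoint_restrictKer_diracMax m fun x y => by simp

theorem isSelfAdjoint_diracDelta (η τ lam : ℝ) : IsSelfAdjoint (diracDelta m η τ lam) := by
  refine isSelfAdjoint_restrictKer_diracMax m fun x y => ?_
  have h : (couplingMatrix η τ lam)ᴴ = couplingMatrix η τ lam := by
    ext i j
    fin_cases i <;> fin_cases j <;> simp [couplingMatrix, σ₂, σ₃]
  exact (inner_mat_left _ x y).trans (by rw [h]; rfl)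

theorem isOrdinaryBoundaryTriple :
    IsOrdinaryBoundaryTriple (diracMin m) (diracMax m) (Gamma₀ m) (Gamma₁ m) where
  dense_domain := dense_diracMin_domain m
  isClosed := isClosed_diracMin m
  symmetric := by
    intro x y
    have h := LinearPMap.adjoint_isFormalAdjoint (dense_diracMin_domain m)
    rw [adjoint_diracMin] at h
    have h1 := h ⟨x, (diracMin_le_diracMax m).1 x.2⟩ y
    rwa [← (diracMin_le_diracMax m).2 (x := x) rfl] at h1
  isClosable := by
    rw [← adjoint_diracMin]
    exact (LinearPMap.adjoint_isClosed (dense_diracMin_domain m)).isClosable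
  closure_eq := by
    have hc : (diracMax m).IsClosed := by
      rw [← adjoint_diracMin]
      exact LinearPMap.adjoint_isClosed (dense_diracMin_domain m)
    rw [adjoint_diracMin]
    refine LinearPMap.eq_of_eq_graph ?_
    rw [← hc.isClosable.graph_closure_eq_closure_graph]
    exact hc.submodule_topologicalClosure_eq
  green := green_diracMax m
  selfAdjoint := isSelfAdjoint_restrictKer_Gamma₀ m
  surjective := surjective_Gamma m

/-! ### The continuous spectrum -/

/-- The symbol `κ σ₁ + m σ₃` squares to `κ² + m² = x²`. The eigenvector `(x + m, κ)` degenerates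
exactly at `x = -m`, where `κ = 0` and `(0, 1)` serves. -/
theorem exists_eigenvector {x : ℝ} (hx : m ^ 2 ≤ x ^ 2) : ∃ v : Spinor, v ≠ 0 ∧
    mat (((√(x ^ 2 - m ^ 2) : ℝ) : ℂ) • σ₁ + (m : ℂ) • σ₃) v = (x : ℂ) • v := by
  have hsq : ((√(x ^ 2 - m ^ 2) : ℝ) : ℂ) ^ 2 = x ^ 2 - m ^ 2 := by
    rw [← Complex.ofReal_pow, Real.sq_sqrt (by linarith)]
    push_cast
    rfl
  set κ : ℂ := ((√(x ^ 2 - m ^ 2) : ℝ) : ℂ)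
  by_cases h : x = -m
  · have hκ : κ = 0 := by
      have : κ ^ 2 = 0 := by rw [hsq, h]; push_cast; ring
      simpa using this
    refine ⟨WithLp.toLp 2 ![0, 1], fun h0 => ?_, ?_⟩
    · simpa using congrArg (fun v : Spinor => v 1) h0
    · ext i
      fin_cases i <;> simp [σ₁, σ₃, hκ, h]
  · refine ⟨WithLp.toLp 2 ![x + m, κ], fun h0 => ?_, ?_⟩
    · have h1 : (x : ℂ) + m = 0 := by simpa using congrArg (fun v : Spinor => v 0) h0
      have h2 : x + m = 0 := by exact_mod_cast h1
      exact h (by linarith)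
    · ext i
      fin_cases i
      · simp [σ₁, σ₃]
        linear_combination hsq
      · simp [σ₁, σ₃]
        ring

/-- Approximate eigenvectors: on `(0, ∞)` take the plane wave `e^{iκx} v` damped by `e^{-εx}` minus
the same wave damped by `e^{-4εx}`. The boundary values cancel, so every boundary condition holds,
and `(A - x)` acts with size `O(ε)` relative to the norm. A bounded resolvent excludes this as `ε →
0`. -/
theorem notMem_resSet_of_sq_le (P : Spinor →ₗ[ℂ] Spinor) {x : ℝ} (hx : m ^ 2 ≤ x ^ 2) :
    (x : ℂ) ∉ resSet (restrictKer (diracMax m) (Gamma₀ m + P ∘ₗ Gamma₁ m)) := by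
  intro hres
  obtain ⟨C, hC⟩ := exists_norm_le_of_mem_resSet hres
  obtain ⟨v, hv0, hv⟩ := exists_eigenvector m hx
  set κ : ℝ := √(x ^ 2 - m ^ 2)
  set K : ℝ := ‖matL2 (-Complex.I • σ₁)‖
  have hK : 0 ≤ K := norm_nonneg _
  have hval : ∀ δ : ℝ, (Complex.I * κ - δ) • mat (-Complex.I • σ₁) v + mat ((m : ℂ) • σ₃) v =
      (x : ℂ) • v - (δ : ℂ) • mat (-Complex.I • σ₁) v := by
    intro δ
    have e : (Complex.I * κ) • mat (-Complex.I • σ₁) v + mat ((m : ℂ) • σ₃) v =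
        mat ((κ : ℂ) • σ₁ + (m : ℂ) • σ₃) v := by
      simp only [map_add, map_smul, add_apply, smul_apply, smul_smul]
      congr 2
      linear_combination -(κ : ℂ) * Complex.I_sq
    rw [← hv, ← e]
    module
  have key : ∀ ε : ℝ, 0 < ε → 1 / 2 ≤ 3 * |C| * K * ε := by
    intro ε hε
    have h1 : (Complex.I * κ - (ε : ℝ)).re < 0 := by simpa using hε
    have h4 : (Complex.I * κ - (4 * ε : ℝ)).re < 0 := by simpa using hε
    obtain ⟨d1, a1, b1, c1⟩ := expL2_mem_diracMax m h1 v 0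
    obtain ⟨d4, a4, b4, c4⟩ := expL2_mem_diracMax m h4 v 0
    rw [hval, map_zero, smul_zero, neg_zero, map_zero, add_zero] at a1 a4
    set E1 := expL2 h1 v 0
    set E4 := expL2 h4 v 0
    have hJ1 : expL2 h1 (mat (-Complex.I • σ₁) v) 0 = matL2 (-Complex.I • σ₁) E1 := by
      rw [matL2_expL2, map_zero]
    have hJ4 : expL2 h4 (mat (-Complex.I • σ₁) v) 0 = matL2 (-Complex.I • σ₁) E4 := by
      rw [matL2_expL2, map_zero]
    have hsplit : ∀ {c : ℂ} (hc : c.re < 0) (δ : ℂ), expL2 hc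
        ((x : ℂ) • v - δ • mat (-Complex.I • σ₁) v) 0 = (x : ℂ) • expL2 hc v 0 -
          δ • expL2 hc (mat (-Complex.I • σ₁) v) 0 := by
      intro c hc δ
      rw [← expL2_smul, sub_eq_add_neg, sub_eq_add_neg, ← neg_smul, ← neg_smul, ← expL2_smul,
        ← expL2_add, smul_zero, smul_zero, add_zero]
    rw [hsplit, hJ1] at a1
    rw [hsplit, hJ4] at a4
    let f : (diracMax m).domain := ⟨E1, d1⟩ - ⟨E4, d4⟩
    have hf : (f : L2) ∈ (restrictKer (diracMax m) (Gamma₀ m + P ∘ₗ Gamma₁ m)).domain := by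
      refine mem_restrictKer_domain.2 ⟨f.2, ?_⟩
      change (Gamma₀ m + P ∘ₗ Gamma₁ m) (⟨E1, d1⟩ - ⟨E4, d4⟩) = 0
      have hb : Gamma₀ m ⟨E1, d1⟩ = Gamma₀ m ⟨E4, d4⟩ := b1.trans b4.symm
      have hc : Gamma₁ m ⟨E1, d1⟩ = Gamma₁ m ⟨E4, d4⟩ := c1.trans c4.symm
      rw [map_sub, LinearMap.add_apply, LinearMap.add_apply, LinearMap.comp_apply,
        LinearMap.comp_apply, hb, hc, sub_self]
    have hA : restrictKer (diracMax m) (Gamma₀ m + P ∘ₗ Gamma₁ m) ⟨f, hf⟩ - (x : ℂ) • (f : L2) =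
        ((4 * ε : ℝ) : ℂ) • matL2 (-Complex.I • σ₁) E4 -
          ((ε : ℝ) : ℂ) • matL2 (-Complex.I • σ₁) E1 := by
      rw [restrictKer_apply _ f.2]
      change diracMax m (⟨E1, d1⟩ - ⟨E4, d4⟩) - (x : ℂ) • (E1 - E4) = _
      rw [LinearPMap.map_sub, a1, a4]
      module
    -- The squared norm is inversely proportional to the damping rate, so the factor `4` halves the
    -- norm. The difference therefore keeps norm at least `‖E1‖ / 2`.
    have hn : ‖E4‖ = ‖E1‖ / 2 := by
      have n1 := norm_expL2_right h1 v
      have n4 := norm_expL2_right h4 v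
      have r1 : (Complex.I * κ - (ε : ℝ)).re = -ε := by simp
      have r4 : (Complex.I * κ - (4 * ε : ℝ)).re = -(4 * ε) := by simp
      rw [r1] at n1
      rw [r4] at n4
      have : ‖E4‖ ^ 2 = (‖E1‖ / 2) ^ 2 := by
        rw [div_pow, n1, n4]
        field_simp
        norm_num
      exact (pow_left_inj₀ (norm_nonneg _) (by positivity) two_ne_zero).1 this
    have hpos : 0 < ‖E1‖ := by
      have n1 := norm_expL2_right h1 v
      have r1 : (Complex.I * κ - (ε : ℝ)).re = -ε := by simp
      rw [r1] at n1
      have hv' : 0 < ‖v‖ := norm_pos_iff.2 hv0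
      have : 0 < ‖E1‖ ^ 2 := by
        rw [n1]
        exact div_pos (by positivity) (by linarith)
      exact lt_of_le_of_ne (norm_nonneg _) fun h => by simp [← h] at this
    have hle := hC ⟨f, hf⟩
    rw [hA] at hle
    have hlow : ‖E1‖ / 2 ≤ ‖(f : L2)‖ := by
      have := norm_sub_norm_le E1 E4
      rw [hn] at this
      change _ ≤ ‖E1 - E4‖
      linarith
    have hup : ‖((4 * ε : ℝ) : ℂ) • matL2 (-Complex.I • σ₁) E4 -
        ((ε : ℝ) : ℂ) • matL2 (-Complex.I • σ₁) E1‖ ≤ 3 * ε * K * ‖E1‖ := by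
      refine (norm_sub_le _ _).trans ?_
      rw [norm_smul, norm_smul, Complex.norm_real, Complex.norm_real,
        Real.norm_of_nonneg (by linarith), Real.norm_of_nonneg hε.le]
      have k1 := (matL2 (-Complex.I • σ₁)).le_opNorm E1
      have k4 := (matL2 (-Complex.I • σ₁)).le_opNorm E4
      rw [hn] at k4
      have k1' := mul_le_mul_of_nonneg_left k1 hε.le
      have k4' := mul_le_mul_of_nonneg_left k4 (by linarith : 0 ≤ 4 * ε)
      calc _ ≤ _ := add_le_add k4' k1'
        _ = 3 * ε * K * ‖E1‖ := by ring
    have h5 : ‖E1‖ / 2 ≤ |C| * (3 * ε * K * ‖E1‖) := hlow.trans (hle.trans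
      ((mul_le_mul_of_nonneg_right (le_abs_self C) (norm_nonneg _)).trans
        (mul_le_mul_of_nonneg_left hup (abs_nonneg C))))
    have h6 : 1 / 2 * ‖E1‖ ≤ 3 * |C| * K * ε * ‖E1‖ := by
      calc _ = ‖E1‖ / 2 := by ring
        _ ≤ _ := h5
        _ = _ := by ring
    exact le_of_mul_le_mul_right h6 hpos
  have hD : 0 ≤ 3 * |C| * K := by positivity
  -- For this `ε` the right side of `key` is below `1/4`.
  have h7 := key (1 / (4 * (3 * |C| * K + 1))) (by positivity)
  rw [mul_one_div, le_div_iff₀ (by positivity)] at h7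
  linarith

/-- Nonreal points are covered by self-adjointness. For real `z` with `|z| < |m|`, the bound `‖A₀ f‖
≥ |m| ‖f‖` gives `‖(A₀ - z) f‖ ≥ (|m| - |z|) ‖f‖`. -/
theorem mem_resSet_diracFree {z : ℂ} (hz : ∀ x : ℝ, m ^ 2 ≤ x ^ 2 → z ≠ x) :
    z ∈ resSet (restrictKer (diracMax m) (Gamma₀ m)) := by
  have hsa := isSelfAdjoint_restrictKer_Gamma₀ m
  by_cases him : z.im = 0
  · have hzr : z = (z.re : ℂ) := Complex.ext (by simp) (by simp [him])
    have hlt : |z.re| < |m| := by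
      by_contra h
      exact hz z.re (sq_le_sq.2 (not_lt.1 h)) hzr
    have hb : ∀ u : (restrictKer (diracMax m) (Gamma₀ m)).domain,
        (|m| - |z.re|) * ‖(u : L2)‖ ≤
          ‖restrictKer (diracMax m) (Gamma₀ m) u - z • (u : L2)‖ := by
      rw [restrictKer_Gamma₀]
      intro u
      have h1 := mul_norm_le_norm_diracFree m u
      have h2 := norm_sub_norm_le (diracFree m u) (z • (u : L2))
      have h3 : ‖z‖ = |z.re| := by rw [hzr, Complex.norm_real]; simp
      rw [norm_smul, h3] at h2
      linarith
    refine mem_resSet_of_isSelfAdjoint hsa (sub_pos.2 hlt) hb ?_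
    rwa [hzr, Complex.conj_ofReal, ← hzr]
  · exact mem_resSet_of_im_ne_zero hsa him

end

section

variable {m : ℝ} {z : ℂ}

/-! ### The square root and the functions `k` and `ζ` -/

theorem sq_sub_ne_ofReal (hz : ∀ x : ℝ, m ^ 2 ≤ x ^ 2 → z ≠ x) (r : ℝ) (hr : 0 ≤ r) :
    z ^ 2 - (m : ℂ) ^ 2 ≠ r := by
  intro h
  set s : ℝ := √(m ^ 2 + r)
  have hs : s ^ 2 = m ^ 2 + r := Real.sq_sqrt (by positivity)
  have hsc : (s : ℂ) ^ 2 = (m : ℂ) ^ 2 + r := by exact_mod_cast hs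
  have h1 : (z - s) * (z + s) = 0 := by linear_combination h - hsc
  rcases mul_eq_zero.1 h1 with h2 | h2
  · exact hz s (by linarith) (sub_eq_zero.1 h2)
  · refine hz (-s) (by rw [neg_sq]; linarith) ?_
    rw [Complex.ofReal_neg]
    exact eq_neg_of_add_eq_zero_left h2

theorem kFun_sq (m : ℝ) (z : ℂ) : kFun m z ^ 2 = z ^ 2 - (m : ℂ) ^ 2 := upperSqrt_sq _

theorem kFun_im_pos (hz : ∀ x : ℝ, m ^ 2 ≤ x ^ 2 → z ≠ x) : 0 < (kFun m z).im :=
  upperSqrt_im_pos (sq_sub_ne_ofReal hz)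

/-- The two square roots differ by a sign, so positivity of the imaginary part determines `k`. All
later evaluations of `k` use this rather than the formula with the principal power. -/
theorem kFun_eq (hz : ∀ x : ℝ, m ^ 2 ≤ x ^ 2 → z ≠ x) {w : ℂ} (hw : w ^ 2 = z ^ 2 - (m : ℂ) ^ 2)
    (him : 0 < w.im) : kFun m z = w := by
  have h := kFun_im_pos hz
  rcases sq_eq_sq_iff_eq_or_eq_neg.1 ((kFun_sq m z).trans hw.symm) with h1 | h1
  · exact h1
  · rw [h1, Complex.neg_im] at h
    linarith

theorem ne_ofReal_conj (hz : ∀ x : ℝ, m ^ 2 ≤ x ^ 2 → z ≠ x) :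
    ∀ x : ℝ, m ^ 2 ≤ x ^ 2 → conj z ≠ x := fun x hx h =>
  hz x hx (by rw [← Complex.conj_conj z, h, Complex.conj_ofReal])

theorem kFun_conj (hz : ∀ x : ℝ, m ^ 2 ≤ x ^ 2 → z ≠ x) : kFun m (conj z) = -conj (kFun m z) := by
  refine kFun_eq (ne_ofReal_conj hz) ?_ ?_
  · rw [neg_sq, ← map_pow, kFun_sq, map_sub, map_pow, map_pow, Complex.conj_ofReal]
  · rw [Complex.neg_im, Complex.conj_im, neg_neg]
    exact kFun_im_pos hz

theorem zetaFun_conj (hz : ∀ x : ℝ, m ^ 2 ≤ x ^ 2 → z ≠ x) :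
    zetaFun m (conj z) = -conj (zetaFun m z) := by
  rw [zetaFun, zetaFun, kFun_conj hz, map_div₀, map_add, Complex.conj_ofReal, div_neg]

theorem I_mul_kFun_re_neg (hz : ∀ x : ℝ, m ^ 2 ≤ x ^ 2 → z ≠ x) :
    (Complex.I * kFun m z).re < 0 := by
  rw [Complex.I_mul_re]
  exact neg_neg_of_pos (kFun_im_pos hz)

theorem kFun_ne_zero (hz : ∀ x : ℝ, m ^ 2 ≤ x ^ 2 → z ≠ x) : kFun m z ≠ 0 := fun h => by
  simpa [h] using kFun_im_pos hz

theorem add_ne_zero_of_ne (hz : ∀ x : ℝ, m ^ 2 ≤ x ^ 2 → z ≠ x) : z + m ≠ 0 := fun h =>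
  hz (-m) (by rw [neg_sq]) (by rw [Complex.ofReal_neg]; exact eq_neg_of_add_eq_zero_left h)

/-- All four are consequences of `k² = (z - m)(z + m)`; they are the scalar content of the Dirac
equation for `G_z`. -/
theorem zetaFun_identities (hz : ∀ x : ℝ, m ^ 2 ≤ x ^ 2 → z ≠ x) :
    kFun m z * zetaFun m z = z + m ∧ kFun m z * (zetaFun m z)⁻¹ = z - m ∧
      (z - m) * zetaFun m z = kFun m z ∧ (z + m) * (zetaFun m z)⁻¹ = kFun m z := by
  have hk := kFun_ne_zero hz
  have hzm := add_ne_zero_of_ne hz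
  have hsq := kFun_sq m z
  rw [zetaFun, inv_div]
  refine ⟨by field_simp, ?_, ?_, by field_simp⟩
  · field_simp
    linear_combination hsq
  · field_simp
    linear_combination -hsq

/-! ### The `γ`-field and the Weyl function -/

theorem mat_add_apply (A B : Matrix (Fin 2) (Fin 2) ℂ) (ξ : Spinor) :
    mat (A + B) ξ = mat A ξ + mat B ξ := by
  simp only [map_add, add_apply]

theorem mat_smul_apply (a : ℂ) (A : Matrix (Fin 2) (Fin 2) ℂ) (ξ : Spinor) :
    mat (a • A) ξ = a • mat A ξ := by
  simp only [map_smul, smul_apply]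

/-- The value of `e^{-ik|x|} G_z(x)` for `x > 0`. -/
def greenRight (m : ℝ) (z : ℂ) : Matrix (Fin 2) (Fin 2) ℂ :=
  (Complex.I / 2) • !![zetaFun m z, 1; 1, (zetaFun m z)⁻¹]

/-- The value of `e^{-ik|x|} G_z(x)` for `x < 0`. -/
def greenLeft (m : ℝ) (z : ℂ) : Matrix (Fin 2) (Fin 2) ℂ :=
  (Complex.I / 2) • !![zetaFun m z, -1; -1, (zetaFun m z)⁻¹]

/-- For `x > 0` differentiation of `e^{ik|x|}` is multiplication by `i k`, so this is the equation
`(T - z) G_z ξ = 0` reduced to matrices. On the left half-line the sign of that factor changes. -/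
theorem dirac_greenRight (hz : ∀ x : ℝ, m ^ 2 ≤ x ^ 2 → z ≠ x) :
    (Complex.I * kFun m z) • ((-Complex.I • σ₁) * greenRight m z) +
      ((m : ℂ) • σ₃) * greenRight m z = z • greenRight m z := by
  obtain ⟨h1, h2, h3, h4⟩ := zetaFun_identities hz
  have hI := Complex.I_mul_I
  ext i j
  fin_cases i <;> fin_cases j <;> simp [σ₁, σ₃, greenRight]
  · linear_combination (-(Complex.I / 2)) * h3 - Complex.I / 2 * kFun m z * hI
  · linear_combination (Complex.I / 2) * h2 - Complex.I / 2 * kFun m z * (zetaFun m z)⁻¹ * hI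
  · linear_combination (Complex.I / 2) * h1 - Complex.I / 2 * kFun m z * zetaFun m z * hI
  · linear_combination (-(Complex.I / 2)) * h4 - Complex.I / 2 * kFun m z * hI

theorem dirac_greenLeft (hz : ∀ x : ℝ, m ^ 2 ≤ x ^ 2 → z ≠ x) :
    -((Complex.I * kFun m z) • ((-Complex.I • σ₁) * greenLeft m z)) +
      ((m : ℂ) • σ₃) * greenLeft m z = z • greenLeft m z := by
  obtain ⟨h1, h2, h3, h4⟩ := zetaFun_identities hz
  have hI := Complex.I_mul_I
  ext i j
  fin_cases i <;> fin_cases j <;> simp [σ₁, σ₃, greenLeft]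
  · linear_combination (-(Complex.I / 2)) * h3 - Complex.I / 2 * kFun m z * hI
  · linear_combination (-(Complex.I / 2)) * h2 + Complex.I / 2 * kFun m z * (zetaFun m z)⁻¹ * hI
  · linear_combination (-(Complex.I / 2)) * h1 + Complex.I / 2 * kFun m z * zetaFun m z * hI
  · linear_combination (-(Complex.I / 2)) * h4 - Complex.I / 2 * kFun m z * hI

/-- The factor `i/2` in `G_z` is the normalisation for which the jump yields `Γ₀ γ(z) = I`. -/
theorem jump_green (m : ℝ) (z : ℂ) :
    (-Complex.I • σ₁) * (greenRight m z - greenLeft m z) = 1 := by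
  ext i j
  fin_cases i <;> fin_cases j <;> simp [σ₁, greenRight, greenLeft]

theorem mean_green (m : ℝ) (z : ℂ) :
    (1 / 2 : ℂ) • (greenRight m z + greenLeft m z) = weylMatrix m z := by
  ext i j
  fin_cases i <;> fin_cases j <;> simp [greenRight, greenLeft, weylMatrix] <;> ring

/-- The `γ`-field of the boundary triple, as a linear map into the domain of `S*`. -/
def diracGamma (hz : ∀ x : ℝ, m ^ 2 ≤ x ^ 2 → z ≠ x) : Spinor →ₗ[ℂ] (diracMax m).domain where
  toFun ξ := ⟨expL2 (I_mul_kFun_re_neg hz) (mat (greenRight m z) ξ) (mat (greenLeft m z) ξ),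
    (expL2_mem_diracMax m (I_mul_kFun_re_neg hz) _ _).fst⟩
  map_add' ξ ξ' := Subtype.ext (by
    simp only [ContinuousLinearMap.map_add, expL2_add, Submodule.coe_add])
  map_smul' a ξ := Subtype.ext (by
    simp only [ContinuousLinearMap.map_smul, expL2_smul, Submodule.coe_smul, RingHom.id_apply])

theorem diracMax_diracGamma (hz : ∀ x : ℝ, m ^ 2 ≤ x ^ 2 → z ≠ x)
    (ξ : Spinor) :
    diracMax m (diracGamma hz ξ) = z • (diracGamma hz ξ : L2) := by
  obtain ⟨h, h1, -⟩ := expL2_mem_diracMax m (I_mul_kFun_re_neg hz) (mat (greenRight m z) ξ)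
    (mat (greenLeft m z) ξ)
  refine h1.trans ?_
  change _ = z • expL2 (I_mul_kFun_re_neg hz) (mat (greenRight m z) ξ) (mat (greenLeft m z) ξ)
  rw [← expL2_smul]
  have e1 := congrArg (fun B => mat B ξ) (dirac_greenRight hz)
  have e2 := congrArg (fun B => mat B ξ) (dirac_greenLeft hz)
  simp only [map_add, map_neg, map_smul, map_mul, add_apply, neg_apply, smul_apply,
    mul_apply_eq_comp] at e1 e2
  simp only [map_smul, smul_apply]
  rw [e1, e2]

theorem Gamma₀_diracGamma (hz : ∀ x : ℝ, m ^ 2 ≤ x ^ 2 → z ≠ x)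
    (ξ : Spinor) : Gamma₀ m (diracGamma hz ξ) = ξ := by
  obtain ⟨h, -, h1, -⟩ := expL2_mem_diracMax m (I_mul_kFun_re_neg hz) (mat (greenRight m z) ξ)
    (mat (greenLeft m z) ξ)
  refine h1.trans ?_
  rw [← sub_apply, ← map_sub, ← mat_mul_apply, jump_green, mat_one_apply]

theorem Gamma₁_diracGamma (hz : ∀ x : ℝ, m ^ 2 ≤ x ^ 2 → z ≠ x)
    (ξ : Spinor) : Gamma₁ m (diracGamma hz ξ) = mat (weylMatrix m z) ξ := by
  obtain ⟨h, -, -, h1⟩ := expL2_mem_diracMax m (I_mul_kFun_re_neg hz) (mat (greenRight m z) ξ)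
    (mat (greenLeft m z) ξ)
  refine h1.trans ?_
  rw [← add_apply, ← map_add, ← smul_apply, ← map_smul, mean_green]

theorem coeFn_diracGamma (hz : ∀ x : ℝ, m ^ 2 ≤ x ^ 2 → z ≠ x)
    (ξ : Spinor) : ((diracGamma hz ξ : L2) : ℝ → Spinor) =ᵐ[volume]
    fun x => mat (greenMatrix m z x) ξ := by
  filter_upwards [coeFn_expL2 (I_mul_kFun_re_neg hz) (mat (greenRight m z) ξ)
    (mat (greenLeft m z) ξ), (countable_singleton (0 : ℝ)).ae_notMem volume] with x hx hx0
  refine hx.trans ?_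
  rcases lt_or_gt_of_ne hx0 with h | h
  · have : greenMatrix m z x =
        Complex.exp (Complex.I * kFun m z * (|x| : ℝ)) • greenLeft m z := by
      rw [greenMatrix, greenLeft, sgn, Real.sign_of_neg h, smul_smul, mul_comm]
      norm_num
    rw [this, mat_smul_apply, expFun, if_neg (not_lt.2 h.le)]
  · have : greenMatrix m z x =
        Complex.exp (Complex.I * kFun m z * (|x| : ℝ)) • greenRight m z := by
      rw [greenMatrix, greenRight, sgn, Real.sign_of_pos h, smul_smul, mul_comm]
      norm_num
    rw [this, mat_smul_apply, expFun, if_pos h]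

/-! ### The resolvent set of `A₀` and the boundary maps over it. -/

theorem resSet_diracFree_eq (m : ℝ) :
    resSet (diracFree m) = {z : ℂ | ∀ x : ℝ, m ^ 2 ≤ x ^ 2 → z ≠ x} := by
  rw [← restrictKer_Gamma₀]
  refine Subset.antisymm (fun z hz x hx h => ?_) fun z hz => mem_resSet_diracFree m hz
  rw [restrictKer_Gamma₀_eq_add, h] at hz
  exact notMem_resSet_of_sq_le m 0 hx hz

theorem sq_le_sq_iff_mem (hm : 0 ≤ m) {x : ℝ} : m ^ 2 ≤ x ^ 2 ↔ x ∈ Iic (-m) ∪ Ici m := by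
  rw [sq_le_sq, abs_of_nonneg hm, le_abs']
  rfl

theorem resSet_diracFree (hm : 0 ≤ m) :
    resSet (diracFree m) = ((fun x : ℝ => (x : ℂ)) '' (Iic (-m) ∪ Ici m))ᶜ := by
  rw [resSet_diracFree_eq]
  ext z
  simp only [mem_ofPred_eq, mem_compl_iff, mem_image, not_exists, not_and, sq_le_sq_iff_mem hm]
  exact forall₂_congr fun x _ => ⟨fun h h' => h h'.symm, fun h h' => h h'.symm⟩

theorem gammaField_and_weylFunction
    (hz : ∀ x : ℝ, m ^ 2 ≤ x ^ 2 → z ≠ x) :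
    Function.Bijective ((Gamma₀ m).domRestrict (kerSub (diracMax m) z)) ∧
      (∀ ξ : Spinor, ((gammaField (diracMax m) (Gamma₀ m) z ξ : L2) : ℝ → Spinor) =ᵐ[volume]
        fun x => mat (greenMatrix m z x) ξ) ∧
      weylFunction (diracMax m) (Gamma₀ m) (Gamma₁ m) z = (mat (weylMatrix m z)).toLinearMap := by
  obtain ⟨h1, h2⟩ := gammaField_eq (mem_resSet_diracFree m hz) (diracMax_diracGamma hz)
    (Gamma₀_diracGamma hz)
  refine ⟨h1, fun ξ => ?_, LinearMap.ext fun ξ => ?_⟩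
  · rw [h2]
    exact coeFn_diracGamma hz ξ
  · rw [weylFunction, LinearMap.comp_apply, h2]
    exact Gamma₁_diracGamma hz ξ

/-! ### Krein's formula -/

theorem det_eq_zero_iff_exists_mat {B : Matrix (Fin 2) (Fin 2) ℂ} :
    B.det = 0 ↔ ∃ ξ : Spinor, ξ ≠ 0 ∧ mat B ξ = 0 := by
  rw [← Matrix.exists_mulVec_eq_zero_iff]
  constructor
  · rintro ⟨v, hv, h⟩
    refine ⟨WithLp.toLp 2 v, fun h0 => hv ?_, ?_⟩
    · simpa using congrArg WithLp.ofLp h0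
    · exact congrArg (WithLp.toLp 2) h
  · rintro ⟨ξ, hξ, h⟩
    refine ⟨WithLp.ofLp ξ, fun h0 => hξ ?_, ?_⟩
    · exact congrArg (WithLp.toLp 2) h0
    · exact congrArg WithLp.ofLp h

theorem mat_one_add_mul (P M : Matrix (Fin 2) (Fin 2) ℂ) (ξ : Spinor) :
    mat (1 + P * M) ξ = ξ + mat P (mat M ξ) := by
  rw [mat_add_apply, mat_mul_apply, mat_one_apply]

theorem mem_resSet_diracDelta_iff (hz : ∀ x : ℝ, m ^ 2 ≤ x ^ 2 → z ≠ x)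
    (η τ lam : ℝ) : z ∈ resSet (diracDelta m η τ lam) ↔
    (1 + couplingMatrix η τ lam * weylMatrix m z).det ≠ 0 := by
  rw [diracDelta, mem_resSet_restrictKer_iff (mem_resSet_diracFree m hz) (diracMax_diracGamma hz)
    (Gamma₀_diracGamma hz) (isSelfAdjoint_diracDelta m η τ lam).isClosed, ne_eq,
    det_eq_zero_iff_exists_mat, not_exists]
  refine forall_congr' fun ξ => ?_
  rw [mat_one_add_mul, Gamma₁_diracGamma, not_and, not_imp_not]
  rfl

/-- The functions `k` and `ζ` both change to minus their conjugates under `z ↦ z̄`, and `sgn` is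
odd. -/
theorem greenMatrix_conj (hz : ∀ x : ℝ, m ^ 2 ≤ x ^ 2 → z ≠ x)
    (x : ℝ) :
    greenMatrix m (conj z) x = (greenMatrix m z (-x))ᴴ := by
  have hs : sgn (-x) = -sgn x := by simp [sgn, Real.sign_neg]
  have hsc : conj (sgn x) = sgn x := Complex.conj_ofReal _
  have he : Complex.exp (Complex.I * -conj (kFun m z) * (|x| : ℝ)) =
      conj (Complex.exp (Complex.I * kFun m z * (|x| : ℝ))) := by
    rw [← Complex.exp_conj, map_mul, map_mul, Complex.conj_I, Complex.conj_ofReal]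
    congr 1
    ring
  rw [greenMatrix, greenMatrix, kFun_conj hz, zetaFun_conj hz, hs, abs_neg, he]
  ext i j
  fin_cases i <;> fin_cases j <;> simp [hsc, inv_neg] <;> ring

/-- With `Q = (I + P M(z))⁻¹ P`, this exhibits `g_{z,j}` as `i/2` times the conjugate of `γ(z̄) Q*
e_j`. Square integrability and the pairing with `f` then follow from the `γ`-field. -/
theorem gFun_eq (hz : ∀ x : ℝ, m ^ 2 ≤ x ^ 2 → z ≠ x)
    (P : Matrix (Fin 2) (Fin 2) ℂ) (j : Fin 2) (x : ℝ) :
    gFun m P z j x = (Complex.I / 2) • conjFun (fun x => mat (greenMatrix m (conj z) x)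
      (mat (((1 + P * weylMatrix m z)⁻¹ * P)ᴴ) (EuclideanSpace.single j 1))) x := by
  set Q := (1 + P * weylMatrix m z)⁻¹ * P with hQ
  rw [gFun, ← hQ]
  simp only [conjFun]
  rw [greenMatrix_conj hz, ← mat_mul_apply, ← Matrix.conjTranspose_mul]
  generalize Q * greenMatrix m z (-x) = B
  ext i
  simp [Matrix.mulVec_single, EuclideanSpace.single]

theorem memLp_conjFun {f : ℝ → Spinor} (hf : MemLp f 2 (volume : Measure ℝ)) :
    MemLp (conjFun f) 2 (volume : Measure ℝ) := by
  have hc : Continuous fun v : Spinor => (WithLp.toLp 2 fun i => conj (v i) : Spinor) := by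
    refine (PiLp.continuous_toLp 2 _).comp ?_
    exact continuous_pi fun i => Complex.continuous_conj.comp (EuclideanSpace.proj i).continuous
  refine hf.congr_norm (hc.comp_aestronglyMeasurable hf.1) (Eventually.of_forall fun x => ?_)
  simp [conjFun, EuclideanSpace.norm_eq]

theorem memLp_greenMatrix (hz : ∀ x : ℝ, m ^ 2 ≤ x ^ 2 → z ≠ x)
    (ξ : Spinor) :
    MemLp (fun x => mat (greenMatrix m z x) ξ) 2 (volume : Measure ℝ) :=
  (Lp.memLp (diracGamma hz ξ : L2)).ae_eq (coeFn_diracGamma hz ξ)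

theorem memLp_gFun (hz : ∀ x : ℝ, m ^ 2 ≤ x ^ 2 → z ≠ x)
    (P : Matrix (Fin 2) (Fin 2) ℂ) (j : Fin 2) :
    MemLp (gFun m P z j) 2 (volume : Measure ℝ) := by
  rw [funext (gFun_eq hz P j)]
  have h := memLp_conjFun (memLp_greenMatrix (ne_ofReal_conj hz)
    (mat (((1 + P * weylMatrix m z)⁻¹ * P)ᴴ) (EuclideanSpace.single j 1)))
  exact h.const_smul (Complex.I / 2)

/-- The pairing is `i/2` times the inner product of `f` with `γ(z̄) Q* e_j`; moving `γ(z̄)` across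
by `γ(z̄)* = Γ₁ (A₀ - z)⁻¹` gives the coordinate `j` of the vector in Krein's formula. -/
theorem pairing_gFun (hz : ∀ x : ℝ, m ^ 2 ≤ x ^ 2 → z ≠ x)
    (P : Matrix (Fin 2) (Fin 2) ℂ) (j : Fin 2) (f : L2)
    {h : resolventOp (restrictKer (diracMax m) (Gamma₀ m)) z f ∈ (diracMax m).domain} :
    pairing (gFun m P z j) (conjFun f) = Complex.I / 2 *
      (mat ((1 + P * weylMatrix m z)⁻¹ * P) (Gamma₁ m ⟨_, h⟩)) j := by
  set Q := (1 + P * weylMatrix m z)⁻¹ * P with hQ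
  have hz' := ne_ofReal_conj hz
  set ξ := mat Qᴴ (EuclideanSpace.single j 1) with hξ
  have h1 : (mat Q (Gamma₁ m ⟨_, h⟩)) j = inner ℂ (diracGamma hz' ξ : L2) f := by
    rw [← inner_gamma_conj (green_diracMax m) (mem_resSet_diracFree m hz)
      (diracMax_diracGamma hz') (Gamma₀_diracGamma hz') f (h := h) ξ, hξ, inner_mat_left,
      Matrix.conjTranspose_conjTranspose, EuclideanSpace.inner_single_left, map_one, one_mul]
  rw [h1, L2.inner_def, ← integral_const_mul, pairing]
  refine integral_congr_ae ?_
  filter_upwards [coeFn_diracGamma hz' ξ] with x hx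
  rw [hx, PiLp.inner_apply, Finset.mul_sum]
  refine Finset.sum_congr rfl fun i _ => ?_
  rw [gFun_eq hz, ← hQ, ← hξ]
  simp only [conjFun, PiLp.smul_apply, smul_eq_mul, Complex.conj_conj, RCLike.inner_apply]
  ring

theorem resolventOp_diracDelta (hz : ∀ x : ℝ, m ^ 2 ≤ x ^ 2 → z ≠ x)
    (η τ lam : ℝ) (hzA : z ∈ resSet (diracDelta m η τ lam)) (f : L2) :
    ((resolventOp (diracDelta m η τ lam) z f : L2) : ℝ → Spinor) =ᵐ[volume] fun x =>
      (resolventOp (diracFree m) z f : L2) x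
      - (pairing (gFun m (couplingMatrix η τ lam) z 0) (conjFun f) *
          Complex.exp (Complex.I * kFun m z * (|x| : ℝ))) •
          (WithLp.toLp 2 ![zetaFun m z, sgn x] : Spinor)
      - (pairing (gFun m (couplingMatrix η τ lam) z 1) (conjFun f) *
          Complex.exp (Complex.I * kFun m z * (|x| : ℝ))) •
          (WithLp.toLp 2 ![sgn x, (zetaFun m z)⁻¹] : Spinor) := by
  set P := couplingMatrix η τ lam with hP
  have hdet := (mem_resSet_diracDelta_iff hz η τ lam).1 hzA
  obtain ⟨h, -⟩ := resolventOp_mem_restrictKer (mem_resSet_diracFree m hz) f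
  rw [← restrictKer_Gamma₀]
  -- The solution of `(I + P M(z)) c = P Γ₁ (A₀ - z)⁻¹ f`. The two correction terms of the resolvent
  -- are the columns of `G_z` weighted by the coordinates of `c`, with the factor `i/2` absorbed in
  -- the pairings.
  set c := mat ((1 + P * weylMatrix m z)⁻¹ * P) (Gamma₁ m ⟨_, h⟩) with hc
  obtain ⟨u, hu1, hu2⟩ := krein_solution (P := (mat P).toLinearMap) (mem_resSet_diracFree m hz)
    (diracMax_diracGamma hz) (Gamma₀_diracGamma hz) f (h := h) (c := c) (by
      rw [Gamma₁_diracGamma]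
      refine (mat_one_add_mul P (weylMatrix m z) c).symm.trans ?_
      rw [hc, ← mat_mul_apply, ← mul_assoc, Matrix.mul_nonsing_inv _ (isUnit_iff_ne_zero.2 hdet),
        one_mul]
      rfl)
  rw [resolventOp_eq hzA u hu2, hu1]
  filter_upwards [Lp.coeFn_sub (resolventOp (restrictKer (diracMax m) (Gamma₀ m)) z f)
    (diracGamma hz c : L2), coeFn_diracGamma hz c] with x h1 h2
  rw [h1, Pi.sub_apply, h2, pairing_gFun hz P 0 f (h := h), pairing_gFun hz P 1 f (h := h), ← hc,
    sub_sub]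
  congr 1
  ext i
  fin_cases i <;> simp [greenMatrix, Matrix.mulVec, dotProduct, Fin.sum_univ_two] <;> ring

/-! ### The spectrum -/

/-- Points of the closed half-lines are never isolated, while a finite set off those half-lines
consists of isolated points. -/
theorem discSpec_essSpec_eq {A : L2 →ₗ.[ℂ] L2} {F : Set ℝ} (hF : F.Finite)
    (hlt : ∀ x ∈ F, x ∉ Iic (-m) ∪ Ici m)
    (hspec : spec A = (fun x : ℝ => (x : ℂ)) '' (Iic (-m) ∪ Ici m ∪ F))
    (heig : ∀ x ∈ F, kerSub A (x : ℂ) ≠ ⊥ ∧ FiniteDimensional ℂ (kerSub A (x : ℂ))) :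
    discSpec A = (fun x : ℝ => (x : ℂ)) '' F ∧
      essSpec A = (fun x : ℝ => (x : ℂ)) '' (Iic (-m) ∪ Ici m) := by
  have hdist : ∀ x y : ℝ, dist (x : ℂ) y = |x - y| := fun x y => by
    rw [Complex.dist_eq, ← Complex.ofReal_sub, Complex.norm_real, Real.norm_eq_abs]
  have hdisc : discSpec A = (fun x : ℝ => (x : ℂ)) '' F := by
    refine Subset.antisymm ?_ ?_
    · rintro w ⟨hw, ⟨ε, hε, hiso⟩, -⟩
      rw [hspec] at hw
      obtain ⟨x, hx | hx, rfl⟩ := hw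
      · exfalso
        -- A second spectral point at distance `ε / 2`, found by moving away from the gap,
        -- contradicts isolation.
        have hcon : ∀ y : ℝ, y ∈ Iic (-m) ∪ Ici m → |y - x| = ε / 2 → False := by
          intro y hy hyx
          have h1 := hiso (y : ℂ) (hspec ▸ ⟨y, .inl hy, rfl⟩) (by
            rw [hdist, hyx]
            linarith)
          have h2 : y = x := Complex.ofReal_injective h1
          rw [h2, sub_self, abs_zero] at hyx
          linarith
        rcases hx with hx | hx
        · refine hcon (x - ε / 2) (.inl ?_) ?_
          · rw [mem_Iic] at hx ⊢
            linarith
          · rw [sub_sub_cancel_left, abs_neg, abs_of_pos (by linarith)]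
        · refine hcon (x + ε / 2) (.inr ?_) ?_
          · rw [mem_Ici] at hx ⊢
            linarith
          · rw [add_sub_cancel_left, abs_of_pos (by linarith)]
      · exact ⟨x, hx, rfl⟩
    · rintro w ⟨x, hx, rfl⟩
      refine ⟨hspec ▸ ⟨x, .inr hx, rfl⟩, ?_, heig x hx⟩
      have hcl : IsClosed (Iic (-m) ∪ Ici m ∪ (F \ {x})) :=
        (isClosed_Iic.union isClosed_Ici).union (hF.subset sdiff_subset).isClosed
      have hx' : x ∈ (Iic (-m) ∪ Ici m ∪ (F \ {x}))ᶜ := by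
        rintro (h | h)
        · exact hlt x hx h
        · exact h.2 rfl
      obtain ⟨ε, hε, hball⟩ := Metric.isOpen_iff.1 hcl.isOpen_compl x hx'
      refine ⟨ε, hε, fun w hw hwx => ?_⟩
      rw [hspec] at hw
      obtain ⟨y, hy, rfl⟩ := hw
      simp only [hdist] at hwx
      by_contra hne
      have hyx : y ≠ x := fun h => hne (by rw [h])
      refine hball (Metric.mem_ball.2 (by rwa [Real.dist_eq])) ?_
      rcases hy with hy | hy
      · exact .inl hy
      · exact .inr ⟨hy, hyx⟩
  refine ⟨hdisc, ?_⟩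
  rw [essSpec, hdisc, hspec]
  ext w
  constructor
  · rintro ⟨⟨x, hx | hx, rfl⟩, hn⟩
    · exact ⟨x, hx, rfl⟩
    · exact absurd ⟨x, hx, rfl⟩ hn
  · rintro ⟨x, hx, rfl⟩
    refine ⟨⟨x, .inl hx, rfl⟩, ?_⟩
    rintro ⟨y, hy, hyx⟩
    have : y = x := Complex.ofReal_injective hyx
    exact hlt y hy (this ▸ hx)

theorem essSpec_diracFree (hm : 0 ≤ m) :
    essSpec (diracFree m) = (fun x : ℝ => (x : ℂ)) '' (Iic (-m) ∪ Ici m) := by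
  refine (discSpec_essSpec_eq (F := ∅) finite_empty (by simp) ?_ (by simp)).2
  rw [spec, resSet_diracFree hm, compl_compl, union_empty]

/-- The determinant condition for eigenvalues in the gap. -/
def gapEigenvalues (m η τ lam : ℝ) : Set ℝ :=
  {x | x ^ 2 < m ^ 2 ∧ (1 - dParam η τ lam / 4) * √(m ^ 2 - x ^ 2) + η * x + m * τ = 0}

theorem ne_ofReal_of_sq_lt {x : ℝ} (hx : x ^ 2 < m ^ 2) :
    ∀ y : ℝ, m ^ 2 ≤ y ^ 2 → (x : ℂ) ≠ y := by
  intro y hy h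
  rw [Complex.ofReal_injective h] at hx
  linarith

/-- In the gap `k = i κ` with `κ = √(m² - x²) > 0`. Expanding `det (I + P M) = 1 + tr (P M) + det P
det M` with `det P = d` and `det M = -1/4`, and using `i κ ζ = x + m` and `i κ ζ⁻¹ = x - m`,
multiplication by `κ` gives the stated real expression. -/
theorem det_eq_zero_iff_gap (η τ lam : ℝ) {x : ℝ} (hx : x ^ 2 < m ^ 2) :
    (1 + couplingMatrix η τ lam * weylMatrix m x).det = 0 ↔
      (1 - dParam η τ lam / 4) * √(m ^ 2 - x ^ 2) + η * x + m * τ = 0 := by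
  have hz := ne_ofReal_of_sq_lt hx
  set κ := √(m ^ 2 - x ^ 2) with hκ
  have hκpos : 0 < κ := Real.sqrt_pos.2 (by linarith)
  have hκsq : κ ^ 2 = m ^ 2 - x ^ 2 := Real.sq_sqrt (by linarith)
  have hκc : (κ : ℂ) ^ 2 = (m : ℂ) ^ 2 - (x : ℂ) ^ 2 := by exact_mod_cast hκsq
  have hk : kFun m x = Complex.I * κ := by
    refine kFun_eq hz ?_ ?_
    · rw [mul_pow, Complex.I_sq, hκc]
      ring
    · simpa using hκpos
  have hκ0 : (κ : ℂ) ≠ 0 := by exact_mod_cast hκpos.ne'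
  obtain ⟨h1, h2, -, -⟩ := zetaFun_identities hz
  rw [hk] at h1 h2
  have hdet : (κ : ℂ) * (1 + couplingMatrix η τ lam * weylMatrix m x).det =
      (((1 - dParam η τ lam / 4) * κ + η * x + m * τ : ℝ) : ℂ) := by
    have hζ : zetaFun m x * (zetaFun m x)⁻¹ = 1 := by
      refine mul_inv_cancel₀ fun h0 => add_ne_zero_of_ne hz ?_
      rw [← h1, h0, mul_zero]
    have hI := Complex.I_mul_I
    rw [Matrix.det_fin_two]
    simp only [couplingMatrix, weylMatrix, σ₂, σ₃, dParam, Matrix.add_apply, Matrix.sub_apply,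
      Matrix.mul_apply, Matrix.smul_apply, Fin.sum_univ_two, Matrix.one_apply, smul_eq_mul]
    simp
    linear_combination (1 / 2 * (η + τ) : ℂ) * h1 + (1 / 2 * (η - τ) : ℂ) * h2 +
      (κ * (Complex.I ^ 2 * (η ^ 2 - τ ^ 2) + Complex.I ^ 4 * lam ^ 2) / 4 : ℂ) * hζ +
      (κ * (η ^ 2 - τ ^ 2 + lam ^ 2 * (Complex.I ^ 2 - 1)) / 4 : ℂ) * hI
  constructor
  · intro h
    rw [h, mul_zero] at hdet
    exact_mod_cast hdet.symm
  · intro h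
    rw [h, Complex.ofReal_zero] at hdet
    exact (mul_eq_zero.1 hdet).resolve_left hκ0

theorem spec_diracDelta (hm : 0 ≤ m) (η τ lam : ℝ) : spec (diracDelta m η τ lam) =
    (fun x : ℝ => (x : ℂ)) '' (Iic (-m) ∪ Ici m ∪ gapEigenvalues m η τ lam) := by
  ext z
  rw [spec, mem_compl_iff]
  constructor
  · intro h
    have him : z.im = 0 := by
      by_contra him
      exact h (mem_resSet_of_im_ne_zero (isSelfAdjoint_diracDelta m η τ lam) him)
    have hzr : (z.re : ℂ) = z := Complex.ext (by simp) (by simp [him])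
    refine ⟨z.re, ?_, hzr⟩
    rcases le_or_gt (m ^ 2) (z.re ^ 2) with hx | hx
    · exact .inl ((sq_le_sq_iff_mem hm).1 hx)
    · refine .inr ⟨hx, (det_eq_zero_iff_gap η τ lam hx).1 ?_⟩
      rw [← hzr, mem_resSet_diracDelta_iff (ne_ofReal_of_sq_lt hx), not_not] at h
      exact h
  · rintro ⟨x, hx | hx, rfl⟩
    · exact notMem_resSet_of_sq_le m _ ((sq_le_sq_iff_mem hm).2 hx)
    · simp only
      rw [mem_resSet_diracDelta_iff (ne_ofReal_of_sq_lt hx.1), not_not]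
      exact (det_eq_zero_iff_gap η τ lam hx.1).2 hx.2

theorem kerSub_diracDelta (η τ lam : ℝ) {x : ℝ} (hx : x ∈ gapEigenvalues m η τ lam) :
    kerSub (diracDelta m η τ lam) (x : ℂ) ≠ ⊥ ∧
      FiniteDimensional ℂ (kerSub (diracDelta m η τ lam) (x : ℂ)) := by
  have hz := ne_ofReal_of_sq_lt hx.1
  obtain ⟨ξ, hξ0, hξ⟩ := det_eq_zero_iff_exists_mat.1 ((det_eq_zero_iff_gap η τ lam hx.1).2 hx.2)
  refine kerSub_restrictKer (mem_resSet_diracFree m hz) (diracMax_diracGamma hz)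
    (Gamma₀_diracGamma hz) hξ0 ?_
  rw [Gamma₁_diracGamma]
  exact (mat_one_add_mul _ _ ξ).symm.trans hξ

/-- The square root drops out and the equation is linear. From `η² = τ² + λ² + 4` one has `|τ| <
|η|`, so the root lies in the gap. -/
theorem gapEigenvalues_of_eq {η τ lam : ℝ} (hm : 0 < m) (hd : dParam η τ lam = 4) :
    gapEigenvalues m η τ lam = {-(m * τ / η)} := by
  have hd' := hd
  rw [dParam] at hd'
  have hη2 : τ ^ 2 < η ^ 2 := by nlinarith [sq_nonneg lam]
  have hη : η ≠ 0 := by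
    rintro rfl
    nlinarith [sq_nonneg τ]
  ext x
  rw [gapEigenvalues, mem_ofPred_eq, hd, mem_singleton_iff]
  have hiff : (1 - 4 / 4) * √(m ^ 2 - x ^ 2) + η * x + m * τ = 0 ↔ x = -(m * τ / η) := by
    rw [div_self (by norm_num), sub_self, zero_mul, zero_add]
    constructor
    · intro h
      field_simp
      linarith
    · rintro rfl
      field_simp
      ring
  rw [hiff]
  refine ⟨fun h => h.2, fun h => ⟨?_, h⟩⟩
  rw [h, neg_sq, div_pow, div_lt_iff₀ (by positivity), mul_pow]
  exact mul_lt_mul_of_pos_left hη2 (by positivity)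

/-- With `c = d/4 - 1` the equation is `m τ + η x = c √(m² - x²)`. Squaring loses only the sign,
which is restored by requiring `c (m τ + η x) > 0`; strictness also forces `x² < m²`. -/
theorem gapEigenvalues_of_ne {η τ lam : ℝ} (hd : dParam η τ lam ≠ 4) :
    gapEigenvalues m η τ lam = {x | (x = zPM m η τ lam 1 ∨ x = zPM m η τ lam (-1)) ∧
      0 < (dParam η τ lam - 4) * (m * τ + η * x)} := by
  obtain ⟨c, hc⟩ : ∃ c, c = dParam η τ lam / 4 - 1 := ⟨_, rfl⟩
  have hdc : η ^ 2 - τ ^ 2 - lam ^ 2 = 4 * c + 4 := by rw [hc, dParam]; ring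
  have hd4 : dParam η τ lam = 4 * c + 4 := hdc
  simp only [gapEigenvalues, zPM]
  rw [hd4] at hd ⊢
  have hc0 : c ≠ 0 := fun h => hd (by rw [h]; norm_num)
  rw [show 1 - (4 * c + 4) / 4 = -c by ring, show (4 * c + 4) / 4 - 1 = c by ring,
    show (4 * c + 4) / 4 + 1 = c + 2 by ring, show 4 * c + 4 - 4 = 4 * c by ring]
  have hcpos : 0 < c ^ 2 := by positivity
  have hq : 0 < η ^ 2 + c ^ 2 := by positivity
  set r := √(lam ^ 2 + (c + 2) ^ 2) with hr
  have hrsq : r ^ 2 = lam ^ 2 + (c + 2) ^ 2 := Real.sq_sqrt (by positivity)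
  have hroots : ∀ x : ℝ, (x = m * (-η * τ + 1 * (|c| * r)) / (η ^ 2 + c ^ 2) ∨
      x = m * (-η * τ + -1 * (|c| * r)) / (η ^ 2 + c ^ 2)) ↔
      (m * τ + η * x) ^ 2 = c ^ 2 * (m ^ 2 - x ^ 2) := by
    intro x
    have h1 : (m * τ + η * x) ^ 2 = c ^ 2 * (m ^ 2 - x ^ 2) ↔
        ((η ^ 2 + c ^ 2) * x + m * η * τ) ^ 2 = (m * (|c| * r)) ^ 2 := by
      -- Completing the square; the discriminant takes the form with `r` because `η² - τ² + c² = λ²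
      -- + (c + 2)²`.
      have e : ((η ^ 2 + c ^ 2) * x + m * η * τ) ^ 2 - (m * (|c| * r)) ^ 2 =
          (η ^ 2 + c ^ 2) * ((m * τ + η * x) ^ 2 - c ^ 2 * (m ^ 2 - x ^ 2)) := by
        rw [mul_pow, mul_pow, sq_abs, hrsq]
        linear_combination (m ^ 2 * c ^ 2) * hdc
      rw [← sub_eq_zero, ← sub_eq_zero (a := ((η ^ 2 + c ^ 2) * x + m * η * τ) ^ 2), e,
        mul_eq_zero, or_iff_right hq.ne']
    rw [h1, sq_eq_sq_iff_eq_or_eq_neg, eq_div_iff hq.ne', eq_div_iff hq.ne']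
    refine or_congr ⟨fun h => by linarith, fun h => by linarith⟩
      ⟨fun h => by linarith, fun h => by linarith⟩
  ext x
  rw [mem_ofPred_eq, mem_ofPred_eq, hroots]
  constructor
  · rintro ⟨hx, h⟩
    have hκ : 0 < √(m ^ 2 - x ^ 2) := Real.sqrt_pos.2 (by linarith)
    have hκsq : √(m ^ 2 - x ^ 2) ^ 2 = m ^ 2 - x ^ 2 := Real.sq_sqrt (by linarith)
    have h2 : m * τ + η * x = c * √(m ^ 2 - x ^ 2) := by linarith
    rw [h2, mul_pow, hκsq]
    refine ⟨rfl, ?_⟩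
    have : 4 * c * (c * √(m ^ 2 - x ^ 2)) = 4 * (c ^ 2 * √(m ^ 2 - x ^ 2)) := by ring
    rw [this]
    positivity
  · rintro ⟨h1, h2⟩
    have hu : m * τ + η * x ≠ 0 := fun h => by simp [h] at h2
    have hx : 0 < m ^ 2 - x ^ 2 := by
      have h3 : 0 < c ^ 2 * (m ^ 2 - x ^ 2) := by
        rw [← h1]
        positivity
      exact (mul_pos_iff_of_pos_left hcpos).1 h3
    have hκ : 0 < √(m ^ 2 - x ^ 2) := Real.sqrt_pos.2 hx
    have hκsq : √(m ^ 2 - x ^ 2) ^ 2 = m ^ 2 - x ^ 2 := Real.sq_sqrt hx.le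
    refine ⟨by linarith, ?_⟩
    rw [← hκsq, ← mul_pow, sq_eq_sq_iff_eq_or_eq_neg] at h1
    rcases h1 with h1 | h1
    · linarith
    · exfalso
      rw [h1] at h2
      have h3 : 0 < c ^ 2 * √(m ^ 2 - x ^ 2) := by positivity
      nlinarith

theorem finite_gapEigenvalues (hm : 0 ≤ m) (η τ lam : ℝ) : (gapEigenvalues m η τ lam).Finite := by
  rcases hm.eq_or_lt with rfl | hm
  -- For `m = 0` there is no gap.
  · refine finite_empty.subset fun x hx => ?_
    have := hx.1
    nlinarith [sq_nonneg x]
  by_cases hd : dParam η τ lam = 4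
  · rw [gapEigenvalues_of_eq hm hd]
    exact finite_singleton _
  · rw [gapEigenvalues_of_ne hd]
    exact (toFinite {zPM m η τ lam 1, zPM m η τ lam (-1)}).subset fun x hx => hx.1

theorem discSpec_essSpec_diracDelta (hm : 0 ≤ m) (η τ lam : ℝ) :
    discSpec (diracDelta m η τ lam) = (fun x : ℝ => (x : ℂ)) '' gapEigenvalues m η τ lam ∧
      essSpec (diracDelta m η τ lam) = (fun x : ℝ => (x : ℂ)) '' (Iic (-m) ∪ Ici m) :=
  discSpec_essSpec_eq (finite_gapEigenvalues hm η τ lam)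
    (fun x hx h => by
      have := (sq_le_sq_iff_mem hm).2 h
      linarith [hx.1])
    (spec_diracDelta hm η τ lam) fun x hx => kerSub_diracDelta η τ lam hx

end

end DeltaDirac

end

theorem mainTheorem12 (m : ℝ) (hm : 0 ≤ m) :
    -- the adjoint of `S`
    (diracMin m)† = diracMax m ∧
    -- the boundary triple, the operator `A₀` and its resolvent set
    IsOrdinaryBoundaryTriple (diracMin m) (diracMax m) (Gamma₀ m) (Gamma₁ m) ∧
    restrictKer (diracMax m) (Gamma₀ m) = diracFree m ∧
    resSet (diracFree m) = ((fun x : ℝ => (x : ℂ)) '' (Iic (-m) ∪ Ici m))ᶜ ∧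
    -- the `γ`-field and the Weyl function
    (∀ z ∈ resSet (diracFree m),
      Function.Bijective ((Gamma₀ m).domRestrict (kerSub (diracMax m) z)) ∧
      (∀ ξ : Spinor,
        ((gammaField (diracMax m) (Gamma₀ m) z ξ : L2) : ℝ → Spinor) =ᵐ[volume]
          fun x => mat (greenMatrix m z x) ξ) ∧
      weylFunction (diracMax m) (Gamma₀ m) (Gamma₁ m) z = (mat (weylMatrix m z)).toLinearMap) ∧
    ∀ η τ lam : ℝ,
      IsSelfAdjoint (diracDelta m η τ lam) ∧
      -- the resolvent formula
      (∀ z ∈ resSet (diracFree m) ∩ resSet (diracDelta m η τ lam),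
        IsUnit (1 + couplingMatrix η τ lam * weylMatrix m z).det ∧
        (∀ j, MemLp (gFun m (couplingMatrix η τ lam) z j) 2 volume) ∧
        ∀ f : L2,
          ((resolventOp (diracDelta m η τ lam) z f : L2) : ℝ → Spinor) =ᵐ[volume] fun x =>
            (resolventOp (diracFree m) z f : L2) x
            - (pairing (gFun m (couplingMatrix η τ lam) z 0) (conjFun f) *
                Complex.exp (Complex.I * kFun m z * (|x| : ℝ))) •
                (WithLp.toLp 2 ![zetaFun m z, sgn x] : Spinor)
            - (pairing (gFun m (couplingMatrix η τ lam) z 1) (conjFun f) *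
                Complex.exp (Complex.I * kFun m z * (|x| : ℝ))) •
                (WithLp.toLp 2 ![sgn x, (zetaFun m z)⁻¹] : Spinor)) ∧
      -- the essential spectrum
      essSpec (diracDelta m η τ lam) = essSpec (diracFree m) ∧
      essSpec (diracFree m) = (fun x : ℝ => (x : ℂ)) '' (Iic (-m) ∪ Ici m) ∧
      -- the discrete spectrum
      (0 < m →
        (dParam η τ lam = 4 →
          discSpec (diracDelta m η τ lam) = {((-(m * τ / η) : ℝ) : ℂ)}) ∧
        (dParam η τ lam ≠ 4 →
          discSpec (diracDelta m η τ lam) = (fun x : ℝ => (x : ℂ)) ''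
            {x | (x = zPM m η τ lam 1 ∨ x = zPM m η τ lam (-1)) ∧
              0 < (dParam η τ lam - 4) * (m * τ + η * x)})) := by
  refine ⟨adjoint_diracMin m, isOrdinaryBoundaryTriple m, restrictKer_Gamma₀ m,
    resSet_diracFree hm, fun z hz => ?_, fun η τ lam => ?_⟩
  · rw [resSet_diracFree_eq] at hz
    exact gammaField_and_weylFunction hz
  obtain ⟨hdisc, hess⟩ := discSpec_essSpec_diracDelta hm η τ lam
  refine ⟨isSelfAdjoint_diracDelta m η τ lam, ?_, hess.trans (essSpec_diracFree hm).symm,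
    essSpec_diracFree hm, fun hm' => ⟨fun hd => ?_, fun hd => ?_⟩⟩
  · rintro z ⟨hz, hzA⟩
    rw [resSet_diracFree_eq] at hz
    exact ⟨isUnit_iff_ne_zero.2 ((mem_resSet_diracDelta_iff hz η τ lam).1 hzA),
      memLp_gFun hz _, resolventOp_diracDelta hz η τ lam hzA⟩
  · rw [hdisc, gapEigenvalues_of_eq hm' hd, image_singleton]
  · rw [hdisc, gapEigenvalues_of_ne hd]
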